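/- **Setting.** Let $n\ge 1$, $s\in(0,1)$, $\gamma\in(0,1]$, $n\neq 2s$, let $\Omega\subset\mathbb R^n$ be a non-empty bounded open set (e.g. of class $C^{1,1}$), and let $\delta(x)=\operatorname{dist}(x,\partial\Omega)$. Let $\mathcal L$ be a non-negative linear operator on $L^2(\Omega)$ (with a domain) which has a Green's function $\mathcal G_0$: for $u,f\in L^2(\Omega)$, $u\in\operatorname{dom}\mathcal L$ and $\mathcal Lu=f$ if and only if $u(x)=\int_\Omega \mathcal G_0(x,y)f(y)\,dy$ for a.e. $x$. Assume that $\mathcal G_0$ is measurable and satisfies (K1): for some $c>0$ and all $x\ne y$ in $\Omega$, $\mathcal G_0(x,y)=\mathcal G_0(y,x)$ and $c^{-1}k(x,y)\le\mathcal G_0(x,y)\le c\,k(x,y)$, where $$k(x,y)=\frac1{|x-y|^{n-2s}}\Big(\frac{\delta(x)^\gamma}{|x-y|^\gamma}\wedge1\Big)\Big(\frac{\delta(y)^\gamma}{|x-y|^\gamma}\wedge1\Big).$$ Then $\mathcal L$ has eigenvalues $\lambda_1\le\lambda_2\le\cdots\to+\infty$, repeated according to multiplicity, with an orthonormal basis $(\varphi_j)_{j\ge1}$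 of $L^2(\Omega)$ made of eigenfunctions, $\mathcal L\varphi_j=\lambda_j\varphi_j$. Fix any such $(\lambda_j,\varphi_j)$ and write $\Sigma=\{\lambda_j\}$. For $\lambda\in\mathbb R\setminus\Sigma$ put $I=\min\{j\ge 1:\lambda_j\ge\lambda,\ \lambda_{j+1}>\lambda_j\}$, $\bar\lambda=\lambda_{I+1}$, and $\mathbb G_\lambda(\psi)=\sum_{j\ge1}\frac{\langle\psi,\varphi_j\rangle}{\lambda_j-\lambda}\varphi_j$ for $\psi\in L^2(\Omega)$. For $f\in L^1(\Omega;\delta^\gamma)$ (that is, $f\delta^\gamma\in L^1(\Omega)$), a *weak solution* of $\mathcal Lu-\lambda u=f$ in $\Omega$, $Bu=0$ on $\partial\Omega$ (homogeneous boundary condition) is a function $u\in L^1(\Omega;\delta^\gamma)$ with $\int_\Omega u\psi=\int_\Omega f\,\mathbb G_\lambda(\psi)$ for all $\psi\in\delta^\gamma L^\infty(\Omega)$, the integral on the right being absolutely convergent. **Theorem (Projection and uniform estimates).** Let $\lambda\in\mathbb R\setminus\Sigma$ and $f\in L^1(\Omega;\delta^\gamma)$. There is a weak solution $u$ with datum $f$,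 unique up to null sets. The integrals $\langle f,\varphi_j\rangle=\int_\Omega f\varphi_j$ converge absolutely. With $$f^\perp=f-\sum_{j=1}^I\langle f,\varphi_j\rangle\varphi_j\in L^1(\Omega;\delta^\gamma)$$ there is a weak solution $u^\perp=\mathbb G_\lambda(f^\perp)$ with datum $f^\perp$, unique up to null sets, and $$u=\sum_{j=1}^I\frac{\langle f,\varphi_j\rangle}{\lambda_j-\lambda}\varphi_j+u^\perp\quad\text{a.e. in }\Omega.$$ Moreover the following estimates hold for all $\lambda\in\mathbb R\setminus\Sigma$ with $\lambda\ge-\Lambda$, where $\Lambda\in\mathbb R$ is arbitrary. The constants $C$ depend, besides the fixed setting above (including the choice of $(\lambda_j,\varphi_j)$), only on $\bar\lambda$, on $\Lambda$ and on the arguments shown; in particular they do not depend on $f$ or on the distance from $\lambda$ to $\Sigma$. 1. $\|u^\perp\delta^\gamma\|_{L^1(\Omega)}\le C(\bar\lambda,\Lambda)\,\|f\delta^\gamma\|_{L^1(\Omega)}$ for $f\in L^1(\Omega;\delta^\gamma)$. 2. $\|u^\perp\|_{L^p(\Omega)}\le C(p,\bar\lambda,\Lambda)\,\|f\|_{L^1(\Omega)}$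 for $f\in L^1(\Omega)$ and $p\in[1,\frac n{n-2s})$. 3. $\|u^\perp\|_{L^{p_1}(\Omega)}\le C(p_0,p_1,\bar\lambda,\Lambda)\,\|f\|_{L^{p_0}(\Omega)}$ for $f\in L^{p_0}(\Omega)$, $p_0\in(1,\frac n{2s})$ and $\frac1{p_1}=\frac1{p_0}-\frac{2s}n$. 4. $\|u^\perp\|_{L^\infty(K)}\le C(\bar\lambda,\Lambda,K,K_0)\,\big(\|f\|_{L^\infty(K_0)}+\|f\delta^\gamma\|_{L^1(\Omega)}\big)$ for $f\in L^1(\Omega;\delta^\gamma)\cap L^\infty_{\rm loc}(\Omega)$ and $K\Subset K_0\Subset\Omega$, where $A\Subset B$ means that the closure of $A$ lies in the interior of $B$. -/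

import Mathlib

open MeasureTheory Set Filter
open scoped ENNReal NNReal

noncomputable section

namespace GreenEig

/-- Points of `ℝⁿ` with the Euclidean norm. -/
abbrev Pt (n : ℕ) : Type := EuclideanSpace ℝ (Fin n)

/-- Lebesgue measure on `Ω`. -/
abbrev mu {n : ℕ} (Ω : Set (Pt n)) : Measure (Pt n) := volume.restrict Ω

/-- The real Hilbert space `L²(Ω)`. -/
abbrev L2 {n : ℕ} (Ω : Set (Pt n)) : Type := Lp ℝ 2 (mu Ω)

/-- The distance to the boundary, `δ(x) = dist(x, ∂Ω)`. -/
def bdist {n : ℕ} (Ω : Set (Pt n)) (x : Pt n) : ℝ := Metric.infDist x (frontier Ω)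

/-- The model kernel
`|x-y|^{-(n-2s)} (δ(x)^γ / |x-y|^γ ∧ 1) (δ(y)^γ / |x-y|^γ ∧ 1)`. -/
def modelKernel {n : ℕ} (s γ : ℝ) (Ω : Set (Pt n)) (x y : Pt n) : ℝ :=
  1 / dist x y ^ ((n : ℝ) - 2 * s)
    * min (bdist Ω x ^ γ / dist x y ^ γ) 1 * min (bdist Ω y ^ γ / dist x y ^ γ) 1

/-- Condition (K1) on a kernel `G` on `Ω × Ω` off the diagonal: it is measurable, symmetric, and
comparable to the model kernel (the values on the diagonal and outside `Ω × Ω` play no role). -/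
structure GreenBounds {n : ℕ} (s γ : ℝ) (Ω : Set (Pt n)) (G : Pt n → Pt n → ℝ) : Prop where
  measurable : Measurable (Function.uncurry G)
  symm : ∀ x ∈ Ω, ∀ y ∈ Ω, x ≠ y → G x y = G y x
  comparable : ∃ c : ℝ, 0 < c ∧ ∀ x ∈ Ω, ∀ y ∈ Ω, x ≠ y →
    c⁻¹ * modelKernel s γ Ω x y ≤ G x y ∧ G x y ≤ c * modelKernel s γ Ω x y

/-- `G` is the Green function of the operator `L` on `L²(Ω)`: the solutions of `L u = f` are
exactly given by `u(x) = ∫_Ω G(x,y) f(y) dy`. -/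
def IsGreenFunction {n : ℕ} {Ω : Set (Pt n)} (L : L2 Ω →ₗ.[ℝ] L2 Ω) (G : Pt n → Pt n → ℝ) : Prop :=
  ∀ u f : L2 Ω, (∃ h : u ∈ L.domain, L ⟨u, h⟩ = f) ↔
    (u : Pt n → ℝ) =ᵐ[mu Ω] fun x => ∫ y in Ω, G x y * f y

/-- `L` is a non-negative operator: `⟨L u, u⟩ ≥ 0` on its domain. -/
def IsNonneg {n : ℕ} {Ω : Set (Pt n)} (L : L2 Ω →ₗ.[ℝ] L2 Ω) : Prop :=
  ∀ u : L.domain, 0 ≤ inner ℝ (L u) (u : L2 Ω)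

/-- The eigenvalues of `L`, in non-decreasing order, repeated according to multiplicity and tending
to infinity, with an orthonormal basis of `L²(Ω)` made of eigenfunctions.
Indices start at `0`: `lam j` and `φ j` are `λ_{j+1}` and `φ_{j+1}` of the usual numbering. -/
structure IsEigenSystem {n : ℕ} {Ω : Set (Pt n)} (L : L2 Ω →ₗ.[ℝ] L2 Ω)
    (lam : ℕ → ℝ) (φ : HilbertBasis ℕ ℝ (L2 Ω)) : Prop where
  mono : Monotone lam
  tendsto : Tendsto lam atTop atTop
  eigen : ∀ j, ∃ h : φ j ∈ L.domain, L ⟨φ j, h⟩ = lam j • φ j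

/-- `f ∈ L¹(Ω; δ^γ)`. -/
def MemL1w {n : ℕ} (γ : ℝ) (Ω : Set (Pt n)) (f : Pt n → ℝ) : Prop :=
  Integrable (fun x => f x * bdist Ω x ^ γ) (mu Ω)

/-- `ψ ∈ δ^γ L^∞(Ω)`, for `ψ` given as an element of `L²(Ω)`
(on a bounded `Ω`, `δ^γ L^∞(Ω)` is contained in `L²(Ω)`). -/
def MemWLinf {n : ℕ} (γ : ℝ) {Ω : Set (Pt n)} (ψ : L2 Ω) : Prop :=
  ∃ M : ℝ, ∀ᵐ x ∂(mu Ω), |ψ x| ≤ M * bdist Ω x ^ γ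

/-- `f ∈ L^∞_loc(Ω)`. -/
def MemLinfLoc {n : ℕ} (Ω : Set (Pt n)) (f : Pt n → ℝ) : Prop :=
  ∀ K : Set (Pt n), IsCompact K → K ⊆ Ω → MemLp f ∞ (volume.restrict K)

/-- The solution operator `𝔾_l` on `L²(Ω)`, for `l` outside the spectrum:
`𝔾_l(g) = ∑_j ⟨g, φ_j⟩ / (λ_j - l) φ_j`, the series converging in `L²(Ω)`. -/
def solOp {n : ℕ} {Ω : Set (Pt n)} (lam : ℕ → ℝ) (φ : HilbertBasis ℕ ℝ (L2 Ω)) (l : ℝ)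
    (g : L2 Ω) : L2 Ω :=
  ∑' j, (inner ℝ (φ j) g / (lam j - l)) • φ j

/-- `u` is a `𝔾_l(δ^γ L^∞(Ω))`-weak solution of `L u - l u = f` in `Ω`, `B u = 0` on `∂Ω`:
`f, u ∈ L¹(Ω; δ^γ)` and `∫ u ψ = ∫ f 𝔾_l(ψ)` for all `ψ ∈ δ^γ L^∞(Ω)`, the integral on the right
being absolutely convergent. -/
structure IsWeakSol {n : ℕ} (γ : ℝ) {Ω : Set (Pt n)} (lam : ℕ → ℝ)
    (φ : HilbertBasis ℕ ℝ (L2 Ω)) (l : ℝ) (f u : Pt n → ℝ) : Prop where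
  data_mem : MemL1w γ Ω f
  sol_mem : MemL1w γ Ω u
  integrable : ∀ ψ : L2 Ω, MemWLinf γ ψ → Integrable (fun x => f x * solOp lam φ l ψ x) (mu Ω)
  weak : ∀ ψ : L2 Ω, MemWLinf γ ψ → ∫ x in Ω, u x * ψ x = ∫ x in Ω, f x * solOp lam φ l ψ x

/-- The number `I = min {j ≥ 1 : λ_j ≥ l and λ_{j+1} > λ_j}` of low eigenfunctions
(`λ_j` is `lam (j - 1)`). -/
def lowCount (lam : ℕ → ℝ) (l : ℝ) : ℕ := sInf {j : ℕ | l ≤ lam j ∧ lam j < lam (j + 1)} + 1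

/-- The eigenvalue `λ_{I+1}`, usually written with a bar over `l`. -/
def lamBar (lam : ℕ → ℝ) (l : ℝ) : ℝ := lam (lowCount lam l)

/-- The pairing `⟨f, φ⟩ = ∫_Ω f φ`. -/
def pairing {n : ℕ} {Ω : Set (Pt n)} (f : Pt n → ℝ) (e : L2 Ω) : ℝ := ∫ x in Ω, f x * e x

/-- `f^⊥ = f - ∑_{j ≤ I} ⟨f, φ_j⟩ φ_j`. -/
def perp {n : ℕ} {Ω : Set (Pt n)} (lam : ℕ → ℝ) (φ : HilbertBasis ℕ ℝ (L2 Ω)) (l : ℝ)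
    (f : Pt n → ℝ) : Pt n → ℝ :=
  fun x => f x - ∑ j ∈ Finset.range (lowCount lam l), pairing f (φ j) * φ j x

end GreenEig

end

/-!
The absolute value of the Green function gains regularity at each iteration, in two ways at once:
composing with it lowers the singularity on the diagonal and trades powers of `|x - y|` for powers
of `δ`. Hence some iterate of the potential operator maps `L¹(Ω; δ^γ)` into `δ^γ L^∞(Ω)`, and a
function dominated by its own potential is bounded by finitely many iterated potentials of its
datum plus a multiple of its `L¹(Ω; δ^γ)` norm times `δ^γ`. Eigenfunctions and images of the
resolvent therefore lie in `δ^γ L^∞(Ω)`, which makes the weak formulation dual to the spectral one.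

For the estimates, the resolvent restricted to the span of the high eigenfunctions is bounded on
`L²(Ω)` in terms of the gap between the low and the high eigenvalues alone, so the iteration bounds
it in `δ^γ L^∞(Ω)` with the same uniformity. Duality turns this into the `L¹(Ω; δ^γ)` estimate of
`u^⊥`, and the iteration, now applied to `u^⊥`, reduces the remaining estimates to those of
finitely many iterated potentials of `f`.
-/

namespace GreenEig

section Potential

variable {α : Type*} [MeasurableSpace α] {μ : Measure α} {κ : α → α → ℝ≥0∞} {F F' : α → ℝ≥0∞}

/-- The potential `x ↦ ∫ κ(x, y) F(y) dμ(y)` of a non-negative density `F`; for fixed `μ` and `κ` it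
is an operator, whose iterates are the `(potential μ κ)^[i]`. -/
noncomputable def potential (μ : Measure α) (κ : α → α → ℝ≥0∞) (F : α → ℝ≥0∞) (x : α) : ℝ≥0∞ :=
  ∫⁻ y, κ x y * F y ∂μ

lemma potential_congr_ae (h : F =ᵐ[μ] F') : potential μ κ F = potential μ κ F' := by
  ext x
  refine lintegral_congr_ae ?_
  filter_upwards [h] with y hy
  rw [hy]

lemma potential_mono_ae (h : F ≤ᵐ[μ] F') (x : α) : potential μ κ F x ≤ potential μ κ F' x := by
  refine lintegral_mono_ae ?_
  filter_upwards [h] with y hy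
  gcongr

lemma potential_iterate_mono_ae (h : F ≤ᵐ[μ] F') (i : ℕ) :
    (potential μ κ)^[i] F ≤ᵐ[μ] (potential μ κ)^[i] F' := by
  induction i with
  | zero => exact h
  | succ i ih =>
    simp_rw [Function.iterate_succ_apply']
    exact Eventually.of_forall (potential_mono_ae ih)

section Measurable

variable (hκ : Measurable (Function.uncurry κ))
include hκ

lemma aemeasurable_kernel_mul (hF : AEMeasurable F μ) (x : α) :
    AEMeasurable (fun y => κ x y * F y) μ :=
  hκ.of_uncurry_left.aemeasurable.mul hF

lemma potential_add (hF : AEMeasurable F μ) (x : α) :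
    potential μ κ (fun y => F y + F' y) x = potential μ κ F x + potential μ κ F' x := by
  simp_rw [potential, mul_add]
  exact lintegral_add_left' (aemeasurable_kernel_mul hκ hF x) _

lemma potential_const_mul (hF : AEMeasurable F μ) (c : ℝ≥0∞) (x : α) :
    potential μ κ (fun y => c * F y) x = c * potential μ κ F x := by
  simp_rw [potential, mul_left_comm _ c]
  exact lintegral_const_mul'' _ (aemeasurable_kernel_mul hκ hF x)

variable [SFinite μ]

lemma measurable_potential (hF : AEMeasurable F μ) : Measurable (potential μ κ F) := by
  rw [potential_congr_ae hF.ae_eq_mk]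
  exact Measurable.lintegral_prod_right (f := fun x y => κ x y * hF.mk F y)
    (hκ.mul (hF.measurable_mk.comp measurable_snd))

lemma aemeasurable_potential_iterate (hF : AEMeasurable F μ) (i : ℕ) :
    AEMeasurable ((potential μ κ)^[i] F) μ := by
  induction i with
  | zero => exact hF
  | succ i ih =>
    rw [Function.iterate_succ_apply']
    exact (measurable_potential hκ ih).aemeasurable

lemma potential_iterate_const_mul (hF : AEMeasurable F μ) (c : ℝ≥0∞) (i : ℕ) :
    (potential μ κ)^[i] (fun y => c * F y) = fun y => c * (potential μ κ)^[i] F y := by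
  induction i with
  | zero => rfl
  | succ i ih =>
    simp_rw [Function.iterate_succ_apply']
    ext x
    rw [ih, potential_const_mul hκ (aemeasurable_potential_iterate hκ hF i)]

lemma potential_iterate_add (hF : AEMeasurable F μ) (hF' : AEMeasurable F' μ) (i : ℕ) :
    (potential μ κ)^[i] (fun y => F y + F' y)
      = fun y => (potential μ κ)^[i] F y + (potential μ κ)^[i] F' y := by
  induction i generalizing F F' with
  | zero => rfl
  | succ i ih =>
    simp_rw [Function.iterate_succ_apply]
    rw [← ih (measurable_potential hκ hF).aemeasurable (measurable_potential hκ hF').aemeasurable]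
    exact congrArg _ (funext (potential_add hκ hF))

lemma ae_le_sum_potential_iterate {V : α → ℝ≥0∞} (hF : AEMeasurable F μ) (hV : AEMeasurable V μ)
    (A : ℝ≥0∞)
    (h : ∀ᵐ x ∂μ, V x ≤ potential μ κ F x + A * potential μ κ V x) (N : ℕ) :
    ∀ᵐ x ∂μ, V x ≤ (∑ i ∈ Finset.range N, A ^ i * (potential μ κ)^[i + 1] F x)
      + A ^ N * (potential μ κ)^[N] V x := by
  induction N with
  | zero => exact Eventually.of_forall fun x => by simp
  | succ N ih =>
    have hstep := potential_iterate_mono_ae (κ := κ) h N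
    filter_upwards [ih, hstep] with x hx hstep_x
    rw [potential_iterate_add hκ (measurable_potential hκ hF).aemeasurable
        ((measurable_potential hκ hV).aemeasurable.const_mul A),
      potential_iterate_const_mul hκ (measurable_potential hκ hV).aemeasurable,
      ← Function.iterate_succ_apply, ← Function.iterate_succ_apply] at hstep_x
    calc V x ≤ (∑ i ∈ Finset.range N, A ^ i * (potential μ κ)^[i + 1] F x)
          + A ^ N * (potential μ κ)^[N] V x := hx
      _ ≤ (∑ i ∈ Finset.range N, A ^ i * (potential μ κ)^[i + 1] F x)
          + A ^ N * ((potential μ κ)^[N + 1] F x + A * (potential μ κ)^[N + 1] V x) := by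
        gcongr
      _ = _ := by rw [Finset.sum_range_succ]; ring

section Symmetric

variable (hsymm : ∀ᵐ x ∂μ, ∀ᵐ y ∂μ, κ x y = κ y x)
include hsymm

lemma lintegral_potential_mul (hF : AEMeasurable F μ) (hF' : AEMeasurable F' μ) :
    ∫⁻ x, potential μ κ F x * F' x ∂μ = ∫⁻ x, F x * potential μ κ F' x ∂μ := by
  calc ∫⁻ x, potential μ κ F x * F' x ∂μ
      = ∫⁻ x, ∫⁻ y, κ x y * F y * F' x ∂μ ∂μ :=
        lintegral_congr fun x => (lintegral_mul_const'' _ (aemeasurable_kernel_mul hκ hF x)).symm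
    _ = ∫⁻ y, ∫⁻ x, κ x y * F y * F' x ∂μ ∂μ :=
        lintegral_lintegral_swap ((hκ.aemeasurable.mul hF.comp_snd).mul hF'.comp_fst)
    _ = ∫⁻ y, F y * potential μ κ F' y ∂μ := by
        refine lintegral_congr_ae ?_
        filter_upwards [hsymm] with y hy
        rw [potential, ← lintegral_const_mul'' _ (aemeasurable_kernel_mul hκ hF' y)]
        refine lintegral_congr_ae ?_
        filter_upwards [hy] with x hxy
        rw [hxy]
        ring

lemma lintegral_potential_iterate_mul (hF : AEMeasurable F μ) (hF' : AEMeasurable F' μ) (i : ℕ) :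
    ∫⁻ x, (potential μ κ)^[i] F x * F' x ∂μ = ∫⁻ x, F x * (potential μ κ)^[i] F' x ∂μ := by
  induction i generalizing F' with
  | zero => rfl
  | succ i ih =>
    rw [Function.iterate_succ_apply', Function.iterate_succ_apply,
      lintegral_potential_mul hκ hsymm (aemeasurable_potential_iterate hκ hF i) hF',
      ih (measurable_potential hκ hF').aemeasurable]

end Symmetric

end Measurable

end Potential

section RieszKernel

variable {X : Type*} [MetricSpace X]

/-- The Riesz kernel `|x - y|^{-a}`, with the junk value of `0 ^ (-a)` on the diagonal. -/
noncomputable def rieszKernel (a : ℝ) (x y : X) : ℝ≥0∞ := ENNReal.ofReal (dist x y ^ (-a))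

lemma rieszKernel_comm (a : ℝ) (x y : X) : rieszKernel a x y = rieszKernel a y x := by
  rw [rieszKernel, rieszKernel, dist_comm]

lemma rieszKernel_zero (x y : X) : rieszKernel 0 x y = 1 := by simp [rieszKernel]

lemma rieszKernel_le_of_le_dist {a r : ℝ} (ha : 0 ≤ a) (hr : 0 < r) {x y : X}
    (hxy : r ≤ dist x y) : rieszKernel a x y ≤ ENNReal.ofReal (r ^ (-a)) :=
  ENNReal.ofReal_le_ofReal (Real.rpow_le_rpow_of_nonpos hr hxy (neg_nonpos.2 ha))

lemma rieszKernel_rpow (a : ℝ) {q : ℝ} (hq : 0 ≤ q) (x y : X) :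
    rieszKernel a x y ^ q = rieszKernel (a * q) x y := by
  rw [rieszKernel, ENNReal.ofReal_rpow_of_nonneg (by positivity) hq, ← Real.rpow_mul dist_nonneg,
    neg_mul, rieszKernel]

lemma rpow_neg_mul_rpow_neg_le {u v a b : ℝ} (hu : 0 < u) (hv : 0 < v) (ha : 0 ≤ a) (hb : 0 ≤ b) :
    u ^ (-a) * v ^ (-b) ≤ u ^ (-(a + b)) + v ^ (-(a + b)) := by
  have hsplit {t : ℝ} (ht : 0 < t) : t ^ (-(a + b)) = t ^ (-a) * t ^ (-b) := by
    rw [neg_add, Real.rpow_add ht]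
  rw [hsplit hu, hsplit hv]
  rcases le_total u v with huv | hvu
  · have : v ^ (-b) ≤ u ^ (-b) := Real.rpow_le_rpow_of_nonpos hu huv (neg_nonpos.2 hb)
    exact le_add_of_le_of_nonneg (by gcongr) (by positivity)
  · have : u ^ (-a) ≤ v ^ (-a) := Real.rpow_le_rpow_of_nonpos hv hvu (neg_nonpos.2 ha)
    exact le_add_of_nonneg_of_le (by positivity) (by gcongr)

lemma rpow_neg_mul_rpow_neg_le_of_le_add {d u v α β θ : ℝ} (hd : 0 < d) (hu : 0 < u) (hv : 0 < v)
    (hduv : d ≤ u + v) (hθ : 0 ≤ θ) (hθα : θ ≤ α) (hαβ : α ≤ β) :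
    u ^ (-α) * v ^ (-β) ≤ (d / 2) ^ (-(α - θ)) * (u ^ (-(β + θ)) + v ^ (-(β + θ))) := by
  have hanti {t : ℝ} (ht : d / 2 ≤ t) : t ^ (-(α - θ)) ≤ (d / 2) ^ (-(α - θ)) :=
    Real.rpow_le_rpow_of_nonpos (by linarith) ht (by linarith)
  rcases le_total (d / 2) u with h | h
  · calc u ^ (-α) * v ^ (-β) = u ^ (-(α - θ)) * (u ^ (-θ) * v ^ (-β)) := by
          rw [← mul_assoc, ← Real.rpow_add hu]; ring_nf
      _ ≤ (d / 2) ^ (-(α - θ)) * (u ^ (-(θ + β)) + v ^ (-(θ + β))) := by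
          exact mul_le_mul (hanti h) (rpow_neg_mul_rpow_neg_le hu hv hθ (by linarith))
            (by positivity) (by positivity)
      _ = _ := by rw [add_comm θ β]
  · calc u ^ (-α) * v ^ (-β) = v ^ (-(α - θ)) * (u ^ (-α) * v ^ (-(β - α + θ))) := by
          rw [mul_left_comm, ← Real.rpow_add hv]; ring_nf
      _ ≤ (d / 2) ^ (-(α - θ)) * (u ^ (-(α + (β - α + θ))) + v ^ (-(α + (β - α + θ)))) := by
          exact mul_le_mul (hanti (by linarith))
            (rpow_neg_mul_rpow_neg_le hu hv (by linarith) (by linarith))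
            (by positivity) (by positivity)
      _ = _ := by ring_nf

lemma rieszKernel_mul_le {α β θ : ℝ} (hθ : 0 ≤ θ) (hθα : θ ≤ α) (hαβ : α ≤ β) {x y z : X}
    (hxy : x ≠ y) (hzx : z ≠ x) (hzy : z ≠ y) :
    rieszKernel α x z * rieszKernel β z y ≤ ENNReal.ofReal (2 ^ (α - θ)) * rieszKernel (α - θ) x y
      * (rieszKernel (β + θ) x z + rieszKernel (β + θ) y z) := by
  simp only [rieszKernel, dist_comm y z]
  rw [← ENNReal.ofReal_mul (by positivity), ← ENNReal.ofReal_mul (by positivity),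
    ← ENNReal.ofReal_add (by positivity) (by positivity), ← ENNReal.ofReal_mul (by positivity)]
  have hhalf : (2 : ℝ) ^ (α - θ) * dist x y ^ (-(α - θ)) = (dist x y / 2) ^ (-(α - θ)) := by
    rw [Real.div_rpow dist_nonneg zero_le_two, Real.rpow_neg zero_le_two, div_inv_eq_mul, mul_comm]
  rw [hhalf]
  exact ENNReal.ofReal_le_ofReal (rpow_neg_mul_rpow_neg_le_of_le_add (dist_pos.2 hxy)
    (dist_pos.2 hzx.symm) (dist_pos.2 hzy) (dist_triangle x z y) hθ hθα hαβ)

variable [MeasurableSpace X] {μ : Measure X}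

/-- A measure is upper regular of dimension `d` if `μ(B(x, r)) ≤ C r^d` for all balls. For Lebesgue
measure on a subset of `ℝⁿ` this holds with `d = n`, and it is all that the estimates of Riesz
potentials require. -/
def IsUpperRegular (d : ℝ) (μ : Measure X) : Prop :=
  ∃ C : ℝ≥0, ∀ x r, 0 < r → μ (Metric.ball x r) ≤ C * ENNReal.ofReal (r ^ d)

lemma IsUpperRegular.measure_singleton {d : ℝ} (hμ : IsUpperRegular d μ) (hd : 0 < d) (x : X) :
    μ {x} = 0 := by
  obtain ⟨C, hC⟩ := hμ
  have hlim : Tendsto (fun r : ℝ => (C : ℝ≥0∞) * ENNReal.ofReal (r ^ d)) (nhdsWithin 0 (Ioi 0))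
      (nhds 0) := by
    have h0 : Tendsto (fun r : ℝ => r ^ d) (nhdsWithin 0 (Ioi 0)) (nhds 0) := by
      simpa [hd.ne'] using
        ((Real.continuous_rpow_const hd.le).tendsto 0).mono_left nhdsWithin_le_nhds
    simpa using ENNReal.Tendsto.const_mul (ENNReal.tendsto_ofReal h0) (.inr ENNReal.coe_ne_top)
  refine le_antisymm (ge_of_tendsto hlim ?_) zero_le
  filter_upwards [self_mem_nhdsWithin] with r hr
  exact (measure_mono (singleton_subset_iff.2 (Metric.mem_ball_self hr))).trans (hC x r hr)

lemma IsUpperRegular.ae_ne {d : ℝ} (hμ : IsUpperRegular d μ) (hd : 0 < d) (x : X) :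
    ∀ᵐ y ∂μ, y ≠ x :=
  measure_eq_zero_iff_ae_notMem.1 (hμ.measure_singleton hd x)

section Annuli

variable {d a : ℝ}

/-- Sum over the geometric annuli `r θ ^ k / 2 ≤ dist x y < 2 r θ ^ k`; a small `θ` covers balls, a
large one complements of balls. -/
lemma IsUpperRegular.exists_setLIntegral_rieszKernel_le (hμ : IsUpperRegular d μ) (ha : 0 ≤ a)
    {θ : ℝ} (hθ : 0 < θ) (hθd : θ ^ (d - a) < 1) :
    ∃ C : ℝ≥0, ∀ (x : X) (r : ℝ), 0 < r → ∀ s : Set X,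
      (∀ y ∈ s, ∃ k : ℕ, r * θ ^ k / 2 ≤ dist x y ∧ dist x y < 2 * (r * θ ^ k)) →
      ∫⁻ y in s, rieszKernel a x y ∂μ ≤ C * ENNReal.ofReal (r ^ (d - a)) := by
  obtain ⟨C, hC⟩ := hμ
  have hsum : Summable fun k : ℕ => (θ ^ (d - a)) ^ k :=
    summable_geometric_of_lt_one (by positivity) hθd
  refine ⟨C * (2 ^ (a + d) * ∑' k : ℕ, (θ ^ (d - a)) ^ k).toNNReal, fun x r hr s hs => ?_⟩
  set A : ℕ → Set X := fun k => {y | r * θ ^ k / 2 ≤ dist x y ∧ dist x y < 2 * (r * θ ^ k)}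
  have hA (k : ℕ) : ∫⁻ y in A k, rieszKernel a x y ∂μ
      ≤ C * ENNReal.ofReal (2 ^ (a + d) * r ^ (d - a) * (θ ^ (d - a)) ^ k) := by
    set t := r * θ ^ k
    have ht : 0 < t := by positivity
    have hsub : A k ⊆ Metric.ball x (2 * t) := fun y hy => Metric.mem_ball'.2 hy.2
    have hpow : (t / 2) ^ (-a) * (2 * t) ^ d = 2 ^ (a + d) * r ^ (d - a) * (θ ^ (d - a)) ^ k := by
      have ht_rpow : t ^ (d - a) = r ^ (d - a) * (θ ^ (d - a)) ^ k := by
        rw [Real.mul_rpow hr.le (by positivity), ← Real.rpow_natCast, ← Real.rpow_mul hθ.le,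
          mul_comm (k : ℝ), Real.rpow_mul hθ.le, Real.rpow_natCast]
      calc (t / 2) ^ (-a) * (2 * t) ^ d = 2 ^ (a + d) * t ^ (d - a) := by
            rw [Real.div_rpow ht.le zero_le_two, Real.mul_rpow zero_le_two ht.le,
              Real.rpow_neg zero_le_two, div_inv_eq_mul, Real.rpow_add two_pos, sub_eq_neg_add d a,
              Real.rpow_add ht]
            ring
        _ = _ := by rw [ht_rpow, mul_assoc]
    calc ∫⁻ y in A k, rieszKernel a x y ∂μ
        ≤ ∫⁻ _ in A k, ENNReal.ofReal ((t / 2) ^ (-a)) ∂μ :=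
          setLIntegral_mono measurable_const fun y hy =>
            rieszKernel_le_of_le_dist ha (by positivity) hy.1
      _ ≤ ENNReal.ofReal ((t / 2) ^ (-a)) * (C * ENNReal.ofReal ((2 * t) ^ d)) := by
          rw [setLIntegral_const]
          gcongr
          exact (measure_mono hsub).trans (hC x _ (by positivity))
      _ = _ := by rw [mul_left_comm, ← ENNReal.ofReal_mul (by positivity), hpow]
  calc ∫⁻ y in s, rieszKernel a x y ∂μ
      ≤ ∫⁻ y in ⋃ k, A k, rieszKernel a x y ∂μ :=
        lintegral_mono_set fun y hy => mem_iUnion.2 (hs y hy)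
    _ ≤ ∑' k, ∫⁻ y in A k, rieszKernel a x y ∂μ := lintegral_iUnion_le _ _
    _ ≤ ∑' k : ℕ, C * ENNReal.ofReal (2 ^ (a + d) * r ^ (d - a) * (θ ^ (d - a)) ^ k) :=
        ENNReal.tsum_le_tsum hA
    _ = C * ENNReal.ofReal (2 ^ (a + d) * r ^ (d - a) * ∑' k : ℕ, (θ ^ (d - a)) ^ k) := by
        rw [ENNReal.tsum_mul_left,
          ← ENNReal.ofReal_tsum_of_nonneg (fun k => by positivity) (hsum.mul_left _), tsum_mul_left]
    _ = _ := by
        rw [mul_right_comm, ENNReal.ofReal_mul (by positivity), ENNReal.coe_mul, mul_assoc]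
        rfl

lemma IsUpperRegular.exists_setLIntegral_ball_rieszKernel_le (hμ : IsUpperRegular d μ)
    (ha : 0 ≤ a) (had : a < d) :
    ∃ C : ℝ≥0, ∀ (x : X) (r : ℝ), 0 < r →
      ∫⁻ y in Metric.ball x r, rieszKernel a x y ∂μ ≤ C * ENNReal.ofReal (r ^ (d - a)) := by
  obtain ⟨C, hC⟩ := hμ.exists_setLIntegral_rieszKernel_le ha (θ := 1 / 2) (by norm_num)
    (Real.rpow_lt_one (by norm_num) (by norm_num) (sub_pos.2 had))
  refine ⟨C, fun x r hr => ?_⟩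
  rw [← setLIntegral_congr (sdiff_null_ae_eq_self (hμ.measure_singleton (ha.trans_lt had) x))]
  refine hC x r hr _ fun y hy => ?_
  have hlt : dist x y < r := Metric.mem_ball'.1 hy.1
  have hpos : 0 < dist x y := dist_pos.2 fun h => hy.2 h.symm
  obtain ⟨k, hk₁, hk₂⟩ := exists_nat_pow_near_of_lt_one (div_pos hpos hr)
    ((div_le_one hr).2 hlt.le) (by norm_num : (0 : ℝ) < 1 / 2) (by norm_num)
  rw [lt_div_iff₀ hr, pow_succ] at hk₁
  rw [div_le_iff₀ hr] at hk₂
  exact ⟨k, by linarith, by linarith⟩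

lemma IsUpperRegular.exists_setLIntegral_compl_ball_rieszKernel_le (hμ : IsUpperRegular d μ)
    (ha : 0 ≤ a) (had : d < a) :
    ∃ C : ℝ≥0, ∀ (x : X) (r : ℝ), 0 < r →
      ∫⁻ y in (Metric.ball x r)ᶜ, rieszKernel a x y ∂μ ≤ C * ENNReal.ofReal (r ^ (d - a)) := by
  obtain ⟨C, hC⟩ := hμ.exists_setLIntegral_rieszKernel_le ha (θ := 2) (by norm_num)
    (Real.rpow_lt_one_of_one_lt_of_neg (by norm_num) (sub_neg.2 had))
  refine ⟨C, fun x r hr => hC x r hr _ fun y hy => ?_⟩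
  have hle : r ≤ dist x y := by rwa [mem_compl_iff, Metric.mem_ball', not_lt] at hy
  obtain ⟨k, hk₁, hk₂⟩ := exists_nat_pow_near ((one_le_div hr).2 hle) (by norm_num : (1 : ℝ) < 2)
  rw [le_div_iff₀ hr] at hk₁
  rw [div_lt_iff₀ hr, pow_succ] at hk₂
  have : 0 < r * 2 ^ k := by positivity
  exact ⟨k, by linarith, by linarith⟩

lemma IsUpperRegular.exists_lintegral_rieszKernel_le [OpensMeasurableSpace X] [IsFiniteMeasure μ]
    (hμ : IsUpperRegular d μ) (ha : 0 ≤ a) (had : a < d) :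
    ∃ C : ℝ≥0, ∀ x, ∫⁻ y, rieszKernel a x y ∂μ ≤ C := by
  obtain ⟨C, hC⟩ := hμ.exists_setLIntegral_ball_rieszKernel_le ha had
  refine ⟨C + (μ univ).toNNReal, fun x => ?_⟩
  rw [← lintegral_add_compl _ (Metric.isOpen_ball (x := x) (ε := 1)).measurableSet, ENNReal.coe_add,
    ENNReal.coe_toNNReal (measure_ne_top μ _)]
  gcongr
  · simpa using hC x 1 one_pos
  · calc ∫⁻ y in (Metric.ball x 1)ᶜ, rieszKernel a x y ∂μ
        ≤ ∫⁻ _ in (Metric.ball x 1)ᶜ, 1 ∂μ := by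
          refine setLIntegral_mono measurable_const fun y hy => ?_
          rw [mem_compl_iff, Metric.mem_ball', not_lt] at hy
          simpa using rieszKernel_le_of_le_dist ha one_pos hy
      _ ≤ μ univ := by simpa using measure_mono (subset_univ _)

end Annuli

section Composition

variable [SecondCountableTopology X] [OpensMeasurableSpace X] {d α β θ : ℝ}

lemma measurable_rieszKernel (a : ℝ) : Measurable (Function.uncurry (rieszKernel (X := X) a)) :=
  (measurable_dist.pow_const (-a)).ennreal_ofReal

lemma IsUpperRegular.exists_lintegral_rieszKernel_mul_le [IsFiniteMeasure μ]
    (hμ : IsUpperRegular d μ) (hθ : 0 ≤ θ) (hθα : θ ≤ α) (hαβ : α ≤ β) (hβd : β + θ < d) :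
    ∃ C : ℝ≥0, ∀ x y : X, x ≠ y →
      ∫⁻ z, rieszKernel α x z * rieszKernel β z y ∂μ ≤ C * rieszKernel (α - θ) x y := by
  obtain ⟨C, hC⟩ := hμ.exists_lintegral_rieszKernel_le (by linarith) hβd
  have hd : 0 < d := by linarith
  refine ⟨((2 : ℝ) ^ (α - θ)).toNNReal * (C + C), fun x y hxy => ?_⟩
  calc ∫⁻ z, rieszKernel α x z * rieszKernel β z y ∂μ
      ≤ ∫⁻ z, ENNReal.ofReal (2 ^ (α - θ)) * rieszKernel (α - θ) x y
          * (rieszKernel (β + θ) x z + rieszKernel (β + θ) y z) ∂μ := by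
        refine lintegral_mono_ae ?_
        filter_upwards [hμ.ae_ne hd x, hμ.ae_ne hd y] with z hzx hzy
        exact rieszKernel_mul_le hθ hθα hαβ hxy hzx hzy
    _ = ENNReal.ofReal (2 ^ (α - θ)) * rieszKernel (α - θ) x y
          * (∫⁻ z, rieszKernel (β + θ) x z ∂μ + ∫⁻ z, rieszKernel (β + θ) y z ∂μ) := by
        rw [lintegral_const_mul', lintegral_add_left (measurable_rieszKernel _).of_uncurry_left]
        exact ENNReal.mul_ne_top ENNReal.ofReal_ne_top ENNReal.ofReal_ne_top
    _ ≤ ENNReal.ofReal (2 ^ (α - θ)) * rieszKernel (α - θ) x y * (C + C) := by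
        gcongr <;> exact hC _
    _ = _ := by
        rw [mul_right_comm]
        rfl

lemma IsUpperRegular.exists_potential_rieszKernel_comp_le [IsFiniteMeasure μ]
    (hμ : IsUpperRegular d μ) (hθ : 0 ≤ θ) (hθα : θ ≤ α) (hαβ : α ≤ β) (hβd : β + θ < d) :
    ∃ C : ℝ≥0, ∀ F : X → ℝ≥0∞, AEMeasurable F μ → ∀ x,
      potential μ (rieszKernel α) (potential μ (rieszKernel β) F) x
        ≤ C * potential μ (rieszKernel (α - θ)) F x := by
  obtain ⟨C, hC⟩ := hμ.exists_lintegral_rieszKernel_mul_le hθ hθα hαβ hβd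
  have hm (a : ℝ) : Measurable (Function.uncurry (rieszKernel (X := X) a)) :=
    measurable_rieszKernel a
  refine ⟨C, fun F hF x => ?_⟩
  calc potential μ (rieszKernel α) (potential μ (rieszKernel β) F) x
      = ∫⁻ z, ∫⁻ y, rieszKernel α x z * (rieszKernel β z y * F y) ∂μ ∂μ :=
        lintegral_congr fun z => (lintegral_const_mul' _ _ ENNReal.ofReal_ne_top).symm
    _ = ∫⁻ y, ∫⁻ z, rieszKernel α x z * (rieszKernel β z y * F y) ∂μ ∂μ := by
        refine lintegral_lintegral_swap ?_
        exact ((hm α).comp (measurable_const.prodMk measurable_fst)).aemeasurable.mul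
          ((hm β).aemeasurable.mul hF.comp_snd)
    _ ≤ ∫⁻ y, C * (rieszKernel (α - θ) x y * F y) ∂μ := by
        refine lintegral_mono_ae ?_
        filter_upwards [hμ.ae_ne (by linarith) x] with y hyx
        simp_rw [← mul_assoc]
        rw [lintegral_mul_const (f := fun z => rieszKernel α x z * rieszKernel β z y) _
          ((hm α).of_uncurry_left.mul (hm β).of_uncurry_right)]
        gcongr
        exact hC x y hyx.symm
    _ = _ := lintegral_const_mul' _ _ ENNReal.coe_ne_top

end Composition

end RieszKernel

section Duality

variable {α : Type*} [MeasurableSpace α] {μ : Measure α} {U : α → ℝ≥0∞} {p q : ℝ} {C : ℝ≥0∞}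

lemma lintegral_rpow_le_of_forall_lintegral_mul_le_of_ne_top (hU : AEMeasurable U μ)
    (hpq : p.HolderConjugate q) (hUp : ∫⁻ x, U x ^ p ∂μ ≠ ⊤)
    (h : ∀ g : α → ℝ≥0∞, AEMeasurable g μ → ∫⁻ x, g x ^ q ∂μ ≤ 1 → ∫⁻ x, U x * g x ∂μ ≤ C) :
    ∫⁻ x, U x ^ p ∂μ ≤ C ^ p := by
  have hq0 : q ≠ 0 := hpq.symm.ne_zero
  set N := ∫⁻ x, U x ^ p ∂μ with hN
  rcases eq_or_ne N 0 with hN0 | hN0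
  · simp [hN0]
  have hdual : ∫⁻ x, U x * (U x ^ (p - 1) * N ^ (-q⁻¹)) ∂μ ≤ C := by
    refine h _ ((hU.pow_const _).mul_const _) (le_of_eq ?_)
    simp_rw [ENNReal.mul_rpow_of_nonneg _ _ hpq.symm.nonneg, ← ENNReal.rpow_mul,
      hpq.sub_one_mul_conj]
    rw [lintegral_mul_const'' _ (hU.pow_const _), ← hN, neg_mul, inv_mul_cancel₀ hq0,
      ENNReal.rpow_neg_one, ENNReal.mul_inv_cancel hN0 hUp]
  rw [← ENNReal.rpow_inv_le_iff hpq.pos]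
  calc N ^ p⁻¹ = N * N ^ (-q⁻¹) := by
        rw [← hpq.symm.one_sub_inv, sub_eq_add_neg, ENNReal.rpow_add _ _ hN0 hUp, ENNReal.rpow_one]
    _ = ∫⁻ x, U x * (U x ^ (p - 1) * N ^ (-q⁻¹)) ∂μ := by
        rw [hN, ← lintegral_mul_const'' _ (hU.pow_const _)]
        refine lintegral_congr fun x => ?_
        rw [← mul_assoc]
        congr 1
        nth_rw 2 [← ENNReal.rpow_one (U x)]
        rw [← ENNReal.rpow_add_of_nonneg _ _ zero_le_one hpq.sub_one_pos.le, add_sub_cancel]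
    _ ≤ C := hdual

/-- Truncate at the level `k` and let `k → ∞`. -/
lemma lintegral_rpow_le_of_forall_lintegral_mul_le [IsFiniteMeasure μ] (hU : AEMeasurable U μ)
    (hpq : p.HolderConjugate q)
    (h : ∀ g : α → ℝ≥0∞, AEMeasurable g μ → ∫⁻ x, g x ^ q ∂μ ≤ 1 → ∫⁻ x, U x * g x ∂μ ≤ C) :
    ∫⁻ x, U x ^ p ∂μ ≤ C ^ p := by
  have hm (k : ℕ) : AEMeasurable (fun x => min (U x) k) μ := hU.min aemeasurable_const
  have htrunc (k : ℕ) : ∫⁻ x, min (U x) k ^ p ∂μ ≤ C ^ p := by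
    refine lintegral_rpow_le_of_forall_lintegral_mul_le_of_ne_top (hm k) hpq ?_ fun g hg hg1 =>
      (lintegral_mono fun x => ?_).trans (h g hg hg1)
    · refine ne_top_of_le_ne_top (b := ∫⁻ _, (k : ℝ≥0∞) ^ p ∂μ) ?_ (lintegral_mono fun x =>
        ENNReal.rpow_le_rpow (min_le_right _ _) hpq.nonneg)
      rw [lintegral_const]
      exact ENNReal.mul_ne_top (ENNReal.rpow_ne_top_of_nonneg hpq.nonneg (by simp))
        (measure_ne_top _ _)
    · gcongr
      exact min_le_left _ _
  refine le_of_tendsto' (lintegral_tendsto_of_tendsto_of_monotone (fun k => (hm k).pow_const p)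
    (ae_of_all _ fun x k l hkl => ?_) (ae_of_all _ fun x => ?_)) htrunc
  · have := hpq.nonneg
    dsimp only
    gcongr
  · have hlim : Tendsto (fun k : ℕ => min (U x) k) atTop (nhds (U x)) := by
      simpa using (tendsto_const_nhds (x := U x)).min ENNReal.tendsto_nat_nhds_top
    exact (ENNReal.continuous_rpow_const.tendsto _).comp hlim

end Duality

section HardyLittlewoodSobolev

lemma mul_le_add_mul_min {a b : ℝ≥0∞} {p q : ℝ} (hp : 0 < p) (hq : 0 < q) :
    a * b ≤ a * min b (a ^ (p / q)) + b * min a (b ^ (q / p)) := by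
  rcases le_total b (a ^ (p / q)) with h | h
  · rw [min_eq_left h]
    exact le_self_add
  · have h' : a ≤ b ^ (q / p) := by
      rw [← inv_div]
      exact (ENNReal.le_rpow_inv_iff (by positivity)).2 h
    rw [min_eq_left h', mul_comm b a]
    exact le_add_self

lemma lintegral_potential_mul_le_add {α : Type*} [MeasurableSpace α] {μ : Measure α} [SFinite μ]
    {κ : α → α → ℝ≥0∞} (hκ : Measurable (Function.uncurry κ)) (hsymm : ∀ x y, κ x y = κ y x)
    {F g : α → ℝ≥0∞} (hF : AEMeasurable F μ) (hg : AEMeasurable g μ) {p q : ℝ} (hp : 0 < p)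
    (hq : 0 < q) :
    ∫⁻ x, potential μ κ F x * g x ∂μ
      ≤ (∫⁻ x, F x * potential μ κ (fun y => min (g y) (F x ^ (p / q))) x ∂μ)
        + ∫⁻ x, g x * potential μ κ (fun y => min (F y) (g x ^ (q / p))) x ∂μ := by
  have hout {F g : α → ℝ≥0∞} (hg : AEMeasurable g μ) (r : ℝ) (x : α) :
      ∫⁻ y, κ x y * (F x * min (g y) (F x ^ r)) ∂μ
        = F x * potential μ κ (fun y => min (g y) (F x ^ r)) x := by
    simp_rw [mul_left_comm _ (F x)]
    exact lintegral_const_mul'' _ (aemeasurable_kernel_mul hκ (hg.min aemeasurable_const) x)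
  have hm {F g : α → ℝ≥0∞} (hF : AEMeasurable F μ) (hg : AEMeasurable g μ) (r : ℝ) :
      AEMeasurable (Function.uncurry fun x y => κ x y * (F x * min (g y) (F x ^ r)))
        (μ.prod μ) :=
    hκ.aemeasurable.mul (hF.comp_fst.mul (hg.comp_snd.min (hF.comp_fst.pow_const _)))
  calc ∫⁻ x, potential μ κ F x * g x ∂μ
      = ∫⁻ x, ∫⁻ y, κ x y * (F y * g x) ∂μ ∂μ := by
        refine lintegral_congr fun x => ?_
        rw [potential, ← lintegral_mul_const'' _ (aemeasurable_kernel_mul hκ hF x)]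
        simp_rw [mul_assoc]
    _ ≤ ∫⁻ x, ∫⁻ y, (κ y x * (F y * min (g x) (F y ^ (p / q)))
          + κ x y * (g x * min (F y) (g x ^ (q / p)))) ∂μ ∂μ := by
        refine lintegral_mono fun x => lintegral_mono fun y => ?_
        rw [hsymm y x, ← mul_add]
        gcongr
        exact mul_le_add_mul_min hp hq
    _ = (∫⁻ y, ∫⁻ x, κ y x * (F y * min (g x) (F y ^ (p / q))) ∂μ ∂μ)
          + ∫⁻ x, ∫⁻ y, κ x y * (g x * min (F y) (g x ^ (q / p))) ∂μ ∂μ := by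
        rw [lintegral_lintegral_swap (hm hF hg _)]
        refine (lintegral_congr fun x => lintegral_add_right' _ ?_).trans
          (lintegral_add_right' _ (hm hg hF _).lintegral_prod_right')
        exact aemeasurable_kernel_mul hκ ((hF.min aemeasurable_const).const_mul _) x
    _ = _ := by simp_rw [hout hg, hout hF]

variable {X : Type*} [MetricSpace X] [SecondCountableTopology X] [MeasurableSpace X]
  [OpensMeasurableSpace X] {μ : Measure X} {d β p q : ℝ}

lemma IsUpperRegular.exists_setLIntegral_compl_ball_rieszKernel_mul_le (hμ : IsUpperRegular d μ)
    (hβ : 0 ≤ β) (hpq : p.HolderConjugate q) (hβp : d < β * p) :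
    ∃ C : ℝ≥0, ∀ g : X → ℝ≥0∞, AEMeasurable g μ → ∫⁻ y, g y ^ q ∂μ ≤ 1 →
      ∀ x, ∀ r : ℝ, 0 < r →
      ∫⁻ y in (Metric.ball x r)ᶜ, rieszKernel β x y * g y ∂μ
        ≤ C * ENNReal.ofReal (r ^ (d / p - β)) := by
  have hp : 0 < p := hpq.pos
  obtain ⟨C, hC⟩ :=
    hμ.exists_setLIntegral_compl_ball_rieszKernel_le (mul_nonneg hβ hp.le) hβp
  refine ⟨C ^ (1 / p), fun g hg hg1 x r hr => ?_⟩
  calc _ ≤ (∫⁻ y in (Metric.ball x r)ᶜ, rieszKernel β x y ^ p ∂μ) ^ (1 / p)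
          * (∫⁻ y in (Metric.ball x r)ᶜ, g y ^ q ∂μ) ^ (1 / q) :=
        ENNReal.lintegral_mul_le_Lp_mul_Lq _ hpq
          (measurable_rieszKernel β).of_uncurry_left.aemeasurable hg.restrict
    _ ≤ (C * ENNReal.ofReal (r ^ (d - β * p))) ^ (1 / p) * 1 := by
        simp_rw [rieszKernel_rpow β hp.le]
        gcongr
        · exact hC x r hr
        · exact ENNReal.rpow_le_one ((setLIntegral_le_lintegral _ _).trans hg1)
            (one_div_nonneg.2 hpq.symm.nonneg)
    _ = _ := by
        rw [mul_one, ENNReal.mul_rpow_of_nonneg _ _ (by positivity),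
          ← ENNReal.coe_rpow_of_nonneg _ (by positivity),
          ENNReal.ofReal_rpow_of_nonneg (by positivity) (by positivity),
          ← Real.rpow_mul hr.le]
        congr 3
        field_simp

/-- Split at the radius `r = T ^ (-q / d)`, for which the near part, where the density is at most
`T`, and the far part, where Hölder's inequality applies, are of the same order. -/
lemma IsUpperRegular.exists_potential_rieszKernel_min_le (hμ : IsUpperRegular d μ) (hd : 0 < d)
    (hβ : β < d) (hq : 1 < q) (hqβ : q * (1 - β / d) < 1) :
    ∃ C : ℝ≥0, ∀ g : X → ℝ≥0∞, AEMeasurable g μ → ∫⁻ y, g y ^ q ∂μ ≤ 1 →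
      ∀ x, ∀ T : ℝ, 0 < T →
      potential μ (rieszKernel β) (fun y => min (g y) (ENNReal.ofReal T)) x
        ≤ C * ENNReal.ofReal (T ^ (1 - q * (1 - β / d))) := by
  obtain ⟨p, hpq⟩ : ∃ p, q.HolderConjugate p := ⟨_, .conjExponent hq⟩
  have hp : 0 < p := hpq.symm.pos
  have hβp : d < β * p := by
    have : 1 - β / d < q⁻¹ := by rwa [← one_div, lt_div_iff₀ hpq.pos, mul_comm]
    have : p⁻¹ < β / d := by linarith [hpq.one_sub_inv]
    rw [lt_div_iff₀ hd, inv_mul_lt_iff₀ hp] at this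
    linarith
  have hβ0 : 0 ≤ β := (pos_of_mul_pos_left (hd.trans hβp) hp.le).le
  obtain ⟨C₁, hnear⟩ := hμ.exists_setLIntegral_ball_rieszKernel_le hβ0 hβ
  obtain ⟨C₂, hfar⟩ :=
    hμ.exists_setLIntegral_compl_ball_rieszKernel_mul_le hβ0 hpq.symm hβp
  refine ⟨C₁ + C₂, fun g hg hg1 x T hT => ?_⟩
  set r := T ^ (-(q / d))
  have hr : 0 < r := by positivity
  have hr_pow (e : ℝ) : r ^ e = T ^ (-(q / d) * e) := (Real.rpow_mul hT.le _ _).symm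
  rw [potential, ← lintegral_add_compl _ (Metric.isOpen_ball (x := x) (ε := r)).measurableSet,
    ENNReal.coe_add, add_mul]
  refine add_le_add ?_ ?_
  · calc _ ≤ ∫⁻ y in Metric.ball x r, rieszKernel β x y * ENNReal.ofReal T ∂μ := by
          gcongr
          exact min_le_right _ _
      _ ≤ C₁ * ENNReal.ofReal (r ^ (d - β)) * ENNReal.ofReal T := by
          rw [lintegral_mul_const _ (measurable_rieszKernel β).of_uncurry_left]
          gcongr
          exact hnear x r hr
      _ = _ := by
          rw [mul_assoc, ← ENNReal.ofReal_mul (by positivity), hr_pow,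
            ← Real.rpow_add_one hT.ne']
          congr 3
          field_simp
          ring
  · calc _ ≤ ∫⁻ y in (Metric.ball x r)ᶜ, rieszKernel β x y * g y ∂μ := by
          gcongr
          exact min_le_left _ _
      _ ≤ C₂ * ENNReal.ofReal (r ^ (d / p - β)) := hfar g hg hg1 x r hr
      _ = _ := by
          rw [hr_pow]
          congr 3
          field_simp
          linear_combination d * hpq.sub_one_mul_conj

lemma IsUpperRegular.exists_mul_potential_rieszKernel_min_rpow_le (hμ : IsUpperRegular d μ)
    (hd : 0 < d) (hβ : β < d) (hp : 1 < p) (hq : 1 < q) (hpq : 1 / p + 1 / q = 2 - β / d) :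
    ∃ C : ℝ≥0, ∀ g : X → ℝ≥0∞, AEMeasurable g μ → ∫⁻ y, g y ^ q ∂μ ≤ 1 →
      ∀ x, ∀ a : ℝ≥0∞,
      a * potential μ (rieszKernel β) (fun y => min (g y) (a ^ (p / q))) x ≤ C * a ^ p := by
  have hp0 : 0 < p := by linarith
  have hq0 : 0 < q := by linarith
  have hqβ : q * (1 - β / d) < 1 := by
    have : 1 / p < 1 := (div_lt_one hp0).2 hp
    rw [mul_comm, ← lt_div_iff₀ hq0]
    linarith
  obtain ⟨C, hC⟩ := hμ.exists_potential_rieszKernel_min_le hd hβ hq hqβ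
  refine ⟨C + 1, fun g hg hg1 x a => ?_⟩
  rcases eq_or_ne a 0 with rfl | ha0
  · simp
  rcases eq_or_ne a ⊤ with rfl | ha
  · simp [hp0]
  obtain ⟨t, ht, rfl⟩ : ∃ t : ℝ, 0 < t ∧ a = ENNReal.ofReal t :=
    ⟨a.toReal, ENNReal.toReal_pos ha0 ha, (ENNReal.ofReal_toReal ha).symm⟩
  have hexp : t * (t ^ (p / q)) ^ (1 - q * (1 - β / d)) = t ^ p := by
    rw [← Real.rpow_mul ht.le]
    nth_rw 1 [← Real.rpow_one t]
    rw [← Real.rpow_add ht, show 1 - β / d = 1 / p + 1 / q - 1 by linarith]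
    congr 1
    field_simp
    ring
  rw [ENNReal.ofReal_rpow_of_pos ht, ENNReal.ofReal_rpow_of_pos ht]
  calc _ ≤ ENNReal.ofReal t * (C * ENNReal.ofReal ((t ^ (p / q)) ^ (1 - q * (1 - β / d)))) := by
        gcongr
        exact hC g hg hg1 x _ (by positivity)
    _ = C * ENNReal.ofReal (t ^ p) := by
        rw [mul_left_comm, ← ENNReal.ofReal_mul ht.le, hexp]
    _ ≤ _ := by gcongr; exact le_self_add

lemma IsUpperRegular.exists_lintegral_potential_rieszKernel_mul_le [SFinite μ]
    (hμ : IsUpperRegular d μ) (hd : 0 < d) (hβ : β < d) (hp : 1 < p) (hq : 1 < q)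
    (hpq : 1 / p + 1 / q = 2 - β / d) :
    ∃ C : ℝ≥0, ∀ F g : X → ℝ≥0∞, AEMeasurable F μ → AEMeasurable g μ →
      ∫⁻ y, F y ^ p ∂μ ≤ 1 → ∫⁻ y, g y ^ q ∂μ ≤ 1 →
      ∫⁻ x, potential μ (rieszKernel β) F x * g x ∂μ ≤ C := by
  obtain ⟨C₁, h₁⟩ := hμ.exists_mul_potential_rieszKernel_min_rpow_le hd hβ hp hq hpq
  obtain ⟨C₂, h₂⟩ :=
    hμ.exists_mul_potential_rieszKernel_min_rpow_le hd hβ hq hp ((add_comm _ _).trans hpq)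
  refine ⟨C₁ + C₂, fun F g hF hg hF1 hg1 => ?_⟩
  calc _ ≤ (∫⁻ x, F x * potential μ (rieszKernel β) (fun y => min (g y) (F x ^ (p / q))) x ∂μ)
        + ∫⁻ x, g x * potential μ (rieszKernel β) (fun y => min (F y) (g x ^ (q / p))) x ∂μ :=
        lintegral_potential_mul_le_add (measurable_rieszKernel β) (rieszKernel_comm β) hF hg
          (by linarith) (by linarith)
    _ ≤ (∫⁻ x, C₁ * F x ^ p ∂μ) + ∫⁻ x, C₂ * g x ^ q ∂μ :=
        add_le_add (lintegral_mono fun x => h₁ g hg hg1 x _)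
          (lintegral_mono fun x => h₂ F hF hF1 x _)
    _ ≤ C₁ * 1 + C₂ * 1 := by
        rw [lintegral_const_mul' _ _ ENNReal.coe_ne_top, lintegral_const_mul' _ _
          ENNReal.coe_ne_top]
        gcongr
    _ = _ := by simp

lemma lintegral_potential_mul_le_of_forall_le_one {α : Type*} [MeasurableSpace α] {μ : Measure α}
    {κ : α → α → ℝ≥0∞} (hκ : Measurable (Function.uncurry κ)) {g : α → ℝ≥0∞} {p : ℝ} (hp : 0 < p)
    {C : ℝ≥0∞} (h : ∀ F : α → ℝ≥0∞, AEMeasurable F μ → ∫⁻ x, F x ^ p ∂μ ≤ 1 →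
      ∫⁻ x, potential μ κ F x * g x ∂μ ≤ C) {F : α → ℝ≥0∞} (hF : AEMeasurable F μ)
    (hFp : ∫⁻ x, F x ^ p ∂μ ≠ ⊤) :
    ∫⁻ x, potential μ κ F x * g x ∂μ ≤ C * (∫⁻ x, F x ^ p ∂μ) ^ p⁻¹ := by
  set N := ∫⁻ x, F x ^ p ∂μ
  rcases eq_or_ne N 0 with hN0 | hN0
  · have hF0 : F =ᵐ[μ] fun _ => 0 := by
      filter_upwards [(lintegral_eq_zero_iff' (hF.pow_const p)).1 hN0] with x hx
      simpa [hp, hp.not_gt] using hx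
    rw [potential_congr_ae hF0]
    simp [potential]
  set J := N ^ p⁻¹ with hJ
  have hJ0 : J ≠ 0 := by simp [hJ, hN0, hFp]
  have hJt : J ≠ ⊤ := ENNReal.rpow_ne_top_of_nonneg (by positivity) hFp
  have hnorm : ∫⁻ x, (J⁻¹ * F x) ^ p ∂μ ≤ 1 := by
    simp_rw [ENNReal.mul_rpow_of_nonneg _ _ hp.le]
    rw [lintegral_const_mul'' _ (hF.pow_const _), ENNReal.inv_rpow, hJ,
      ENNReal.rpow_inv_rpow hp.ne', ENNReal.inv_mul_cancel hN0 hFp]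
  calc ∫⁻ x, potential μ κ F x * g x ∂μ
      = J * ∫⁻ x, potential μ κ (fun y => J⁻¹ * F y) x * g x ∂μ := by
        simp_rw [potential_const_mul hκ hF, mul_assoc]
        rw [lintegral_const_mul' _ _ (ENNReal.inv_ne_top.2 hJ0),
          ← mul_assoc, ENNReal.mul_inv_cancel hJ0 hJt, one_mul]
    _ ≤ J * C := by gcongr; exact h _ (hF.const_mul _) hnorm
    _ = _ := mul_comm _ _

lemma eLpNorm_ofReal_eq_lintegral_rpow {α : Type*} [MeasurableSpace α] {μ : Measure α}
    (F : α → ℝ≥0∞) {p : ℝ} (hp : 0 < p) :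
    eLpNorm F (ENNReal.ofReal p) μ = (∫⁻ x, F x ^ p ∂μ) ^ p⁻¹ := by
  rw [eLpNorm_eq_lintegral_rpow_enorm_toReal (by simpa using hp) ENNReal.ofReal_ne_top,
    ENNReal.toReal_ofReal hp.le]
  simp

/-- The Hardy-Littlewood-Sobolev inequality on an upper regular space of finite measure. -/
theorem IsUpperRegular.exists_eLpNorm_potential_rieszKernel_le [IsFiniteMeasure μ]
    (hμ : IsUpperRegular d μ) (hd : 0 < d) (hβ : β < d) {p₀ p₁ : ℝ} (hp₀ : 1 < p₀)
    (hp₀β : p₀ * (1 - β / d) < 1) (hp₁ : 1 / p₁ = 1 / p₀ - (1 - β / d)) :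
    ∃ C : ℝ≥0, ∀ F : X → ℝ≥0∞, AEMeasurable F μ →
      eLpNorm (potential μ (rieszKernel β) F) (ENNReal.ofReal p₁) μ
        ≤ C * eLpNorm F (ENNReal.ofReal p₀) μ := by
  have hp₀0 : 0 < p₀ := by linarith
  have hp₁0 : 0 < p₁ := by
    rw [← one_div_pos, hp₁, sub_pos, lt_div_iff₀ hp₀0, mul_comm]
    exact hp₀β
  have hp₁1 : 1 < p₁ := by
    have : 1 / p₀ < 1 := (div_lt_one hp₀0).2 hp₀
    have : β / d < 1 := (div_lt_one hd).2 hβ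
    rw [← div_lt_one hp₁0]
    linarith
  obtain ⟨q, hq⟩ : ∃ q, p₁.HolderConjugate q := ⟨_, .conjExponent hp₁1⟩
  obtain ⟨C, hC⟩ := hμ.exists_lintegral_potential_rieszKernel_mul_le hd hβ hp₀ hq.symm.lt
    (by have := hq.inv_add_inv_eq_one; simp only [one_div] at *; linarith)
  have hker := measurable_rieszKernel (X := X) β
  refine ⟨C + 1, fun F hF => ?_⟩
  rw [eLpNorm_ofReal_eq_lintegral_rpow _ hp₀0, eLpNorm_ofReal_eq_lintegral_rpow _ hp₁0]
  rcases eq_or_ne (∫⁻ x, F x ^ p₀ ∂μ) ⊤ with hFp | hFp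
  · simp [hFp, hp₀0]
  rw [ENNReal.rpow_inv_le_iff hp₁0]
  calc _ ≤ (C * (∫⁻ x, F x ^ p₀ ∂μ) ^ p₀⁻¹) ^ p₁ :=
        lintegral_rpow_le_of_forall_lintegral_mul_le (measurable_potential hker hF).aemeasurable
          hq fun g hg hg1 => lintegral_potential_mul_le_of_forall_le_one hker hp₀0
            (fun F' hF' hF'1 => hC F' g hF' hg hF'1 hg1) hF hFp
    _ ≤ _ := by
        gcongr
        simp

end HardyLittlewoodSobolev

section GreenKernel

variable {X : Type*} [MetricSpace X] [MeasurableSpace X]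

/-- The properties of a Green kernel `κ` which the estimates rest on: on a space of dimension `d`,
`κ` is symmetric and, up to a constant, `κ(x, y) δ(y)^a ≤ δ(x)^(a + ε) dist(x, y)^(-β - ε)` as long
as `a + ε ≤ γ`. For the model kernel, `δ` is the distance to the boundary and `β` is the positive
part of `n - 2s`. -/
structure GreenKernelBounds (d β γ : ℝ) (μ : Measure X) (δ : X → ℝ≥0) (κ : X → X → ℝ≥0∞) :
    Prop where
  upperRegular : IsUpperRegular d μ
  β_nonneg : 0 ≤ β
  β_lt : β < d
  γ_nonneg : 0 ≤ γ
  measurable_weight : Measurable δ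
  measurable : Measurable (Function.uncurry κ)
  symm : ∀ᵐ x ∂μ, ∀ᵐ y ∂μ, κ x y = κ y x
  gain : ∃ c : ℝ≥0, ∀ a ε : ℝ, 0 ≤ a → 0 ≤ ε → a + ε ≤ γ → ∀ᵐ x ∂μ, ∀ᵐ y ∂μ,
    κ x y * (δ y : ℝ≥0∞) ^ a ≤ c * (δ x : ℝ≥0∞) ^ (a + ε) * rieszKernel (β + ε) x y

lemma exists_nat_pos_div_lt {b d : ℝ} (hb : 0 ≤ b) (hd : 0 < d) :
    ∃ N : ℕ, 0 < N ∧ b / N < d := by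
  obtain ⟨N, hN⟩ := exists_nat_gt (b / d)
  have hN0 : (0 : ℝ) < N := (by positivity : 0 ≤ b / d).trans_lt hN
  refine ⟨N, by exact_mod_cast hN0, ?_⟩
  rw [div_lt_iff₀ hd] at hN
  rwa [div_lt_iff₀' hN0]

namespace GreenKernelBounds

variable {d β γ a ε θ : ℝ} {μ : Measure X} {δ : X → ℝ≥0} {κ : X → X → ℝ≥0∞}
  (hκ : GreenKernelBounds d β γ μ δ κ)

include hκ

lemma dim_pos : 0 < d := hκ.β_nonneg.trans_lt hκ.β_lt

lemma measurable_rpow_weight (a : ℝ) : Measurable fun x => (δ x : ℝ≥0∞) ^ a :=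
  hκ.measurable_weight.coe_nnreal_ennreal.pow_const a

lemma exists_potential_le :
    ∃ c : ℝ≥0, ∀ᵐ x ∂μ, ∀ F, potential μ κ F x ≤ c * potential μ (rieszKernel β) F x := by
  obtain ⟨c, hc⟩ := hκ.gain
  refine ⟨c, ?_⟩
  filter_upwards [hc 0 0 le_rfl le_rfl (by simpa using hκ.γ_nonneg)] with x hx F
  rw [potential, potential, ← lintegral_const_mul' _ _ ENNReal.coe_ne_top]
  refine lintegral_mono_ae ?_
  filter_upwards [hx] with y hxy
  simp only [add_zero, ENNReal.rpow_zero, mul_one] at hxy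
  rw [← mul_assoc]
  gcongr

lemma exists_eLpNorm_potential_le (p : ℝ≥0∞) :
    ∃ c : ℝ≥0, ∀ F : X → ℝ≥0∞,
      eLpNorm (potential μ κ F) p μ ≤ c * eLpNorm (potential μ (rieszKernel β) F) p μ := by
  obtain ⟨c, hc⟩ := hκ.exists_potential_le
  refine ⟨c, fun F => ?_⟩
  simpa [ENNReal.smul_def] using eLpNorm_le_nnreal_smul_eLpNorm_of_ae_le_mul' (c := c)
    (hc.mono fun x hx => by simpa using hx F) p

section FiniteMeasure

variable [SecondCountableTopology X] [OpensMeasurableSpace X] [IsFiniteMeasure μ]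

lemma exists_potential_rpow_weight_le (ha : 0 ≤ a) (hε : 0 ≤ ε) (haε : a + ε ≤ γ)
    (hβε : β + ε < d) :
    ∃ C : ℝ≥0, ∀ᵐ x ∂μ,
      potential μ κ (fun y => (δ y : ℝ≥0∞) ^ a) x ≤ C * (δ x : ℝ≥0∞) ^ (a + ε) := by
  obtain ⟨c, hc⟩ := hκ.gain
  obtain ⟨C, hC⟩ :=
    hκ.upperRegular.exists_lintegral_rieszKernel_le (add_nonneg hκ.β_nonneg hε) hβε
  refine ⟨c * C, ?_⟩
  filter_upwards [hc a ε ha hε haε] with x hx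
  calc potential μ κ (fun y => (δ y : ℝ≥0∞) ^ a) x
      ≤ ∫⁻ y, c * (δ x : ℝ≥0∞) ^ (a + ε) * rieszKernel (β + ε) x y ∂μ := lintegral_mono_ae hx
    _ = c * (δ x : ℝ≥0∞) ^ (a + ε) * ∫⁻ y, rieszKernel (β + ε) x y ∂μ :=
        lintegral_const_mul _ (measurable_rieszKernel _).of_uncurry_left
    _ ≤ c * (δ x : ℝ≥0∞) ^ (a + ε) * C := by gcongr; exact hC x
    _ = _ := by push_cast; ring

lemma exists_potential_iterate_weight_le (i : ℕ) :
    ∃ C : ℝ≥0, ∀ᵐ x ∂μ,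
      (potential μ κ)^[i] (fun y => (δ y : ℝ≥0∞) ^ γ) x ≤ C * (δ x : ℝ≥0∞) ^ γ := by
  obtain ⟨C, hC⟩ := hκ.exists_potential_rpow_weight_le hκ.γ_nonneg le_rfl (by simp)
    (by simpa using hκ.β_lt)
  refine ⟨C ^ i, ?_⟩
  induction i with
  | zero => simp
  | succ i ih =>
    filter_upwards [hC] with x hx
    rw [Function.iterate_succ_apply']
    calc _ ≤ potential μ κ (fun y => (C ^ i : ℝ≥0) * (δ y : ℝ≥0∞) ^ γ) x :=
          potential_mono_ae ih x
      _ = (C ^ i : ℝ≥0) * potential μ κ (fun y => (δ y : ℝ≥0∞) ^ γ) x :=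
          potential_const_mul hκ.measurable (hκ.measurable_rpow_weight γ).aemeasurable _ x
      _ ≤ (C ^ i : ℝ≥0) * (C * (δ x : ℝ≥0∞) ^ γ) := by
          rw [add_zero] at hx
          gcongr
      _ = _ := by push_cast; ring

lemma exists_lintegral_potential_iterate_mul_weight_le (i : ℕ) :
    ∃ C : ℝ≥0, ∀ F : X → ℝ≥0∞, AEMeasurable F μ →
      ∫⁻ x, (potential μ κ)^[i] F x * (δ x : ℝ≥0∞) ^ γ ∂μ
        ≤ C * ∫⁻ x, F x * (δ x : ℝ≥0∞) ^ γ ∂μ := by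
  obtain ⟨C, hC⟩ := hκ.exists_potential_iterate_weight_le i
  refine ⟨C, fun F hF => ?_⟩
  rw [lintegral_potential_iterate_mul hκ.measurable hκ.symm hF
    (hκ.measurable_rpow_weight γ).aemeasurable, ← lintegral_const_mul' _ _ ENNReal.coe_ne_top]
  refine lintegral_mono_ae ?_
  filter_upwards [hC] with x hx
  rw [mul_left_comm]
  gcongr

lemma exists_potential_iterate_le_potential_rieszKernel (hθ : 0 ≤ θ) (hθd : β + θ < d) (i : ℕ)
    (hi : i * θ ≤ β) :
    ∃ C : ℝ≥0, ∀ F : X → ℝ≥0∞, AEMeasurable F μ → ∀ᵐ x ∂μ,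
      (potential μ κ)^[i + 1] F x ≤ C * potential μ (rieszKernel (β - i * θ)) F x := by
  obtain ⟨c, hc⟩ := hκ.exists_potential_le
  induction i with
  | zero => exact ⟨c, fun F _ => by simpa using hc.mono fun x hx => hx F⟩
  | succ i ih =>
    push_cast at hi ⊢
    obtain ⟨C, hC⟩ := ih (by linarith)
    obtain ⟨C', hC'⟩ := hκ.upperRegular.exists_potential_rieszKernel_comp_le (α := β - i * θ)
      hθ (by linarith) (sub_le_self _ (by positivity)) hθd
    refine ⟨C * c * C', fun F hF => ?_⟩
    filter_upwards [hC _ (measurable_potential hκ.measurable hF).aemeasurable] with x hx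
    rw [Function.iterate_succ_apply]
    calc (potential μ κ)^[i + 1] (potential μ κ F) x
        ≤ C * potential μ (rieszKernel (β - i * θ)) (potential μ κ F) x := hx
      _ ≤ C * potential μ (rieszKernel (β - i * θ))
            (fun y => c * potential μ (rieszKernel β) F y) x := by
          gcongr
          exact potential_mono_ae (hc.mono fun y hy => hy F) x
      _ = C * (c * potential μ (rieszKernel (β - i * θ)) (potential μ (rieszKernel β) F) x) := by
          rw [potential_const_mul (measurable_rieszKernel _)
            (measurable_potential (measurable_rieszKernel _) hF).aemeasurable]
      _ ≤ C * (c * (C' * potential μ (rieszKernel (β - i * θ - θ)) F x)) := by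
          gcongr
          exact hC' F hF x
      _ = _ := by
          rw [show β - (i + 1) * θ = β - i * θ - θ by ring]
          push_cast
          ring

lemma exists_potential_iterate_le_lintegral :
    ∃ (N : ℕ) (C : ℝ≥0), ∀ F : X → ℝ≥0∞, AEMeasurable F μ → ∀ᵐ x ∂μ,
      (potential μ κ)^[N] F x ≤ C * ∫⁻ y, F y ∂μ := by
  obtain ⟨N, hN, hθ⟩ := exists_nat_pos_div_lt hκ.β_nonneg (sub_pos.2 hκ.β_lt)
  have hNβ : N * (β / N) = β := by field_simp
  obtain ⟨C, hC⟩ := hκ.exists_potential_iterate_le_potential_rieszKernel (θ := β / N)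
    (div_nonneg hκ.β_nonneg N.cast_nonneg) (by linarith) N hNβ.le
  refine ⟨N + 1, C, fun F hF => (hC F hF).mono fun x hx => hx.trans_eq ?_⟩
  simp [hNβ, potential, rieszKernel_zero]

lemma exists_potential_iterate_one_le_rpow_weight (hε : 0 ≤ ε) (hβε : β + ε < d) (i : ℕ)
    (hi : i * ε ≤ γ) :
    ∃ C : ℝ≥0, ∀ᵐ x ∂μ,
      (potential μ κ)^[i] (fun _ => 1) x ≤ C * (δ x : ℝ≥0∞) ^ (i * ε) := by
  induction i with
  | zero => exact ⟨1, by simp⟩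
  | succ i ih =>
    push_cast at hi ⊢
    obtain ⟨C, hC⟩ := ih (by linarith)
    obtain ⟨C', hC'⟩ := hκ.exists_potential_rpow_weight_le (a := i * ε) (by positivity) hε
      (by linarith) hβε
    refine ⟨C * C', ?_⟩
    filter_upwards [hC'] with x hx
    rw [Function.iterate_succ_apply']
    calc _ ≤ potential μ κ (fun y => C * (δ y : ℝ≥0∞) ^ (i * ε)) x := potential_mono_ae hC x
      _ = C * potential μ κ (fun y => (δ y : ℝ≥0∞) ^ (i * ε)) x :=
          potential_const_mul hκ.measurable (hκ.measurable_rpow_weight _).aemeasurable _ x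
      _ ≤ C * (C' * (δ x : ℝ≥0∞) ^ (i * ε + ε)) := by gcongr
      _ = _ := by
          rw [add_one_mul]
          push_cast
          ring

lemma exists_potential_iterate_one_le :
    ∃ (M : ℕ) (C : ℝ≥0), ∀ᵐ x ∂μ,
      (potential μ κ)^[M] (fun _ => 1) x ≤ C * (δ x : ℝ≥0∞) ^ γ := by
  obtain ⟨M, hM, hε⟩ := exists_nat_pos_div_lt hκ.γ_nonneg (sub_pos.2 hκ.β_lt)
  have hMγ : M * (γ / M) = γ := by field_simp
  obtain ⟨C, hC⟩ := hκ.exists_potential_iterate_one_le_rpow_weight (ε := γ / M)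
    (div_nonneg hκ.γ_nonneg M.cast_nonneg) (by linarith) M hMγ.le
  exact ⟨M, C, by rwa [hMγ] at hC⟩

/-- By symmetry, the `M` powers which turn `1` into a multiple of `δ^γ` also map `L¹(δ^γ)` to `L¹`;
in between, `N` powers map `L¹` to bounded functions. -/
theorem exists_potential_iterate_le :
    ∃ (N : ℕ) (C : ℝ≥0), ∀ F : X → ℝ≥0∞, AEMeasurable F μ → ∀ᵐ x ∂μ,
      (potential μ κ)^[N] F x
        ≤ C * (δ x : ℝ≥0∞) ^ γ * ∫⁻ y, F y * (δ y : ℝ≥0∞) ^ γ ∂μ := by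
  obtain ⟨N, C₁, h₁⟩ := hκ.exists_potential_iterate_le_lintegral
  obtain ⟨M, C₂, h₂⟩ := hκ.exists_potential_iterate_one_le
  refine ⟨M + (N + M), C₂ * C₁ * C₂, fun F hF => ?_⟩
  set F' := (potential μ κ)^[M] F
  have hF' : AEMeasurable F' μ := aemeasurable_potential_iterate hκ.measurable hF M
  have hint : ∫⁻ y, F' y ∂μ ≤ C₂ * ∫⁻ y, F y * (δ y : ℝ≥0∞) ^ γ ∂μ := by
    calc ∫⁻ y, F' y ∂μ = ∫⁻ y, F y * (potential μ κ)^[M] (fun _ => 1) y ∂μ := by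
          simpa using lintegral_potential_iterate_mul hκ.measurable hκ.symm hF
            (aemeasurable_const (b := (1 : ℝ≥0∞))) M
      _ ≤ ∫⁻ y, C₂ * (F y * (δ y : ℝ≥0∞) ^ γ) ∂μ := by
          refine lintegral_mono_ae (h₂.mono fun y hy => ?_)
          rw [mul_left_comm]
          gcongr
      _ = _ := lintegral_const_mul' _ _ ENNReal.coe_ne_top
  have hbdd : (potential μ κ)^[N] F' ≤ᵐ[μ] fun _ => C₁ * (∫⁻ y, F' y ∂μ) * 1 :=
    (h₁ F' hF').mono fun x hx => by simpa using hx
  filter_upwards [h₂, potential_iterate_mono_ae (κ := κ) hbdd M] with x hx hx'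
  rw [Function.iterate_add_apply, Function.iterate_add_apply]
  calc _ ≤ _ := hx'
    _ = C₁ * (∫⁻ y, F' y ∂μ) * (potential μ κ)^[M] (fun _ => 1) x :=
        congrFun (potential_iterate_const_mul hκ.measurable aemeasurable_const _ M) x
    _ ≤ C₁ * (C₂ * ∫⁻ y, F y * (δ y : ℝ≥0∞) ^ γ ∂μ) * (C₂ * (δ x : ℝ≥0∞) ^ γ) := by gcongr
    _ = _ := by push_cast; ring

end FiniteMeasure

end GreenKernelBounds

end GreenKernel

section SchurTest

variable {α : Type*} [MeasurableSpace α] {μ : Measure α} {κ : α → α → ℝ≥0∞} {F : α → ℝ≥0∞} {p : ℝ}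

lemma rpow_lintegral_mul_le {a w : α → ℝ≥0∞} (ha : AEMeasurable a μ) (hw : AEMeasurable w μ)
    (hp : 1 ≤ p) :
    (∫⁻ x, a x * w x ∂μ) ^ p ≤ (∫⁻ x, a x ^ p * w x ∂μ) * (∫⁻ x, w x ∂μ) ^ (p - 1) := by
  have hp0 : 0 < p := by linarith
  have hp1 : 0 ≤ 1 - p⁻¹ := by linarith [inv_le_one_of_one_le₀ hp]
  have hsplit (x : α) : (a x ^ p * w x) ^ p⁻¹ * w x ^ (1 - p⁻¹) = a x * w x := by
    rw [ENNReal.mul_rpow_of_nonneg _ _ (by positivity), ENNReal.rpow_rpow_inv hp0.ne', mul_assoc,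
      ← ENNReal.rpow_add_of_nonneg _ _ (by positivity) hp1, add_sub_cancel, ENNReal.rpow_one]
  have hHölder := ENNReal.lintegral_mul_norm_pow_le (f := fun x => a x ^ p * w x)
    ((ha.pow_const _).mul hw) hw (inv_nonneg.2 hp0.le) hp1 (add_sub_cancel _ _)
  simp_rw [hsplit] at hHölder
  calc (∫⁻ x, a x * w x ∂μ) ^ p
      ≤ ((∫⁻ x, a x ^ p * w x ∂μ) ^ p⁻¹ * (∫⁻ x, w x ∂μ) ^ (1 - p⁻¹)) ^ p := by gcongr
    _ = _ := by
        rw [ENNReal.mul_rpow_of_nonneg _ _ hp0.le, ENNReal.rpow_inv_rpow hp0.ne',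
          ← ENNReal.rpow_mul, sub_mul, inv_mul_cancel₀ hp0.ne', one_mul]

variable [SFinite μ]

lemma lintegral_potential_rpow_le_of_potential_one_le (hκ : Measurable (Function.uncurry κ))
    (hsymm : ∀ᵐ x ∂μ, ∀ᵐ y ∂μ, κ x y = κ y x) {A : ℝ≥0}
    (hA : ∀ᵐ x ∂μ, potential μ κ (fun _ => 1) x ≤ A) (hF : AEMeasurable F μ) (hp : 1 ≤ p) :
    ∫⁻ x, potential μ κ F x ^ p ∂μ ≤ (A : ℝ≥0∞) ^ p * ∫⁻ x, F x ^ p ∂μ := by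
  have hp1 : 0 ≤ p - 1 := by linarith
  calc ∫⁻ x, potential μ κ F x ^ p ∂μ
      ≤ ∫⁻ x, (A : ℝ≥0∞) ^ (p - 1) * (potential μ κ (fun y => F y ^ p) x * 1) ∂μ := by
        refine lintegral_mono_ae ?_
        filter_upwards [hA] with x hx
        have := rpow_lintegral_mul_le hF (hκ.of_uncurry_left (x := x)).aemeasurable hp
        simp_rw [mul_comm _ (κ x _)] at this
        refine this.trans ?_
        rw [mul_one, mul_comm]
        gcongr
        · simpa [potential] using hx
        · simp [potential]
    _ = (A : ℝ≥0∞) ^ (p - 1) * ∫⁻ x, F x ^ p * potential μ κ (fun _ => 1) x ∂μ := by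
        rw [lintegral_const_mul' _ _ (ENNReal.rpow_ne_top_of_nonneg hp1 ENNReal.coe_ne_top),
          lintegral_potential_mul hκ hsymm (hF.pow_const _) aemeasurable_const]
    _ ≤ (A : ℝ≥0∞) ^ (p - 1) * ∫⁻ x, F x ^ p * A ∂μ := by
        refine mul_le_mul' le_rfl (lintegral_mono_ae ?_)
        filter_upwards [hA] with x hx
        gcongr
    _ = (A : ℝ≥0∞) ^ (p - 1) * (A : ℝ≥0∞) ^ (1 : ℝ) * ∫⁻ x, F x ^ p ∂μ := by
        rw [lintegral_mul_const' _ _ ENNReal.coe_ne_top, ENNReal.rpow_one]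
        ring
    _ = _ := by
        rw [← ENNReal.rpow_add_of_nonneg _ _ hp1 zero_le_one, sub_add_cancel]

lemma lintegral_potential_rpow_le_of_lintegral_rpow_le (hκ : Measurable (Function.uncurry κ))
    {A : ℝ≥0} (hA : ∀ᵐ y ∂μ, ∫⁻ x, κ x y ^ p ∂μ ≤ A) (hF : AEMeasurable F μ) (hp : 1 ≤ p) :
    ∫⁻ x, potential μ κ F x ^ p ∂μ ≤ A * (∫⁻ x, F x ∂μ) ^ p := by
  have hκp : Measurable (Function.uncurry fun x y => κ x y ^ p) := hκ.pow_const p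
  calc ∫⁻ x, potential μ κ F x ^ p ∂μ
      ≤ ∫⁻ x, potential μ (fun x y => κ x y ^ p) F x * (∫⁻ y, F y ∂μ) ^ (p - 1) ∂μ :=
        lintegral_mono fun x => rpow_lintegral_mul_le hκ.of_uncurry_left.aemeasurable hF hp
    _ = (∫⁻ x, ∫⁻ y, κ x y ^ p * F y ∂μ ∂μ) * (∫⁻ y, F y ∂μ) ^ (p - 1) :=
        lintegral_mul_const _ (measurable_potential hκp hF)
    _ = (∫⁻ y, (∫⁻ x, κ x y ^ p ∂μ) * F y ∂μ) * (∫⁻ y, F y ∂μ) ^ (p - 1) := by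
        rw [lintegral_lintegral_swap (hκp.aemeasurable.mul hF.comp_snd)]
        simp_rw [lintegral_mul_const _ (Measurable.of_uncurry_right hκp)]
    _ ≤ (∫⁻ y, A * F y ∂μ) * (∫⁻ y, F y ∂μ) ^ (p - 1) := by
        gcongr ?_ * _
        refine lintegral_mono_ae ?_
        filter_upwards [hA] with y hy
        gcongr
    _ = A * ((∫⁻ y, F y ∂μ) ^ (1 : ℝ) * (∫⁻ y, F y ∂μ) ^ (p - 1)) := by
        rw [lintegral_const_mul' _ _ ENNReal.coe_ne_top, ENNReal.rpow_one, mul_assoc]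
    _ = _ := by
        rw [← ENNReal.rpow_add_of_nonneg _ _ zero_le_one (by linarith), add_sub_cancel]

end SchurTest

section GreenKernelEstimates

variable {X : Type*} [MetricSpace X] [MeasurableSpace X] [SecondCountableTopology X]
  [OpensMeasurableSpace X]

namespace GreenKernelBounds

variable {d β γ p : ℝ} {μ : Measure X} [IsFiniteMeasure μ] {δ : X → ℝ≥0} {κ : X → X → ℝ≥0∞}
  (hκ : GreenKernelBounds d β γ μ δ κ)

include hκ

lemma exists_eLpNorm_potential_iterate_le (hp : 1 ≤ p) (i : ℕ) :
    ∃ C : ℝ≥0, ∀ F : X → ℝ≥0∞, AEMeasurable F μ →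
      eLpNorm ((potential μ κ)^[i] F) (ENNReal.ofReal p) μ
        ≤ C * eLpNorm F (ENNReal.ofReal p) μ := by
  have hp0 : 0 < p := by linarith
  obtain ⟨A, hA⟩ := hκ.exists_potential_rpow_weight_le le_rfl le_rfl (by simpa using hκ.γ_nonneg)
    (by simpa using hκ.β_lt)
  simp only [add_zero, ENNReal.rpow_zero, mul_one] at hA
  have hstep (F : X → ℝ≥0∞) (hF : AEMeasurable F μ) :
      eLpNorm (potential μ κ F) (ENNReal.ofReal p) μ ≤ A * eLpNorm F (ENNReal.ofReal p) μ := by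
    rw [eLpNorm_ofReal_eq_lintegral_rpow _ hp0, eLpNorm_ofReal_eq_lintegral_rpow _ hp0,
      ENNReal.rpow_inv_le_iff hp0, ENNReal.mul_rpow_of_nonneg _ _ hp0.le,
      ENNReal.rpow_inv_rpow hp0.ne']
    exact lintegral_potential_rpow_le_of_potential_one_le hκ.measurable hκ.symm hA hF hp
  refine ⟨A ^ i, fun F hF => ?_⟩
  induction i with
  | zero => simp
  | succ i ih =>
    rw [Function.iterate_succ_apply']
    calc _ ≤ A * eLpNorm ((potential μ κ)^[i] F) (ENNReal.ofReal p) μ :=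
          hstep _ (aemeasurable_potential_iterate hκ.measurable hF i)
      _ ≤ A * ((A ^ i : ℝ≥0) * eLpNorm F (ENNReal.ofReal p) μ) := by gcongr
      _ = _ := by push_cast; ring

lemma exists_eLpNorm_potential_iterate_le_eLpNorm_one (hp : 1 ≤ p) (hpβ : p * β < d) (i : ℕ) :
    ∃ C : ℝ≥0, ∀ F : X → ℝ≥0∞, AEMeasurable F μ →
      eLpNorm ((potential μ κ)^[i + 1] F) (ENNReal.ofReal p) μ ≤ C * eLpNorm F 1 μ := by
  have hp0 : 0 < p := by linarith
  obtain ⟨c, hc⟩ := hκ.exists_eLpNorm_potential_le (ENNReal.ofReal p)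
  obtain ⟨A, hA⟩ :=
    hκ.upperRegular.exists_lintegral_rieszKernel_le (mul_nonneg hp0.le hκ.β_nonneg) hpβ
  obtain ⟨C, hC⟩ := hκ.exists_eLpNorm_potential_iterate_le le_rfl i
  rw [ENNReal.ofReal_one] at hC
  refine ⟨c * (A ^ p⁻¹) * C, fun F hF => ?_⟩
  have hF' := aemeasurable_potential_iterate hκ.measurable hF i
  rw [Function.iterate_succ_apply']
  set F' := (potential μ κ)^[i] F
  calc eLpNorm (potential μ κ F') (ENNReal.ofReal p) μ
      ≤ c * (∫⁻ x, potential μ (rieszKernel β) F' x ^ p ∂μ) ^ p⁻¹ := by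
        rw [← eLpNorm_ofReal_eq_lintegral_rpow _ hp0]
        exact hc F'
    _ ≤ c * (A * (∫⁻ x, F' x ∂μ) ^ p) ^ p⁻¹ := by
        gcongr
        refine lintegral_potential_rpow_le_of_lintegral_rpow_le (measurable_rieszKernel β)
          (ae_of_all _ fun y => ?_) hF' hp
        simp_rw [rieszKernel_rpow β hp0.le, rieszKernel_comm _ _ y, mul_comm β]
        exact hA y
    _ = c * ((A : ℝ≥0∞) ^ p⁻¹ * eLpNorm F' 1 μ) := by
        rw [ENNReal.mul_rpow_of_nonneg _ _ (by positivity), ENNReal.rpow_rpow_inv hp0.ne',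
          eLpNorm_one_eq_lintegral_enorm]
        rfl
    _ ≤ c * ((A : ℝ≥0∞) ^ p⁻¹ * (C * eLpNorm F 1 μ)) := by
        gcongr
        exact hC F hF
    _ = _ := by
        push_cast
        rw [ENNReal.coe_rpow_of_nonneg _ (by positivity)]
        ring

lemma exists_eLpNorm_potential_iterate_le_of_one_div_eq {p₀ p₁ : ℝ} (hp₀ : 1 < p₀)
    (hp₀β : p₀ * (1 - β / d) < 1) (hp₁ : 1 / p₁ = 1 / p₀ - (1 - β / d)) (i : ℕ) :
    ∃ C : ℝ≥0, ∀ F : X → ℝ≥0∞, AEMeasurable F μ →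
      eLpNorm ((potential μ κ)^[i + 1] F) (ENNReal.ofReal p₁) μ
        ≤ C * eLpNorm F (ENNReal.ofReal p₀) μ := by
  obtain ⟨c, hc⟩ := hκ.exists_eLpNorm_potential_le (ENNReal.ofReal p₁)
  obtain ⟨A, hA⟩ := hκ.upperRegular.exists_eLpNorm_potential_rieszKernel_le hκ.dim_pos hκ.β_lt
    hp₀ hp₀β hp₁
  obtain ⟨C, hC⟩ := hκ.exists_eLpNorm_potential_iterate_le hp₀.le i
  refine ⟨c * A * C, fun F hF => ?_⟩
  rw [Function.iterate_succ_apply']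
  calc _ ≤ c * (A * (C * eLpNorm F (ENNReal.ofReal p₀) μ)) := by
        refine (hc _).trans ?_
        gcongr
        refine (hA _ (aemeasurable_potential_iterate hκ.measurable hF i)).trans ?_
        gcongr
        exact hC F hF
    _ = _ := by push_cast; ring

lemma exists_le_weight_mul_rieszKernel :
    ∃ c : ℝ≥0, ∀ᵐ x ∂μ, ∀ᵐ y ∂μ, κ x y ≤ c * (δ y : ℝ≥0∞) ^ γ * rieszKernel (β + γ) x y := by
  obtain ⟨c, hc⟩ := hκ.gain
  have hmeas : MeasurableSet {z : X × X |
      κ z.1 z.2 ≤ c * (δ z.1 : ℝ≥0∞) ^ γ * rieszKernel (β + γ) z.1 z.2} :=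
    measurableSet_le hκ.measurable
      ((((hκ.measurable_rpow_weight γ).comp measurable_fst).const_mul _).mul
        (measurable_rieszKernel _))
  have hgain : ∀ᵐ x ∂μ, ∀ᵐ y ∂μ, κ x y ≤ c * (δ x : ℝ≥0∞) ^ γ * rieszKernel (β + γ) x y := by
    simpa using hc 0 γ le_rfl hκ.γ_nonneg (by simp)
  refine ⟨c, ?_⟩
  filter_upwards [(Measure.ae_ae_comm hmeas).1 hgain, hκ.symm] with x hx hsymm
  filter_upwards [hx, hsymm] with y hxy hxy'
  rwa [hxy', rieszKernel_comm]

/-- Near the thickening the density is at most `B`; away from it the kernel is at most a multiple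
of `δ(y)^γ`. -/
lemma exists_potential_le_on_thickening (K : Set X) (t : ℝ) {ε : ℝ} (hε : 0 < ε) :
    ∃ C : ℝ≥0, ∀ F : X → ℝ≥0∞, ∀ B : ℝ≥0∞,
      (∀ᵐ y ∂μ, y ∈ Metric.thickening (t + ε) K → F y ≤ B) →
      ∀ᵐ x ∂μ, x ∈ Metric.thickening t K →
        potential μ κ F x ≤ C * (B + ∫⁻ y, F y * (δ y : ℝ≥0∞) ^ γ ∂μ) := by
  obtain ⟨c, hc⟩ := hκ.gain
  obtain ⟨c', hc'⟩ := hκ.exists_le_weight_mul_rieszKernel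
  obtain ⟨A, hA⟩ := hκ.upperRegular.exists_lintegral_rieszKernel_le hκ.β_nonneg hκ.β_lt
  set E : ℝ≥0 := (ε ^ (-(β + γ))).toNNReal
  refine ⟨c * A + c' * E, fun F B hFB => ?_⟩
  filter_upwards [hc 0 0 le_rfl le_rfl (by simpa using hκ.γ_nonneg), hc'] with x hx hx' hxt
  simp only [add_zero, ENNReal.rpow_zero, mul_one] at hx
  calc potential μ κ F x
      ≤ ∫⁻ y, c * B * rieszKernel β x y + (c' * E : ℝ≥0) * (F y * (δ y : ℝ≥0∞) ^ γ) ∂μ := by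
        refine lintegral_mono_ae ?_
        filter_upwards [hFB, hx, hx'] with y hy hxy hxy'
        by_cases hyt : y ∈ Metric.thickening (t + ε) K
        · refine le_add_right ((mul_le_mul' hxy (hy hyt)).trans_eq ?_)
          ring
        · have hdist : ε ≤ dist x y := by
            by_contra! hlt
            obtain ⟨z, hz, hxz⟩ := Metric.mem_thickening_iff.1 hxt
            rw [dist_comm] at hlt
            exact hyt (Metric.mem_thickening_iff.2
              ⟨z, hz, (dist_triangle y x z).trans_lt (by linarith)⟩)
          refine le_add_left ?_
          calc κ x y * F y ≤ c' * (δ y : ℝ≥0∞) ^ γ * E * F y := by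
                gcongr
                refine hxy'.trans ?_
                gcongr
                exact rieszKernel_le_of_le_dist (add_nonneg hκ.β_nonneg hκ.γ_nonneg) hε hdist
            _ = _ := by push_cast; ring
    _ = c * B * ∫⁻ y, rieszKernel β x y ∂μ
          + (c' * E : ℝ≥0) * ∫⁻ y, F y * (δ y : ℝ≥0∞) ^ γ ∂μ := by
        have hr : Measurable (rieszKernel β x) := (measurable_rieszKernel β).of_uncurry_left
        rw [lintegral_add_left (hr.const_mul _), lintegral_const_mul _ hr,
          lintegral_const_mul' _ _ ENNReal.coe_ne_top]
    _ ≤ c * B * A + (c' * E : ℝ≥0) * ∫⁻ y, F y * (δ y : ℝ≥0∞) ^ γ ∂μ := by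
        gcongr
        exact hA x
    _ = (c * A : ℝ≥0) * B + (c' * E : ℝ≥0) * ∫⁻ y, F y * (δ y : ℝ≥0∞) ^ γ ∂μ := by
        push_cast
        ring
    _ ≤ _ := by
        rw [mul_add]
        gcongr <;> simp

lemma exists_potential_iterate_le_on_thickening (K : Set X) (i : ℕ) (t : ℝ) {ε : ℝ} (hε : 0 < ε) :
    ∃ C : ℝ≥0, ∀ F : X → ℝ≥0∞, AEMeasurable F μ → ∀ B : ℝ≥0∞,
      (∀ᵐ y ∂μ, y ∈ Metric.thickening (t + ε) K → F y ≤ B) →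
      ∀ᵐ x ∂μ, x ∈ Metric.thickening t K →
        (potential μ κ)^[i + 1] F x ≤ C * (B + ∫⁻ y, F y * (δ y : ℝ≥0∞) ^ γ ∂μ) := by
  induction i generalizing t ε with
  | zero =>
    obtain ⟨C, hC⟩ := hκ.exists_potential_le_on_thickening K t hε
    exact ⟨C, fun F _ => hC F⟩
  | succ i ih =>
    obtain ⟨C₁, h₁⟩ := ih (t + ε / 2) (half_pos hε)
    obtain ⟨C₂, h₂⟩ := hκ.exists_potential_le_on_thickening K t (half_pos hε)
    obtain ⟨C₃, h₃⟩ := hκ.exists_lintegral_potential_iterate_mul_weight_le (i + 1)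
    refine ⟨C₂ * (C₁ + C₃), fun F hF B hFB => ?_⟩
    rw [← add_halves ε, ← add_assoc] at hFB
    filter_upwards [h₂ _ _ (h₁ F hF B hFB)] with x hx hxt
    rw [Function.iterate_succ_apply']
    calc _ ≤ _ := hx hxt
      _ ≤ C₂ * (C₁ * (B + ∫⁻ y, F y * (δ y : ℝ≥0∞) ^ γ ∂μ)
            + C₃ * (B + ∫⁻ y, F y * (δ y : ℝ≥0∞) ^ γ ∂μ)) := by
          gcongr
          exact (h₃ F hF).trans (by gcongr; exact le_add_self)
      _ = _ := by push_cast; ring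

end GreenKernelBounds

end GreenKernelEstimates

section PotentialSum

variable {α : Type*} [MeasurableSpace α] {μ : Measure α} {κ : α → α → ℝ≥0∞} {w : α → ℝ≥0∞}
  {D : ℝ≥0} {p q : ℝ≥0∞}

/-- The first `N` iterated potentials of `F` plus a multiple of the weight `w`: the form in which
solutions are dominated by their datum `F`. -/
noncomputable def potentialSum (μ : Measure α) (κ : α → α → ℝ≥0∞) (w : α → ℝ≥0∞) (N : ℕ)
    (F : α → ℝ≥0∞) (x : α) : ℝ≥0∞ :=
  (∑ i ∈ Finset.range N, (potential μ κ)^[i + 1] F x) + (∫⁻ y, F y * w y ∂μ) * w x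

lemma potential_iterate_le_potentialSum {N i : ℕ} (hi : i < N) (F : α → ℝ≥0∞) (x : α) :
    (potential μ κ)^[i + 1] F x ≤ potentialSum μ κ w N F x :=
  (Finset.single_le_sum (f := fun i => (potential μ κ)^[i + 1] F x) (fun _ _ => zero_le)
    (Finset.mem_range.2 hi)).trans le_self_add

lemma lintegral_mul_mul_le_potentialSum (N : ℕ) (F : α → ℝ≥0∞) (x : α) :
    (∫⁻ y, F y * w y ∂μ) * w x ≤ potentialSum μ κ w N F x :=
  le_add_self

variable [IsFiniteMeasure μ]

lemma exists_lintegral_mul_le_eLpNorm (hw : ∀ᵐ x ∂μ, w x ≤ D) (hp : 1 ≤ p) :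
    ∃ C : ℝ≥0, ∀ F : α → ℝ≥0∞, AEMeasurable F μ → ∫⁻ x, F x * w x ∂μ ≤ C * eLpNorm F p μ := by
  have hm : μ univ ^ (1 / (1 : ℝ≥0∞).toReal - 1 / p.toReal) ≠ ⊤ := by
    refine ENNReal.rpow_ne_top_of_nonneg ?_ (measure_ne_top _ _)
    rcases eq_or_ne p ⊤ with rfl | hp'
    · simp
    · have : 1 ≤ p.toReal := by simpa using ENNReal.toReal_mono hp' hp
      simpa using inv_le_one_of_one_le₀ this
  refine ⟨D * (μ univ ^ (1 / (1 : ℝ≥0∞).toReal - 1 / p.toReal)).toNNReal, fun F hF => ?_⟩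
  calc ∫⁻ x, F x * w x ∂μ ≤ ∫⁻ x, F x * D ∂μ :=
        lintegral_mono_ae (hw.mono fun x hx => by gcongr)
    _ = eLpNorm F 1 μ * D := by
        rw [lintegral_mul_const' _ _ ENNReal.coe_ne_top, eLpNorm_one_eq_lintegral_enorm]
        rfl
    _ ≤ eLpNorm F p μ * μ univ ^ (1 / (1 : ℝ≥0∞).toReal - 1 / p.toReal) * D := by
        gcongr
        exact eLpNorm_le_eLpNorm_mul_rpow_measure_univ hp hF.aestronglyMeasurable
    _ = _ := by
        rw [ENNReal.coe_mul, ENNReal.coe_toNNReal hm]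
        ring

lemma exists_eLpNorm_potentialSum_le (hκ : Measurable (Function.uncurry κ)) (hwm : Measurable w)
    (hw : ∀ᵐ x ∂μ, w x ≤ D) (hp : 1 ≤ p) (hq : 1 ≤ q)
    (hpot : ∀ i, ∃ C : ℝ≥0, ∀ F : α → ℝ≥0∞, AEMeasurable F μ →
      eLpNorm ((potential μ κ)^[i + 1] F) q μ ≤ C * eLpNorm F p μ) (N : ℕ) :
    ∃ C : ℝ≥0, ∀ F : α → ℝ≥0∞, AEMeasurable F μ →
      eLpNorm (potentialSum μ κ w N F) q μ ≤ C * eLpNorm F p μ := by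
  choose A hA using hpot
  obtain ⟨B, hB⟩ := exists_lintegral_mul_le_eLpNorm hw hp
  have hm : μ univ ^ q.toReal⁻¹ ≠ ⊤ :=
    ENNReal.rpow_ne_top_of_nonneg (by positivity) (measure_ne_top _ _)
  refine ⟨(∑ i ∈ Finset.range N, A i) + B * D * (μ univ ^ q.toReal⁻¹).toNNReal,
    fun F hF => ?_⟩
  have hmeas (i : ℕ) : AEStronglyMeasurable ((potential μ κ)^[i + 1] F) μ :=
    (aemeasurable_potential_iterate hκ hF (i + 1)).aestronglyMeasurable
  have hsplit : potentialSum μ κ w N F = (∑ i ∈ Finset.range N, (potential μ κ)^[i + 1] F)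
      + fun x => (∫⁻ y, F y * w y ∂μ) * w x := by
    ext x
    simp only [potentialSum, Pi.add_apply, Finset.sum_apply]
  have hsum : eLpNorm (∑ i ∈ Finset.range N, (potential μ κ)^[i + 1] F) q μ
      ≤ ∑ i ∈ Finset.range N, A i * eLpNorm F p μ :=
    (eLpNorm_sum_le (fun i _ => hmeas i) hq).trans (Finset.sum_le_sum fun i _ => hA i F hF)
  have hweight : eLpNorm (fun x => (∫⁻ y, F y * w y ∂μ) * w x) q μ
      ≤ B * eLpNorm F p μ * D * μ univ ^ q.toReal⁻¹ := by
    refine eLpNorm_le_of_ae_enorm_bound ?_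
    filter_upwards [hw] with x hx
    exact mul_le_mul' (hB F hF) hx
  rw [hsplit]
  refine (eLpNorm_add_le (Finset.aestronglyMeasurable_sum _ fun i _ => hmeas i)
    (hwm.const_mul _).aestronglyMeasurable hq).trans ((add_le_add hsum hweight).trans_eq ?_)
  push_cast
  rw [ENNReal.coe_toNNReal hm, ← Finset.sum_mul]
  ring

end PotentialSum

namespace GreenKernelBounds

variable {X : Type*} [MetricSpace X] [MeasurableSpace X] [SecondCountableTopology X]
  [OpensMeasurableSpace X] {d β γ : ℝ} {μ : Measure X} [IsFiniteMeasure μ] {δ : X → ℝ≥0}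
  {κ : X → X → ℝ≥0∞} (hκ : GreenKernelBounds d β γ μ δ κ)

include hκ

/-- Iterate the inequality until the kernel is smooth enough to be bounded by the weight. -/
lemma exists_le_sum_potential_iterate_add (A : ℝ≥0) :
    ∃ (N : ℕ) (C : ℝ≥0), ∀ F V : X → ℝ≥0∞, AEMeasurable F μ → AEMeasurable V μ →
      (∀ᵐ x ∂μ, V x ≤ potential μ κ F x + A * potential μ κ V x) →
      ∀ᵐ x ∂μ, V x ≤ (∑ i ∈ Finset.range N, (A : ℝ≥0∞) ^ i * (potential μ κ)^[i + 1] F x)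
        + C * (∫⁻ y, V y * (δ y : ℝ≥0∞) ^ γ ∂μ) * (δ x : ℝ≥0∞) ^ γ := by
  obtain ⟨N, C, hC⟩ := hκ.exists_potential_iterate_le
  refine ⟨N, A ^ N * C, fun F V hF hV h => ?_⟩
  filter_upwards [ae_le_sum_potential_iterate hκ.measurable hF hV A h N, hC V hV] with x hx hVx
  refine hx.trans (add_le_add le_rfl ?_)
  calc (A : ℝ≥0∞) ^ N * (potential μ κ)^[N] V x
      ≤ (A : ℝ≥0∞) ^ N * (C * (δ x : ℝ≥0∞) ^ γ * ∫⁻ y, V y * (δ y : ℝ≥0∞) ^ γ ∂μ) := by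
        gcongr
    _ = _ := by
        push_cast
        ring

lemma exists_le_mul_weight (A : ℝ≥0) :
    ∃ C : ℝ≥0, ∀ F V : X → ℝ≥0∞, AEMeasurable F μ → AEMeasurable V μ →
      (∀ᵐ x ∂μ, V x ≤ potential μ κ F x + A * potential μ κ V x) →
      ∀ M : ℝ≥0, (∀ᵐ x ∂μ, F x ≤ M * (δ x : ℝ≥0∞) ^ γ) →
      ∀ᵐ x ∂μ, V x ≤ C * (M + ∫⁻ y, V y * (δ y : ℝ≥0∞) ^ γ ∂μ) * (δ x : ℝ≥0∞) ^ γ := by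
  obtain ⟨N, C, hC⟩ := hκ.exists_le_sum_potential_iterate_add A
  choose B hB using hκ.exists_potential_iterate_weight_le
  refine ⟨(∑ i ∈ Finset.range N, A ^ i * B (i + 1)) + C, fun F V hF hV h M hM => ?_⟩
  have hiter (i : ℕ) : ∀ᵐ x ∂μ, (potential μ κ)^[i] F x ≤ M * (B i * (δ x : ℝ≥0∞) ^ γ) := by
    have hmono := potential_iterate_mono_ae (κ := κ) hM i
    rw [potential_iterate_const_mul hκ.measurable
      (hκ.measurable_rpow_weight γ).aemeasurable M i] at hmono
    filter_upwards [hmono, hB i] with x hx hBx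
    exact hx.trans (by gcongr)
  filter_upwards [hC F V hF hV h, ae_all_iff.2 hiter] with x hx hxi
  refine hx.trans ?_
  push_cast
  rw [add_mul, add_mul]
  gcongr
  · rw [Finset.sum_mul, Finset.sum_mul]
    refine Finset.sum_le_sum fun i _ => ?_
    calc (A : ℝ≥0∞) ^ i * (potential μ κ)^[i + 1] F x
        ≤ (A : ℝ≥0∞) ^ i * (M * (B (i + 1) * (δ x : ℝ≥0∞) ^ γ)) := by
          gcongr
          exact hxi (i + 1)
      _ = (A : ℝ≥0∞) ^ i * B (i + 1) * M * (δ x : ℝ≥0∞) ^ γ := by ring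
      _ ≤ _ := by
          gcongr
          exact le_self_add
  · exact le_add_self

lemma exists_le_potentialSum (A B D : ℝ≥0) :
    ∃ (N : ℕ) (C : ℝ≥0), ∀ F P V : X → ℝ≥0∞, AEMeasurable F μ → AEMeasurable P μ →
      AEMeasurable V μ → (∀ᵐ x ∂μ, V x ≤ potential μ κ P x + A * potential μ κ V x) →
      (∀ᵐ x ∂μ, P x ≤ F x + B * (∫⁻ y, F y * (δ y : ℝ≥0∞) ^ γ ∂μ) * (δ x : ℝ≥0∞) ^ γ) →
      ∫⁻ y, V y * (δ y : ℝ≥0∞) ^ γ ∂μ ≤ D * ∫⁻ y, F y * (δ y : ℝ≥0∞) ^ γ ∂μ →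
      ∀ᵐ x ∂μ, V x ≤ C * potentialSum μ κ (fun y => (δ y : ℝ≥0∞) ^ γ) N F x := by
  obtain ⟨N, C, hC⟩ := hκ.exists_le_sum_potential_iterate_add A
  choose E hE using hκ.exists_potential_iterate_weight_le
  refine ⟨N, (∑ i ∈ Finset.range N, A ^ i * (1 + B * E (i + 1))) + C * D,
    fun F P V hF hP hV hVP hPF hVF => ?_⟩
  set I := ∫⁻ y, F y * (δ y : ℝ≥0∞) ^ γ ∂μ
  have hiter (i : ℕ) : ∀ᵐ x ∂μ, (potential μ κ)^[i] P x
      ≤ (potential μ κ)^[i] F x + B * I * (E i * (δ x : ℝ≥0∞) ^ γ) := by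
    have hmono := potential_iterate_mono_ae (κ := κ) hPF i
    have hw := (hκ.measurable_rpow_weight γ).aemeasurable (μ := μ)
    rw [potential_iterate_add hκ.measurable hF (hw.const_mul _),
      potential_iterate_const_mul hκ.measurable hw] at hmono
    filter_upwards [hmono, hE i] with x hx hEx
    exact hx.trans (by gcongr)
  filter_upwards [hC P V hP hV hVP, ae_all_iff.2 hiter] with x hx hxi
  set S := potentialSum μ κ (fun y => (δ y : ℝ≥0∞) ^ γ) N F x
  have hIS : I * (δ x : ℝ≥0∞) ^ γ ≤ S := lintegral_mul_mul_le_potentialSum N F x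
  refine hx.trans ?_
  push_cast
  rw [add_mul, Finset.sum_mul]
  refine add_le_add (Finset.sum_le_sum fun i hi => ?_) ?_
  · calc (A : ℝ≥0∞) ^ i * (potential μ κ)^[i + 1] P x
        ≤ A ^ i * ((potential μ κ)^[i + 1] F x + B * I * (E (i + 1) * (δ x : ℝ≥0∞) ^ γ)) := by
          gcongr
          exact hxi (i + 1)
      _ = A ^ i * ((potential μ κ)^[i + 1] F x + B * E (i + 1) * (I * (δ x : ℝ≥0∞) ^ γ)) := by
          ring
      _ ≤ A ^ i * (S + B * E (i + 1) * S) := by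
          gcongr
          exact potential_iterate_le_potentialSum (Finset.mem_range.1 hi) F x
      _ = _ := by ring
  · calc (C : ℝ≥0∞) * (∫⁻ y, V y * (δ y : ℝ≥0∞) ^ γ ∂μ) * (δ x : ℝ≥0∞) ^ γ
        ≤ C * (D * I) * (δ x : ℝ≥0∞) ^ γ := by gcongr
      _ = C * D * (I * (δ x : ℝ≥0∞) ^ γ) := by ring
      _ ≤ _ := by gcongr

lemma exists_potentialSum_le_on_thickening {D : ℝ≥0} (hD : ∀ᵐ x ∂μ, (δ x : ℝ≥0∞) ^ γ ≤ D)
    (K : Set X) (t : ℝ) {ε : ℝ} (hε : 0 < ε) (N : ℕ) :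
    ∃ C : ℝ≥0, ∀ F : X → ℝ≥0∞, AEMeasurable F μ → ∀ B : ℝ≥0∞,
      (∀ᵐ y ∂μ, y ∈ Metric.thickening (t + ε) K → F y ≤ B) →
      ∀ᵐ x ∂μ, x ∈ Metric.thickening t K →
        potentialSum μ κ (fun y => (δ y : ℝ≥0∞) ^ γ) N F x
          ≤ C * (B + ∫⁻ y, F y * (δ y : ℝ≥0∞) ^ γ ∂μ) := by
  choose E hE using fun i => hκ.exists_potential_iterate_le_on_thickening K i t hε
  refine ⟨(∑ i ∈ Finset.range N, E i) + D, fun F hF B hB => ?_⟩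
  filter_upwards [hD, ae_all_iff.2 fun i => hE i F hF B hB] with x hDx hEx hxK
  push_cast
  rw [add_mul, Finset.sum_mul]
  refine add_le_add (Finset.sum_le_sum fun i _ => hEx i hxK) ?_
  rw [mul_comm]
  exact mul_le_mul' hDx le_add_self

end GreenKernelBounds

section BoundaryDistance

variable {n : ℕ} {Ω : Set (Pt n)} {γ : ℝ}

lemma bdist_nonneg (Ω : Set (Pt n)) (x : Pt n) : 0 ≤ bdist Ω x := Metric.infDist_nonneg

lemma bdist_le_add_dist (Ω : Set (Pt n)) (x y : Pt n) : bdist Ω y ≤ bdist Ω x + dist x y := by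
  rw [dist_comm]
  exact Metric.infDist_le_infDist_add_dist

lemma frontier_nonempty_of_isBounded (hn : 1 ≤ n) (hΩb : Bornology.IsBounded Ω)
    (hΩne : Ω.Nonempty) : (frontier Ω).Nonempty := by
  have : Nonempty (Fin n) := ⟨⟨0, hn⟩⟩
  refine nonempty_frontier_iff.2 ⟨hΩne, ?_⟩
  rintro rfl
  exact NormedSpace.unbounded_univ ℝ (Pt n) hΩb

lemma bdist_pos (hn : 1 ≤ n) (hΩo : IsOpen Ω) (hΩb : Bornology.IsBounded Ω) {x : Pt n}
    (hx : x ∈ Ω) : 0 < bdist Ω x := by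
  refine (isClosed_frontier.notMem_iff_infDist_pos
    (frontier_nonempty_of_isBounded hn hΩb ⟨x, hx⟩)).1 fun h => ?_
  rw [hΩo.frontier_eq] at h
  exact h.2 hx

lemma bdist_le_diam (hn : 1 ≤ n) (hΩb : Bornology.IsBounded Ω) {x : Pt n} (hx : x ∈ Ω) :
    bdist Ω x ≤ Metric.diam (closure Ω) := by
  obtain ⟨z, hz⟩ := frontier_nonempty_of_isBounded hn hΩb ⟨x, hx⟩
  exact (Metric.infDist_le_dist_of_mem hz).trans
    (Metric.dist_le_diam_of_mem hΩb.closure (subset_closure hx) (frontier_subset_closure hz))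

lemma measurable_bdist (Ω : Set (Pt n)) : Measurable (bdist Ω) := measurable_infDist

/-- The distance to the boundary `bdist Ω`, as a weight with values in `ℝ≥0`. -/
noncomputable def bdistNN (Ω : Set (Pt n)) (x : Pt n) : ℝ≥0 := Metric.infNndist x (frontier Ω)

lemma ofReal_bdist_rpow (hγ : 0 ≤ γ) (x : Pt n) :
    ENNReal.ofReal (bdist Ω x ^ γ) = (bdistNN Ω x : ℝ≥0∞) ^ γ := by
  rw [← ENNReal.ofReal_rpow_of_nonneg (bdist_nonneg Ω x) hγ, bdist, ← Metric.coe_infNndist,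
    ENNReal.ofReal_coe_nnreal, bdistNN]

lemma enorm_mul_bdist_rpow (hγ : 0 ≤ γ) (f : Pt n → ℝ) (x : Pt n) :
    ‖f x * bdist Ω x ^ γ‖ₑ = ‖f x‖ₑ * (bdistNN Ω x : ℝ≥0∞) ^ γ := by
  rw [enorm_mul, Real.enorm_of_nonneg (Real.rpow_nonneg (bdist_nonneg Ω x) γ),
    ofReal_bdist_rpow hγ]

end BoundaryDistance

section ModelKernel

variable {n : ℕ} {Ω : Set (Pt n)} {s γ : ℝ} {G : Pt n → Pt n → ℝ}

lemma isUpperRegular_mu (hn : 1 ≤ n) (Ω : Set (Pt n)) : IsUpperRegular n (mu Ω) := by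
  have : Nonempty (Fin n) := ⟨⟨0, hn⟩⟩
  refine ⟨(volume (Metric.ball (0 : Pt n) 1)).toNNReal, fun x r hr => ?_⟩
  calc mu Ω (Metric.ball x r) ≤ volume (Metric.ball x r) := Measure.restrict_apply_le _ _
    _ = _ := by
      rw [Measure.addHaar_ball _ _ hr.le, finrank_euclideanSpace_fin, mul_comm,
        ENNReal.coe_toNNReal measure_ball_lt_top.ne, Real.rpow_natCast]

lemma min_div_rpow_one_le {p d γ b : ℝ} (hp : 0 ≤ p) (hd : 0 < d) (hb : 0 ≤ b) (hbγ : b ≤ γ) :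
    min (p ^ γ / d ^ γ) 1 ≤ p ^ b / d ^ b := by
  rw [← Real.div_rpow hp hd.le, ← Real.div_rpow hp hd.le]
  rcases le_total (p / d) 1 with h | h
  · exact (min_le_left _ _).trans
      (Real.rpow_le_rpow_of_exponent_ge_of_imp (by positivity) h hbγ fun _ hγ => by linarith)
  · exact (min_le_right _ _).trans (Real.one_le_rpow h hb)

/-- The gain `p ^ ε`: if `d ≤ p`, then `q ≤ 2 p` and `1 ≤ (p / d) ^ ε`; if `p ≤ d`, then `q ≤ 2 d`
and the minimum is at most `(p / d) ^ (a + ε)`. -/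
lemma min_mul_min_mul_rpow_le {p q d γ a ε : ℝ} (hp : 0 ≤ p) (hq : 0 ≤ q) (hd : 0 < d)
    (hqp : q ≤ p + d) (ha : 0 ≤ a) (hε : 0 ≤ ε) (haε : a + ε ≤ γ) :
    min (p ^ γ / d ^ γ) 1 * min (q ^ γ / d ^ γ) 1 * q ^ a
      ≤ 2 ^ γ * (p ^ (a + ε) * d ^ (-ε)) := by
  have hqa {t : ℝ} (ht : 0 ≤ t) (hqt : q ≤ 2 * t) : q ^ a ≤ 2 ^ γ * t ^ a :=
    calc q ^ a ≤ (2 * t) ^ a := Real.rpow_le_rpow hq hqt ha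
      _ = 2 ^ a * t ^ a := Real.mul_rpow zero_le_two ht
      _ ≤ 2 ^ γ * t ^ a := by
        gcongr
        exacts [one_le_two, by linarith]
  calc min (p ^ γ / d ^ γ) 1 * min (q ^ γ / d ^ γ) 1 * q ^ a
      ≤ min (p ^ γ / d ^ γ) 1 * 1 * q ^ a := by
        gcongr
        exact min_le_right _ _
    _ ≤ 2 ^ γ * (p ^ (a + ε) * d ^ (-ε)) := by
      rw [mul_one]
      rcases le_total d p with h | h
      · have hp' : 0 < p := hd.trans_le h
        have hone : 1 ≤ p ^ ε * d ^ (-ε) := by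
          rw [Real.rpow_neg hd.le, ← div_eq_mul_inv, ← Real.div_rpow hp hd.le]
          exact Real.one_le_rpow ((one_le_div hd).2 h) hε
        calc min (p ^ γ / d ^ γ) 1 * q ^ a ≤ 1 * (2 ^ γ * p ^ a) := by
              gcongr
              exacts [min_le_right _ _, hqa hp (by linarith)]
          _ ≤ 2 ^ γ * p ^ a * (p ^ ε * d ^ (-ε)) := by
              rw [one_mul]
              exact le_mul_of_one_le_right (by positivity) hone
          _ = _ := by
              rw [Real.rpow_add hp']
              ring
      · calc min (p ^ γ / d ^ γ) 1 * q ^ a ≤ p ^ (a + ε) / d ^ (a + ε) * (2 ^ γ * d ^ a) := by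
              gcongr
              exacts [min_div_rpow_one_le hp hd (add_nonneg ha hε) haε, hqa hd.le (by linarith)]
          _ = _ := by
              rw [Real.rpow_add hd, Real.rpow_neg hd.le]
              field_simp

lemma rpow_neg_le_of_le {b d D : ℝ} (hd : 0 < d) (hdD : d ≤ D) (hD : 1 ≤ D) :
    d ^ (-b) ≤ D ^ |b| * d ^ (-max b 0) := by
  rcases le_total 0 b with h | h
  · rw [max_eq_left h]
    exact le_mul_of_one_le_left (by positivity) (Real.one_le_rpow hD (abs_nonneg _))
  · rw [max_eq_right h, neg_zero, Real.rpow_zero, mul_one, abs_of_nonpos h]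
    exact Real.rpow_le_rpow hd.le hdD (by linarith)

lemma modelKernel_nonneg (s γ : ℝ) (Ω : Set (Pt n)) (x y : Pt n) : 0 ≤ modelKernel s γ Ω x y := by
  have hx := bdist_nonneg Ω x
  have hy := bdist_nonneg Ω y
  rw [modelKernel]
  positivity

lemma modelKernel_mul_bdist_rpow_le {a ε D : ℝ} (ha : 0 ≤ a) (hε : 0 ≤ ε) (haε : a + ε ≤ γ)
    {x y : Pt n} (hxy : x ≠ y) (hD : 1 ≤ D) (hdD : dist x y ≤ D) :
    modelKernel s γ Ω x y * bdist Ω y ^ a ≤ D ^ |(n : ℝ) - 2 * s| * 2 ^ γ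
      * bdist Ω x ^ (a + ε) * dist x y ^ (-(max ((n : ℝ) - 2 * s) 0 + ε)) := by
  have hd : 0 < dist x y := dist_pos.2 hxy
  have hx := bdist_nonneg Ω x
  have hy := bdist_nonneg Ω y
  calc modelKernel s γ Ω x y * bdist Ω y ^ a
      = dist x y ^ (-((n : ℝ) - 2 * s)) * (min (bdist Ω x ^ γ / dist x y ^ γ) 1
          * min (bdist Ω y ^ γ / dist x y ^ γ) 1 * bdist Ω y ^ a) := by
        rw [modelKernel, Real.rpow_neg hd.le]
        ring
    _ ≤ D ^ |(n : ℝ) - 2 * s| * dist x y ^ (-max ((n : ℝ) - 2 * s) 0)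
          * (2 ^ γ * (bdist Ω x ^ (a + ε) * dist x y ^ (-ε))) := by
        have hmin := min_mul_min_mul_rpow_le hx hy hd (bdist_le_add_dist Ω x y) ha hε haε
        have hpow := rpow_neg_le_of_le (b := (n : ℝ) - 2 * s) hd hdD hD
        exact mul_le_mul hpow hmin (by positivity) (by positivity)
    _ = _ := by
        rw [neg_add, Real.rpow_add hd]
        ring

lemma GreenBounds.exists_enorm_mul_weight_le (hΩb : Bornology.IsBounded Ω)
    (hG : GreenBounds s γ Ω G) :
    ∃ c : ℝ≥0, ∀ a ε : ℝ, 0 ≤ a → 0 ≤ ε → a + ε ≤ γ → ∀ x ∈ Ω, ∀ y ∈ Ω, x ≠ y →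
      ‖G x y‖ₑ * (bdistNN Ω y : ℝ≥0∞) ^ a
        ≤ c * (bdistNN Ω x : ℝ≥0∞) ^ (a + ε) * rieszKernel (max ((n : ℝ) - 2 * s) 0 + ε) x y := by
  obtain ⟨c, hc, hcomp⟩ := hG.comparable
  obtain ⟨D, hD⟩ := Metric.isBounded_iff.1 hΩb
  set D' := max D 1
  have hD' : 1 ≤ D' := le_max_right _ _
  refine ⟨(c * (D' ^ |(n : ℝ) - 2 * s| * 2 ^ γ)).toNNReal, fun a ε ha hε haε x hx y hy hxy => ?_⟩
  have hmodel := modelKernel_nonneg s γ Ω x y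
  have hG0 : 0 ≤ G x y := (by positivity : 0 ≤ c⁻¹ * modelKernel s γ Ω x y).trans
    (hcomp x hx y hy hxy).1
  have hx0 := Real.rpow_nonneg (bdist_nonneg Ω x) (a + ε)
  have hy0 := Real.rpow_nonneg (bdist_nonneg Ω y) a
  rw [Real.enorm_of_nonneg hG0, ← ofReal_bdist_rpow ha, ← ofReal_bdist_rpow (add_nonneg ha hε),
    rieszKernel, ← ENNReal.ofReal_mul hG0, ← ENNReal.ofReal, ← ENNReal.ofReal_mul (by positivity),
    ← ENNReal.ofReal_mul (by positivity)]
  refine ENNReal.ofReal_le_ofReal ?_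
  calc G x y * bdist Ω y ^ a ≤ c * (modelKernel s γ Ω x y * bdist Ω y ^ a) := by
        rw [← mul_assoc]
        exact mul_le_mul_of_nonneg_right (hcomp x hx y hy hxy).2 hy0
    _ ≤ c * (D' ^ |(n : ℝ) - 2 * s| * 2 ^ γ * bdist Ω x ^ (a + ε)
          * dist x y ^ (-(max ((n : ℝ) - 2 * s) 0 + ε))) := by
        refine mul_le_mul_of_nonneg_left ?_ hc.le
        exact modelKernel_mul_bdist_rpow_le ha hε haε hxy hD' ((hD hx hy).trans (le_max_left _ _))
    _ = _ := by ring

lemma ae_ae_mu_of_forall_mem_ne (hn : 1 ≤ n) (hΩ : MeasurableSet Ω) {P : Pt n → Pt n → Prop}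
    (hP : ∀ x ∈ Ω, ∀ y ∈ Ω, x ≠ y → P x y) : ∀ᵐ x ∂(mu Ω), ∀ᵐ y ∂(mu Ω), P x y := by
  filter_upwards [ae_restrict_mem hΩ] with x hx
  filter_upwards [ae_restrict_mem hΩ, (isUpperRegular_mu hn Ω).ae_ne (Nat.cast_pos.2 hn) x]
    with y hy hyx
  exact hP x hx y hy hyx.symm

lemma GreenBounds.ae_symm (hn : 1 ≤ n) (hΩ : MeasurableSet Ω) (hG : GreenBounds s γ Ω G) :
    ∀ᵐ x ∂(mu Ω), ∀ᵐ y ∂(mu Ω), G x y = G y x :=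
  ae_ae_mu_of_forall_mem_ne hn hΩ hG.symm

lemma GreenBounds.greenKernelBounds (hn : 1 ≤ n) (hs : 0 < s) (hγ : 0 ≤ γ) (hΩ : MeasurableSet Ω)
    (hΩb : Bornology.IsBounded Ω) (hG : GreenBounds s γ Ω G) :
    GreenKernelBounds n (max ((n : ℝ) - 2 * s) 0) γ (mu Ω) (bdistNN Ω)
      (fun x y => ‖G x y‖ₑ) := by
  have hn0 : (0 : ℝ) < n := Nat.cast_pos.2 hn
  obtain ⟨c, hc⟩ := hG.exists_enorm_mul_weight_le hΩb
  exact
    { upperRegular := isUpperRegular_mu hn Ω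
      β_nonneg := le_max_right _ _
      β_lt := max_lt (by linarith) hn0
      γ_nonneg := hγ
      measurable_weight := measurable_infNndist
      measurable := hG.measurable.enorm
      symm := (hG.ae_symm hn hΩ).mono fun x hx => hx.mono fun y hxy => by rw [hxy]
      gain := ⟨c, fun a ε ha hε haε => ae_ae_mu_of_forall_mem_ne hn hΩ (hc a ε ha hε haε)⟩ }

end ModelKernel

section IntegralOperator

variable {α : Type*} [MeasurableSpace α] {μ : Measure α} {G : α → α → ℝ} {f g : α → ℝ}

/-- The integral operator `f ↦ ∫ G(·, y) f(y) dμ(y)` with a signed kernel; its value is `0` at the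
points where the integral does not converge absolutely. -/
noncomputable def integralOp (μ : Measure α) (G : α → α → ℝ) (f : α → ℝ) (x : α) : ℝ :=
  ∫ y, G x y * f y ∂μ

lemma integralOp_congr_ae (G : α → α → ℝ) (h : f =ᵐ[μ] g) :
    integralOp μ G f = integralOp μ G g := by
  ext x
  refine integral_congr_ae ?_
  filter_upwards [h] with y hy
  rw [hy]

lemma enorm_integralOp_le (μ : Measure α) (G : α → α → ℝ) (f : α → ℝ) (x : α) :
    ‖integralOp μ G f x‖ₑ ≤ potential μ (fun x y => ‖G x y‖ₑ) (fun y => ‖f y‖ₑ) x := by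
  refine (enorm_integral_le_lintegral_enorm _).trans_eq ?_
  simp_rw [enorm_mul]
  rfl

lemma enorm_integralOp_iterate_le (μ : Measure α) (G : α → α → ℝ) (f : α → ℝ) (i : ℕ) (x : α) :
    ‖(integralOp μ G)^[i] f x‖ₑ
      ≤ (potential μ fun x y => ‖G x y‖ₑ)^[i] (fun y => ‖f y‖ₑ) x := by
  induction i generalizing x with
  | zero => rfl
  | succ i ih =>
    rw [Function.iterate_succ_apply', Function.iterate_succ_apply']
    exact (enorm_integralOp_le μ G _ x).trans (potential_mono_ae (Eventually.of_forall ih) x)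

lemma integrable_kernel_mul (hG : Measurable (Function.uncurry G)) (hf : AEStronglyMeasurable f μ)
    {x : α} (hx : potential μ (fun x y => ‖G x y‖ₑ) (fun y => ‖f y‖ₑ) x ≠ ⊤) :
    Integrable (fun y => G x y * f y) μ := by
  refine ⟨hG.of_uncurry_left.aestronglyMeasurable.mul hf, ?_⟩
  simp_rw [HasFiniteIntegral, enorm_mul]
  exact hx.lt_top

lemma integralOp_add (hG : Measurable (Function.uncurry G)) (hf : AEStronglyMeasurable f μ)
    (hg : AEStronglyMeasurable g μ) {x : α}
    (hfx : potential μ (fun x y => ‖G x y‖ₑ) (fun y => ‖f y‖ₑ) x ≠ ⊤)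
    (hgx : potential μ (fun x y => ‖G x y‖ₑ) (fun y => ‖g y‖ₑ) x ≠ ⊤) :
    integralOp μ G (f + g) x = integralOp μ G f x + integralOp μ G g x := by
  simp_rw [integralOp, Pi.add_apply, mul_add]
  exact integral_add (integrable_kernel_mul hG hf hfx) (integrable_kernel_mul hG hg hgx)

lemma integralOp_const_smul (μ : Measure α) (G : α → α → ℝ) (c : ℝ) (f : α → ℝ) (x : α) :
    integralOp μ G (c • f) x = c * integralOp μ G f x := by
  rw [integralOp, integralOp, ← integral_const_mul]
  simp_rw [Pi.smul_apply, smul_eq_mul, mul_left_comm]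

variable [SFinite μ]

lemma aestronglyMeasurable_integralOp (hG : Measurable (Function.uncurry G))
    (hf : AEStronglyMeasurable f μ) : AEStronglyMeasurable (integralOp μ G f) μ :=
  AEStronglyMeasurable.integral_prod_right' (f := fun z : α × α => G z.1 z.2 * f z.2)
    (hG.aestronglyMeasurable.mul hf.comp_snd)

lemma integral_integralOp_mul (hG : Measurable (Function.uncurry G))
    (hsymm : ∀ᵐ x ∂μ, ∀ᵐ y ∂μ, G x y = G y x)
    (hf : AEStronglyMeasurable f μ) (hg : AEStronglyMeasurable g μ)
    (hfin : ∫⁻ x, potential μ (fun x y => ‖G x y‖ₑ) (fun y => ‖f y‖ₑ) x * ‖g x‖ₑ ∂μ ≠ ⊤) :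
    ∫ x, integralOp μ G f x * g x ∂μ = ∫ x, f x * integralOp μ G g x ∂μ := by
  have hm : AEStronglyMeasurable (Function.uncurry fun x y => G x y * f y * g x) (μ.prod μ) :=
    (hG.aestronglyMeasurable.mul hf.comp_snd).mul hg.comp_fst
  have hint : Integrable (Function.uncurry fun x y => G x y * f y * g x) (μ.prod μ) := by
    refine ⟨hm, ?_⟩
    rw [HasFiniteIntegral, lintegral_prod _ hm.enorm]
    refine lt_of_eq_of_lt (lintegral_congr fun x => ?_) hfin.lt_top
    rw [potential, ← lintegral_mul_const'' _
      (aemeasurable_kernel_mul (κ := fun x y => ‖G x y‖ₑ) hG.enorm hf.enorm x)]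
    simp only [Function.uncurry_apply_pair, enorm_mul]
  calc ∫ x, integralOp μ G f x * g x ∂μ = ∫ x, ∫ y, G x y * f y * g x ∂μ ∂μ := by
        simp_rw [integralOp, ← integral_mul_const]
    _ = ∫ y, ∫ x, G x y * f y * g x ∂μ ∂μ := integral_integral_swap hint
    _ = _ := by
        refine integral_congr_ae ?_
        filter_upwards [hsymm] with y hy
        rw [integralOp, ← integral_const_mul]
        refine integral_congr_ae ?_
        filter_upwards [hy] with x hx
        rw [hx]
        ring

section Bounded

variable {A : ℝ≥0} {p : ℝ≥0∞}

lemma eLpNorm_potential_enorm_le (hG : Measurable (Function.uncurry G))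
    (hsymm : ∀ᵐ x ∂μ, ∀ᵐ y ∂μ, G x y = G y x) (hA : ∀ᵐ x ∂μ, ∫⁻ y, ‖G x y‖ₑ ∂μ ≤ A)
    (hp : 1 ≤ p) (hp' : p ≠ ⊤) (hf : AEStronglyMeasurable f μ) :
    eLpNorm (potential μ (fun x y => ‖G x y‖ₑ) (fun y => ‖f y‖ₑ)) p μ ≤ A * eLpNorm f p μ := by
  have hp0 : p ≠ 0 := (zero_lt_one.trans_le hp).ne'
  have hpr : 1 ≤ p.toReal := by simpa using ENNReal.toReal_mono hp' hp
  have hA' : ∀ᵐ x ∂μ, potential μ (fun x y => ‖G x y‖ₑ) (fun _ => 1) x ≤ A := by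
    simpa only [potential, mul_one] using hA
  have hschur := lintegral_potential_rpow_le_of_potential_one_le (κ := fun x y => ‖G x y‖ₑ)
    hG.enorm (hsymm.mono fun x hx => hx.mono fun y hxy => by rw [hxy]) hA' hf.enorm hpr
  rw [eLpNorm_eq_lintegral_rpow_enorm_toReal hp0 hp',
    eLpNorm_eq_lintegral_rpow_enorm_toReal hp0 hp']
  simp only [enorm_eq_self]
  calc _ ≤ ((A : ℝ≥0∞) ^ p.toReal * ∫⁻ x, ‖f x‖ₑ ^ p.toReal ∂μ) ^ (1 / p.toReal) := by gcongr
    _ = _ := by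
      rw [ENNReal.mul_rpow_of_nonneg _ _ (by positivity), one_div,
        ENNReal.rpow_rpow_inv (by linarith)]

lemma ae_potential_enorm_ne_top (hG : Measurable (Function.uncurry G))
    (hsymm : ∀ᵐ x ∂μ, ∀ᵐ y ∂μ, G x y = G y x) (hA : ∀ᵐ x ∂μ, ∫⁻ y, ‖G x y‖ₑ ∂μ ≤ A)
    (hp : 1 ≤ p) (hp' : p ≠ ⊤) (hf : MemLp f p μ) :
    ∀ᵐ x ∂μ, potential μ (fun x y => ‖G x y‖ₑ) (fun y => ‖f y‖ₑ) x ≠ ⊤ := by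
  have hp0 : 0 < p := zero_lt_one.trans_le hp
  have hlt := (eLpNorm_potential_enorm_le hG hsymm hA hp hp' hf.1).trans_lt
    (ENNReal.mul_lt_top ENNReal.coe_lt_top hf.2)
  have hint := (eLpNorm_lt_top_iff_lintegral_rpow_enorm_lt_top hp0.ne' hp').1 hlt
  simp only [enorm_eq_self] at hint
  have hmeas := (measurable_potential (κ := fun x y => ‖G x y‖ₑ) hG.enorm hf.1.enorm).pow_const
    p.toReal
  filter_upwards [ae_lt_top hmeas hint.ne] with x hx
  exact ((ENNReal.rpow_lt_top_iff_of_pos (ENNReal.toReal_pos hp0.ne' hp')).1 hx).ne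

lemma memLp_integralOp (hG : Measurable (Function.uncurry G))
    (hsymm : ∀ᵐ x ∂μ, ∀ᵐ y ∂μ, G x y = G y x) (hA : ∀ᵐ x ∂μ, ∫⁻ y, ‖G x y‖ₑ ∂μ ≤ A)
    (hp : 1 ≤ p) (hp' : p ≠ ⊤) (hf : MemLp f p μ) :
    MemLp (integralOp μ G f) p μ ∧ eLpNorm (integralOp μ G f) p μ ≤ A * eLpNorm f p μ := by
  have hle : eLpNorm (integralOp μ G f) p μ ≤ A * eLpNorm f p μ :=
    (eLpNorm_mono_enorm fun x => by simpa using enorm_integralOp_le μ G f x).trans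
      (eLpNorm_potential_enorm_le hG hsymm hA hp hp' hf.1)
  exact ⟨⟨aestronglyMeasurable_integralOp hG hf.1,
    hle.trans_lt (ENNReal.mul_lt_top ENNReal.coe_lt_top hf.2)⟩, hle⟩

lemma exists_continuousLinearMap_integralOp (hG : Measurable (Function.uncurry G))
    (hsymm : ∀ᵐ x ∂μ, ∀ᵐ y ∂μ, G x y = G y x) (hA : ∀ᵐ x ∂μ, ∫⁻ y, ‖G x y‖ₑ ∂μ ≤ A)
    [Fact (1 ≤ p)] (hp' : p ≠ ⊤) :
    ∃ T : Lp ℝ p μ →L[ℝ] Lp ℝ p μ, (∀ f : Lp ℝ p μ, T f =ᵐ[μ] integralOp μ G f) ∧ ‖T‖ ≤ A := by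
  have hp : 1 ≤ p := Fact.out
  have hmem (f : Lp ℝ p μ) := memLp_integralOp hG hsymm hA hp hp' (Lp.memLp f)
  have hfin (f : Lp ℝ p μ) := ae_potential_enorm_ne_top hG hsymm hA hp hp' (Lp.memLp f)
  let T : Lp ℝ p μ →ₗ[ℝ] Lp ℝ p μ :=
    { toFun := fun f => (hmem f).1.toLp
      map_add' := by
        intro f g
        apply Lp.ext
        filter_upwards [(hmem (f + g)).1.coeFn_toLp, (hmem f).1.coeFn_toLp,
          (hmem g).1.coeFn_toLp, Lp.coeFn_add (hmem f).1.toLp (hmem g).1.toLp, hfin f, hfin g]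
          with x hfg hf hg hadd hfx hgx
        rw [hfg, hadd, Pi.add_apply, hf, hg, integralOp_congr_ae G (Lp.coeFn_add f g),
          integralOp_add hG (Lp.aestronglyMeasurable f) (Lp.aestronglyMeasurable g) hfx hgx]
      map_smul' := by
        intro r f
        apply Lp.ext
        filter_upwards [(hmem (r • f)).1.coeFn_toLp, (hmem f).1.coeFn_toLp,
          Lp.coeFn_smul r (hmem f).1.toLp] with x hrf hf hsmul
        rw [hrf, RingHom.id_apply, hsmul, Pi.smul_apply, hf,
          integralOp_congr_ae G (Lp.coeFn_smul r f), integralOp_const_smul, smul_eq_mul] }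
  refine ⟨T.mkContinuous A fun f => ?_, fun f => (hmem f).1.coeFn_toLp,
    T.mkContinuous_norm_le A.coe_nonneg _⟩
  change ‖(hmem f).1.toLp‖ ≤ _
  rw [Lp.norm_toLp, Lp.norm_def, ← ENNReal.coe_toReal, ← ENNReal.toReal_mul]
  exact ENNReal.toReal_mono (ENNReal.mul_ne_top ENNReal.coe_ne_top (Lp.eLpNorm_ne_top f)) (hmem f).2

end Bounded

end IntegralOperator

section HilbertSchmidt

variable {ι 𝕜 E F : Type*} [RCLike 𝕜] [NormedAddCommGroup E] [InnerProductSpace 𝕜 E]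
  [NormedAddCommGroup F] [NormedSpace 𝕜 F]

lemma norm_sum_smulRight_innerSL_le {b : ι → E} (hb : Orthonormal 𝕜 b) (v : ι → F)
    (s : Finset ι) :
    ‖∑ i ∈ s, (innerSL 𝕜 (b i)).smulRight (v i)‖ ≤ √(∑ i ∈ s, ‖v i‖ ^ 2) := by
  refine ContinuousLinearMap.opNorm_le_bound _ (Real.sqrt_nonneg _) fun f => ?_
  calc ‖(∑ i ∈ s, (innerSL 𝕜 (b i)).smulRight (v i)) f‖
      = ‖∑ i ∈ s, inner 𝕜 (b i) f • v i‖ := by simp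
    _ ≤ ∑ i ∈ s, ‖inner 𝕜 (b i) f‖ * ‖v i‖ :=
        (norm_sum_le _ _).trans_eq (Finset.sum_congr rfl fun i _ => norm_smul _ _)
    _ ≤ √(∑ i ∈ s, ‖inner 𝕜 (b i) f‖ ^ 2) * √(∑ i ∈ s, ‖v i‖ ^ 2) :=
        Real.sum_mul_le_sqrt_mul_sqrt _ _ _
    _ ≤ √(‖f‖ ^ 2) * √(∑ i ∈ s, ‖v i‖ ^ 2) := by
        gcongr
        exact hb.sum_inner_products_le f
    _ = _ := by rw [Real.sqrt_sq (norm_nonneg _), mul_comm]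

variable [CompleteSpace F]

/-- Hilbert-Schmidt operators are limits in norm of operators of finite rank. -/
lemma isCompactOperator_of_summable_norm_sq (b : HilbertBasis ι 𝕜 E) (T : E →L[𝕜] F)
    (h : Summable fun i => ‖T (b i)‖ ^ 2) : IsCompactOperator T := by
  let A (i : ι) : E →L[𝕜] F := (innerSL 𝕜 (b i)).smulRight (T (b i))
  have hA (i : ι) : A i ∈ compactOperator (RingHom.id 𝕜) E F :=
    (isCompactOperator_of_locallyCompactSpace_dom (innerSL 𝕜 (b i))).clm_comp
      (ContinuousLinearMap.toSpanSingleton 𝕜 (T (b i)))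
  have hsum : Summable A := by
    refine summable_iff_vanishing_norm.2 fun ε hε => ?_
    obtain ⟨s, hs⟩ := summable_iff_vanishing_norm.1 h (ε ^ 2) (by positivity)
    refine ⟨s, fun t ht => (norm_sum_smulRight_innerSL_le b.orthonormal _ t).trans_lt ?_⟩
    exact (Real.sqrt_lt' hε).2 ((le_abs_self _).trans_lt (hs t ht))
  have hT : ∑' i, A i = T := by
    ext f
    have hf := (b.hasSum_repr f).mapL T
    simp only [map_smul, b.repr_apply_apply] at hf
    exact (hsum.hasSum.mapL (ContinuousLinearMap.apply 𝕜 F f)).unique hf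
  rw [← hT]
  exact isCompactOperator_of_tendsto hsum.hasSum
    (Eventually.of_forall fun s => Submodule.sum_mem _ fun i _ => hA i)

end HilbertSchmidt

section CompactIntegralOperator

variable {α : Type*} [MeasurableSpace α] {μ : Measure α} {G K : α → α → ℝ}

lemma enorm_sq_eq_lintegral (f : Lp ℝ 2 μ) : ‖f‖ₑ ^ 2 = ∫⁻ x, ‖f x‖ₑ ^ 2 ∂μ := by
  have h := eLpNorm_nnreal_pow_eq_lintegral (f := f) (μ := μ) (p := 2) two_ne_zero
  rw [NNReal.coe_ofNat] at h
  rw [Lp.enorm_def]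
  exact_mod_cast h

lemma sum_enorm_integralOp_sq_le {ι : Type*} {b : ι → Lp ℝ 2 μ} (hb : Orthonormal ℝ b)
    (hG : Measurable (Function.uncurry G)) (s : Finset ι) (x : α) :
    ∑ i ∈ s, ‖integralOp μ G (b i) x‖ₑ ^ 2 ≤ ∫⁻ y, ‖G x y‖ₑ ^ 2 ∂μ := by
  rcases eq_or_ne (∫⁻ y, ‖G x y‖ₑ ^ 2 ∂μ) ⊤ with htop | hfin
  · exact htop ▸ le_top
  have hmem : MemLp (G x) 2 μ := by
    refine ⟨hG.of_uncurry_left.aestronglyMeasurable, ?_⟩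
    rw [eLpNorm_lt_top_iff_lintegral_rpow_enorm_lt_top two_ne_zero ENNReal.ofNat_ne_top]
    simpa using hfin.lt_top
  have hinner (i : ι) : integralOp μ G (b i) x = inner ℝ (b i) hmem.toLp := by
    rw [L2.inner_def]
    refine integral_congr_ae ?_
    filter_upwards [hmem.coeFn_toLp] with y hy
    simp [hy]
  calc ∑ i ∈ s, ‖integralOp μ G (b i) x‖ₑ ^ 2
      = ENNReal.ofReal (∑ i ∈ s, ‖inner ℝ (b i) hmem.toLp‖ ^ 2) := by
        rw [ENNReal.ofReal_sum_of_nonneg fun i _ => by positivity]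
        refine Finset.sum_congr rfl fun i _ => ?_
        rw [hinner, ENNReal.ofReal_pow (norm_nonneg _), ofReal_norm]
    _ ≤ ENNReal.ofReal (‖hmem.toLp‖ ^ 2) :=
        ENNReal.ofReal_le_ofReal (hb.sum_inner_products_le _)
    _ = ∫⁻ y, ‖G x y‖ₑ ^ 2 ∂μ := by
        rw [ENNReal.ofReal_pow (norm_nonneg _), ofReal_norm, enorm_sq_eq_lintegral]
        refine lintegral_congr_ae ?_
        filter_upwards [hmem.coeFn_toLp] with y hy
        rw [hy]

lemma isCompactOperator_of_lintegral_kernel_sq (hG : Measurable (Function.uncurry G))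
    (hG2 : ∫⁻ x, ∫⁻ y, ‖G x y‖ₑ ^ 2 ∂μ ∂μ ≠ ⊤) {T : Lp ℝ 2 μ →L[ℝ] Lp ℝ 2 μ}
    (hT : ∀ f, T f =ᵐ[μ] integralOp μ G f) : IsCompactOperator T := by
  obtain ⟨w, b, -⟩ := exists_hilbertBasis ℝ (Lp ℝ 2 μ)
  have hsum (s : Finset w) :
      ∑ i ∈ s, ‖T (b i)‖ₑ ^ 2 ≤ ∫⁻ x, ∫⁻ y, ‖G x y‖ₑ ^ 2 ∂μ ∂μ := by
    calc ∑ i ∈ s, ‖T (b i)‖ₑ ^ 2 = ∫⁻ x, ∑ i ∈ s, ‖T (b i) x‖ₑ ^ 2 ∂μ := by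
          simp_rw [enorm_sq_eq_lintegral]
          exact (lintegral_finsetSum' _ fun i _ =>
            (Lp.aestronglyMeasurable (T (b i))).enorm.pow_const 2).symm
      _ ≤ _ := by
          refine lintegral_mono_ae ?_
          filter_upwards [(Finset.eventually_all s).2 fun i _ => hT (b i)] with x hx
          rw [Finset.sum_congr rfl fun i hi => by rw [hx i hi]]
          exact sum_enorm_integralOp_sq_le b.orthonormal hG s x
  refine isCompactOperator_of_summable_norm_sq b T
    (summable_of_sum_le (c := (∫⁻ x, ∫⁻ y, ‖G x y‖ₑ ^ 2 ∂μ ∂μ).toReal)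
      (fun i => by positivity) fun s => ?_)
  convert ENNReal.toReal_mono hG2 (hsum s)
  rw [ENNReal.toReal_sum fun i _ => by simp]
  simp

/-- The kernel `G` cut off at height `M`. -/
noncomputable def truncKernel (G : α → α → ℝ) (M : ℝ≥0) (x y : α) : ℝ :=
  if ‖G x y‖ₑ ≤ M then G x y else 0

lemma measurable_truncKernel (hG : Measurable (Function.uncurry G)) (M : ℝ≥0) :
    Measurable (Function.uncurry (truncKernel G M)) :=
  Measurable.ite (measurableSet_le hG.enorm measurable_const) hG measurable_const

omit [MeasurableSpace α] in
lemma enorm_truncKernel_le (G : α → α → ℝ) (M : ℝ≥0) (x y : α) : ‖truncKernel G M x y‖ₑ ≤ M := by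
  rw [truncKernel]
  split_ifs with h
  · exact h
  · simp

omit [MeasurableSpace α] in
lemma enorm_sub_truncKernel_le (G : α → α → ℝ) {q : ℝ} (hq : 1 < q) (M : ℝ≥0)
    (x y : α) : ‖G x y - truncKernel G M x y‖ₑ ≤ (M : ℝ≥0∞) ^ (1 - q) * ‖G x y‖ₑ ^ q := by
  rw [truncKernel]
  split_ifs with h
  · simp
  rw [not_le] at h
  have hG0 : ‖G x y‖ₑ ≠ 0 := (h.trans_le' zero_le).ne'
  rw [sub_zero]
  calc ‖G x y‖ₑ = ‖G x y‖ₑ ^ (1 - q) * ‖G x y‖ₑ ^ q := by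
        rw [← ENNReal.rpow_add _ _ hG0 enorm_ne_top, sub_add_cancel, ENNReal.rpow_one]
    _ ≤ (M : ℝ≥0∞) ^ (1 - q) * ‖G x y‖ₑ ^ q := by
        gcongr ?_ * _
        rw [← neg_sub, ENNReal.rpow_neg, ENNReal.rpow_neg, ENNReal.inv_le_inv]
        exact ENNReal.rpow_le_rpow h.le (by linarith)

variable [SFinite μ]

lemma opNorm_sub_le_of_lintegral_kernel_sub_le {A B C : ℝ≥0}
    (hG : Measurable (Function.uncurry G)) (hK : Measurable (Function.uncurry K))
    (hGsymm : ∀ᵐ x ∂μ, ∀ᵐ y ∂μ, G x y = G y x) (hKsymm : ∀ᵐ x ∂μ, ∀ᵐ y ∂μ, K x y = K y x)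
    (hA : ∀ᵐ x ∂μ, ∫⁻ y, ‖G x y‖ₑ ∂μ ≤ A) (hB : ∀ᵐ x ∂μ, ∫⁻ y, ‖K x y‖ₑ ∂μ ≤ B)
    (hC : ∀ᵐ x ∂μ, ∫⁻ y, ‖G x y - K x y‖ₑ ∂μ ≤ C) {S T : Lp ℝ 2 μ →L[ℝ] Lp ℝ 2 μ}
    (hS : ∀ f, S f =ᵐ[μ] integralOp μ G f) (hT : ∀ f, T f =ᵐ[μ] integralOp μ K f) :
    ‖S - T‖ ≤ C := by
  have hDsymm : ∀ᵐ x ∂μ, ∀ᵐ y ∂μ, G x y - K x y = G y x - K y x := by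
    filter_upwards [hGsymm, hKsymm] with x hGx hKx
    filter_upwards [hGx, hKx] with y hGxy hKxy
    rw [hGxy, hKxy]
  obtain ⟨D, hD, hDC⟩ := exists_continuousLinearMap_integralOp (p := 2)
    (G := fun x y => G x y - K x y) (hG.sub hK) hDsymm hC ENNReal.ofNat_ne_top
  suffices S - T = D by rwa [this]
  ext1 f
  apply Lp.ext
  filter_upwards [Lp.coeFn_sub (S f) (T f), hS f, hT f, hD f,
    ae_potential_enorm_ne_top hG hGsymm hA one_le_two ENNReal.ofNat_ne_top (Lp.memLp f),
    ae_potential_enorm_ne_top hK hKsymm hB one_le_two ENNReal.ofNat_ne_top (Lp.memLp f)]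
    with x hsub hSx hTx hDx hGx hKx
  have hf := Lp.aestronglyMeasurable f
  rw [sub_apply, hsub, Pi.sub_apply, hSx, hTx, hDx, integralOp, integralOp,
    integralOp, ← integral_sub (integrable_kernel_mul hG hf hGx) (integrable_kernel_mul hK hf hKx)]
  simp_rw [sub_mul]

omit [SFinite μ] in
lemma lintegral_le_lintegral_rpow_add_measure_univ (F : α → ℝ≥0∞) {q : ℝ} (hq : 1 ≤ q) :
    ∫⁻ x, F x ∂μ ≤ ∫⁻ x, F x ^ q ∂μ + μ univ := by
  rw [← lintegral_one, ← lintegral_add_right _ measurable_const]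
  refine lintegral_mono fun x => ?_
  rcases le_total (F x) 1 with h | h
  · exact h.trans le_add_self
  · exact (ENNReal.le_rpow_self_of_one_le h hq).trans le_self_add

variable [IsFiniteMeasure μ]

/-- The truncated kernels are square integrable, and the remainders are small in the Schur norm. -/
theorem isCompactOperator_of_lintegral_kernel_rpow_le (hG : Measurable (Function.uncurry G))
    (hsymm : ∀ᵐ x ∂μ, ∀ᵐ y ∂μ, G x y = G y x) {q : ℝ} (hq : 1 < q) {A : ℝ≥0}
    (hA : ∀ᵐ x ∂μ, ∫⁻ y, ‖G x y‖ₑ ^ q ∂μ ≤ A) {T : Lp ℝ 2 μ →L[ℝ] Lp ℝ 2 μ}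
    (hT : ∀ f, T f =ᵐ[μ] integralOp μ G f) : IsCompactOperator T := by
  let M (k : ℕ) : ℝ≥0 := k + 1
  have hM (k : ℕ) : 0 < M k := by positivity
  have htail (k : ℕ) : ∀ᵐ x ∂μ, ∫⁻ y, ‖G x y - truncKernel G (M k) x y‖ₑ ∂μ
      ≤ (M k ^ (1 - q) * A : ℝ≥0) := by
    filter_upwards [hA] with x hx
    rw [ENNReal.coe_mul, ENNReal.coe_rpow_of_ne_zero (hM k).ne']
    exact (lintegral_mono (enorm_sub_truncKernel_le G hq (M k) x)).trans
      ((lintegral_const_mul _ (hG.of_uncurry_left.enorm.pow_const q)).trans_le (by gcongr))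
  have htrunc (k : ℕ) : ∀ᵐ x ∂μ, ∫⁻ y, ‖truncKernel G (M k) x y‖ₑ ∂μ
      ≤ (M k * (μ univ).toNNReal : ℝ≥0) := by
    refine Eventually.of_forall fun x => ?_
    rw [ENNReal.coe_mul, ENNReal.coe_toNNReal (measure_ne_top μ univ), ← lintegral_const]
    exact lintegral_mono (enorm_truncKernel_le G (M k) x)
  have hrow : ∀ᵐ x ∂μ, ∫⁻ y, ‖G x y‖ₑ ∂μ ≤ (A + (μ univ).toNNReal : ℝ≥0) := by
    filter_upwards [hA] with x hx
    rw [ENNReal.coe_add, ENNReal.coe_toNNReal (measure_ne_top μ univ)]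
    exact (lintegral_le_lintegral_rpow_add_measure_univ (fun y => ‖G x y‖ₑ) hq.le).trans
      (add_le_add_left hx _)
  have htsymm (k : ℕ) : ∀ᵐ x ∂μ, ∀ᵐ y ∂μ, truncKernel G (M k) x y = truncKernel G (M k) y x :=
    hsymm.mono fun x hx => hx.mono fun y hxy => by simp only [truncKernel, hxy]
  choose S hS _ using fun k => exists_continuousLinearMap_integralOp (p := 2)
    (measurable_truncKernel hG (M k)) (htsymm k) (htrunc k) ENNReal.ofNat_ne_top
  have hScompact (k : ℕ) : IsCompactOperator (S k) := by
    refine isCompactOperator_of_lintegral_kernel_sq (measurable_truncKernel hG (M k)) ?_ (hS k)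
    refine ne_top_of_le_ne_top ?_ (lintegral_mono fun x => lintegral_mono fun y =>
      pow_le_pow_left₀ zero_le (enorm_truncKernel_le G (M k) x y) 2)
    simp [ENNReal.mul_eq_top, measure_ne_top]
  have hlim : Tendsto (fun k => M k ^ (1 - q) * A) atTop (nhds 0) := by
    have hpow := (tendsto_rpow_neg_atTop (sub_pos.2 hq)).comp
      (tendsto_atTop_add_const_right atTop 1 (tendsto_natCast_atTop_atTop (R := ℝ)))
    rw [← NNReal.tendsto_coe]
    simpa [M, Function.comp_def] using hpow.mul_const (A : ℝ)
  refine isCompactOperator_of_tendsto (F := S) (l := atTop) ?_ (Eventually.of_forall hScompact)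
  rw [tendsto_iff_norm_sub_tendsto_zero]
  refine squeeze_zero (fun _ => norm_nonneg _) (fun k => ?_) (NNReal.tendsto_coe.2 hlim)
  rw [norm_sub_rev]
  exact opNorm_sub_le_of_lintegral_kernel_sub_le hG (measurable_truncKernel hG (M k)) hsymm
    (htsymm k) hrow (htrunc k) (htail k) hT (hS k)

end CompactIntegralOperator

section MonotoneEnumeration

lemma nonempty_orderIso_nat {ι : Type*} [LinearOrder ι] [Infinite ι]
    (h : ∀ i : ι, (Iic i).Finite) : Nonempty (ℕ ≃o ι) := by
  let _ : LocallyFiniteOrder ι :=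
    LocallyFiniteOrder.ofFiniteIcc fun a b => (h b).subset fun _ hx => hx.2
  let _ : SuccOrder ι := LinearLocallyFiniteOrder.succOrder ι
  let _ : PredOrder ι := LinearLocallyFiniteOrder.predOrder ι
  have hbot : ∃ b : ι, ∀ i, b ≤ i := by
    obtain ⟨i₀⟩ := (inferInstance : Nonempty ι)
    obtain ⟨b, hb, hmin⟩ := exists_min_image (Iic i₀) id (h i₀) ⟨i₀, le_refl i₀⟩
    exact ⟨b, fun i => (le_total i i₀).elim (hmin i) (le_trans hb)⟩
  let _ : OrderBot ι := { bot := hbot.choose, bot_le := hbot.choose_spec }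
  have : NoMaxOrder ι := ⟨fun a => by
    by_contra! ha
    exact infinite_univ (α := ι) ((h a).subset fun i _ => ha i)⟩
  exact ⟨(orderIsoNatOfLinearSuccPredArch (ι := ι)).symm⟩

lemma exists_equiv_monotone_comp {ι : Type*} [Infinite ι] (v : ι → ℝ)
    (hfin : ∀ c : ℝ, {i | v i ≤ c}.Finite) : ∃ e : ℕ ≃ ι, Monotone (v ∘ e) := by
  have hcount : Countable ι := by
    rw [← countable_univ_iff, show (univ : Set ι) = ⋃ k : ℕ, {i | v i ≤ k} by
      ext i
      simpa using exists_nat_ge (v i)]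
    exact countable_iUnion fun k => (hfin k).countable
  obtain ⟨enc, henc⟩ := hcount.exists_injective_nat
  let _ : LinearOrder ι := LinearOrder.lift' (fun i => toLex (v i, enc i)) fun i j h =>
    henc (Prod.ext_iff.1 (toLex.injective h)).2
  have hv : Monotone v := fun i j h =>
    (Prod.Lex.le_iff.1 (show toLex (v i, enc i) ≤ toLex (v j, enc j) from h)).elim le_of_lt
      fun h => h.1.le
  obtain ⟨e⟩ := nonempty_orderIso_nat fun i => (hfin (v i)).subset fun j hj => hv hj
  exact ⟨e.toEquiv, hv.comp e.monotone⟩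

lemma tendsto_atTop_comp_of_finite_setOf_le {ι : Type*} {v : ι → ℝ}
    (hfin : ∀ c : ℝ, {i | v i ≤ c}.Finite) {e : ℕ → ι} (he : e.Injective) :
    Tendsto (v ∘ e) atTop atTop := by
  rw [← Nat.cofinite_eq_atTop, tendsto_atTop]
  intro c
  refine ((hfin c).preimage he.injOn).subset fun j hj => ?_
  exact (not_le.1 (show ¬ c ≤ (v ∘ e) j from hj)).le

end MonotoneEnumeration

section CompactSymmetric

universe u v

variable {𝕜 : Type u} {E : Type v} [RCLike 𝕜] [NormedAddCommGroup E]
  [InnerProductSpace 𝕜 E] {T : E →L[𝕜] E}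

lemma exists_hilbertBasis_eigenvectors [CompleteSpace E] (hc : IsCompactOperator T)
    (hT : (T : E →ₗ[𝕜] E).IsSymmetric) :
    ∃ (ι : Type (max u v)) (m : ι → 𝕜) (v : HilbertBasis ι 𝕜 E), ∀ i, T (v i) = m i • v i := by
  let V (a : 𝕜) : Submodule 𝕜 E := Module.End.eigenspace (T : Module.End 𝕜 E) a
  have hVclosed (a : 𝕜) : IsClosed (V a : Set E) := by
    rw [show (V a : Set E) = {x | T x = a • x} by ext; simp [V]]
    exact isClosed_eq T.continuous (continuous_const_smul a)
  have (a : 𝕜) : CompleteSpace (V a) := (hVclosed a).completeSpace_coe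
  choose w b _ using fun a => exists_hilbertBasis 𝕜 (V a)
  let v (i : Σ a, w a) : E := b i.1 i.2
  have hv : Orthonormal 𝕜 v :=
    hT.orthogonalFamily_eigenspaces.orthonormal_sigma_orthonormal fun a => (b a).orthonormal
  have hV (a : 𝕜) : V a ≤ (Submodule.span 𝕜 (range v)).topologicalClosure := by
    let f : V a →L[𝕜] E := (V a).subtypeL
    calc V a = (Submodule.span 𝕜 (range (b a))).topologicalClosure.map (f : V a →ₗ[𝕜] E) := by
          rw [(b a).dense_span]
          exact (Submodule.map_subtype_top (V a)).symm
      _ ≤ ((Submodule.span 𝕜 (range (b a))).map (f : V a →ₗ[𝕜] E)).topologicalClosure :=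
          Submodule.topologicalClosure_map f _
      _ ≤ _ := by
          refine Submodule.topologicalClosure_mono (Submodule.map_span_le _ _ _ |>.2 ?_)
          rintro _ ⟨i, rfl⟩
          exact Submodule.subset_span ⟨⟨a, i⟩, rfl⟩
  have hspan : (Submodule.span 𝕜 (range v))ᗮ = ⊥ := by
    rw [eq_bot_iff, ← ContinuousLinearMap.orthogonalComplement_iSup_eigenspaces_eq_bot hc hT,
      ← Submodule.orthogonal_closure]
    exact Submodule.orthogonal_le (iSup_le hV)
  refine ⟨_, Sigma.fst, HilbertBasis.mkOfOrthogonalEqBot hv hspan, fun i => ?_⟩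
  rw [HilbertBasis.coe_mkOfOrthogonalEqBot]
  exact Module.End.mem_eigenspace_iff.1 (b i.1 i.2).2

lemma finite_setOf_le_norm_of_isCompactOperator (hc : IsCompactOperator T) {ι : Type*}
    {v : ι → E} (hv : Orthonormal 𝕜 v) {m : ι → 𝕜} (hTv : ∀ i, T (v i) = m i • v i) {c : ℝ}
    (hc0 : 0 < c) : {i | c ≤ ‖m i‖}.Finite := by
  have hsep : ∀ i ∈ {i | c ≤ ‖m i‖}, ∀ j, i ≠ j → c ≤ dist (T (v i)) (T (v j)) := by
    intro i (hi : c ≤ ‖m i‖) j hij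
    have hsq : ‖T (v i) - T (v j)‖ ^ 2 = ‖m i‖ ^ 2 + ‖m j‖ ^ 2 := by
      rw [hTv, hTv, @norm_sub_sq 𝕜, norm_smul, norm_smul, hv.1, hv.1, inner_smul_left,
        inner_smul_right, hv.2 hij]
      simp
    rw [dist_eq_norm]
    refine hi.trans (le_of_sq_le_sq ?_ (norm_nonneg _))
    rw [hsq]
    exact le_add_of_nonneg_right (sq_nonneg _)
  obtain ⟨K, hK, hTK⟩ := hc.image_closedBall_subset_compact (𝕜₁ := 𝕜) (f := (T : E →ₗ[𝕜] E)) 1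
  obtain ⟨t, ht, hcover⟩ := Metric.totallyBounded_iff.1 hK.totallyBounded (c / 2) (half_pos hc0)
  have hball (i : ι) : ∃ y ∈ t, T (v i) ∈ Metric.ball y (c / 2) := by
    simpa using hcover (hTK ⟨v i, by simp [hv.1], rfl⟩)
  choose y hyt hy using hball
  by_contra hinf
  obtain ⟨i, hi, j, -, hij, hyij⟩ := Set.Infinite.exists_ne_map_eq_of_mapsTo hinf
    (fun i _ => hyt i) ht
  have hi' := hy i
  rw [hyij] at hi'
  linarith [hsep i hi j hij, dist_triangle_right (T (v i)) (T (v j)) (y j),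
    Metric.mem_ball.1 hi', Metric.mem_ball.1 (hy j)]

end CompactSymmetric

section PositiveCompact

variable {E : Type*} [NormedAddCommGroup E] [InnerProductSpace ℝ E]

theorem exists_hilbertBasis_nat_eigenvectors [CompleteSpace E] (hE : ¬ FiniteDimensional ℝ E)
    {T : E →L[ℝ] E} (hc : IsCompactOperator T) (hT : (T : E →ₗ[ℝ] E).IsPositive)
    (hinj : Function.Injective T) :
    ∃ (lam : ℕ → ℝ) (φ : HilbertBasis ℕ ℝ E), Monotone lam ∧ Tendsto lam atTop atTop ∧
      ∀ j, lam j ≠ 0 ∧ T (φ j) = (lam j)⁻¹ • φ j := by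
  obtain ⟨ι, m, v, hTv⟩ := exists_hilbertBasis_eigenvectors hc hT.isSymmetric
  have hm (i : ι) : 0 < m i := by
    have hnonneg : 0 ≤ inner ℝ (T (v i)) (v i) := hT.inner_nonneg_left (v i)
    have hne : v i ≠ 0 := v.orthonormal.ne_zero i
    rw [hTv, inner_smul_left, real_inner_self_eq_norm_sq, v.orthonormal.1 i] at hnonneg
    refine lt_of_le_of_ne (by simpa using hnonneg) fun h0 => hne (hinj ?_)
    rw [hTv, ← h0, zero_smul, map_zero]
  have hfin (c : ℝ) : {i | (m i)⁻¹ ≤ c}.Finite := by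
    rcases le_or_gt c 0 with hc0 | hc0
    · exact finite_empty.subset fun i hi => (hi.trans hc0).not_gt (inv_pos.2 (hm i))
    · refine (finite_setOf_le_norm_of_isCompactOperator hc v.orthonormal hTv
        (inv_pos.2 hc0)).subset fun i hi => ?_
      exact (inv_le_of_inv_le₀ (hm i) hi).trans (le_abs_self _)
  have : Infinite ι := by
    by_contra hι
    have := @Fintype.ofFinite ι (not_infinite_iff_finite.1 hι)
    exact hE v.toOrthonormalBasis.toBasis.finiteDimensional_of_finite
  obtain ⟨e, he⟩ := exists_equiv_monotone_comp (fun i => (m i)⁻¹) hfin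
  have hspan : ⊤ ≤ (Submodule.span ℝ (range (v ∘ e))).topologicalClosure := by
    rw [e.surjective.range_comp, v.dense_span]
  refine ⟨fun j => (m (e j))⁻¹,
    HilbertBasis.mk (v.orthonormal.comp e e.injective) hspan, he,
    tendsto_atTop_comp_of_finite_setOf_le hfin e.injective, fun j => ⟨(inv_pos.2 (hm _)).ne', ?_⟩⟩
  rw [HilbertBasis.coe_mk, inv_inv]
  exact hTv (e j)

end PositiveCompact

section InfiniteDimensional

lemma not_finiteDimensional_Lp_two_of_disjoint {α : Type*} [MeasurableSpace α] {μ : Measure α}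
    {A : ℕ → Set α} (hA : ∀ k, MeasurableSet (A k)) (hdisj : Pairwise (Function.onFun Disjoint A))
    (hpos : ∀ k, μ (A k) ≠ 0) (hfin : ∀ k, μ (A k) ≠ ⊤) : ¬ FiniteDimensional ℝ (Lp ℝ 2 μ) := by
  let u (k : ℕ) : Lp ℝ 2 μ := indicatorConstLp 2 (hA k) (hfin k) (1 : ℝ)
  have hinner (i j : ℕ) : inner ℝ (u i) (u j) = (μ (A i ∩ A j)).toReal :=
    L2.real_inner_indicatorConstLp_one_indicatorConstLp_one (hA i) (hA j) (hfin i) (hfin j)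
  have hu : LinearIndependent ℝ u := by
    refine linearIndependent_of_ne_zero_of_inner_eq_zero (𝕜 := ℝ) (fun k h0 => ?_)
      fun i j hij => ?_
    · have hself := hinner k k
      rw [h0, inner_zero_left, inter_self] at hself
      exact (ENNReal.toReal_pos (hpos k) (hfin k)).ne hself
    · change inner ℝ (u i) (u j) = 0
      rw [hinner, (hdisj hij).inter_eq, measure_empty, ENNReal.toReal_zero]
  exact fun _ => not_finite_iff_infinite.2 inferInstance hu.finite

lemma not_finiteDimensional_Lp_two_restrict {X : Type*} [TopologicalSpace X] [T2Space X]
    [MeasurableSpace X] [OpensMeasurableSpace X] {μ : Measure X} [μ.IsOpenPosMeasure] {Ω : Set X}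
    [IsFiniteMeasure (μ.restrict Ω)] (hΩo : IsOpen Ω) (hΩ : Ω.Infinite) :
    ¬ FiniteDimensional ℝ (Lp ℝ 2 (μ.restrict Ω)) := by
  have : Infinite Ω := hΩ.to_subtype
  obtain ⟨U, hUinf, hUo, hU⟩ := exists_seq_infinite_isOpen_pairwise_disjoint Ω
  have hUo' (k : ℕ) : IsOpen (Subtype.val '' U k) := hΩo.isOpenMap_subtype_val _ (hUo k)
  refine not_finiteDimensional_Lp_two_of_disjoint (A := fun k => Subtype.val '' U k)
    (fun k => (hUo' k).measurableSet)
    (fun i j hij => (disjoint_image_iff Subtype.val_injective).2 (hU hij)) (fun k => ?_)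
    fun k => measure_ne_top _ _
  rw [Measure.restrict_apply (hUo' k).measurableSet,
    inter_eq_left.2 (Subtype.coe_image_subset Ω (U k))]
  exact ((hUo' k).measure_pos μ ((hUinf k).nonempty.image _)).ne'

end InfiniteDimensional

section EigenbasisResolvent

variable {ι E : Type*} [NormedAddCommGroup E] [InnerProductSpace ℝ E]

lemma eq_of_forall_inner_hilbertBasis_eq (φ : HilbertBasis ι ℝ E) {x y : E}
    (h : ∀ j, inner ℝ (φ j) x = inner ℝ (φ j) y) : x = y := by
  refine φ.repr.injective (lp.ext (funext fun j => ?_))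
  rw [φ.repr_apply_apply, φ.repr_apply_apply, h]

lemma hasSum_sq_inner_hilbertBasis (φ : HilbertBasis ι ℝ E) (x : E) :
    HasSum (fun j => (inner ℝ (φ j) x) ^ 2) (‖x‖ ^ 2) := by
  have h := φ.hasSum_inner_mul_inner x x
  rw [real_inner_self_eq_norm_sq] at h
  refine h.congr_fun fun j => ?_
  rw [real_inner_comm (φ j) x, sq]

lemma norm_le_of_forall_abs_inner_hilbertBasis_le (φ : HilbertBasis ι ℝ E) {x y : E} {B : ℝ}
    (hB : 0 ≤ B) (h : ∀ j, |inner ℝ (φ j) x| ≤ B * |inner ℝ (φ j) y|) : ‖x‖ ≤ B * ‖y‖ := by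
  refine le_of_sq_le_sq ?_ (by positivity)
  rw [mul_pow]
  refine hasSum_le (fun j => ?_) (hasSum_sq_inner_hilbertBasis φ x)
    ((hasSum_sq_inner_hilbertBasis φ y).mul_left (B ^ 2))
  rw [← sq_abs, ← sq_abs (inner ℝ (φ j) y), ← mul_pow]
  exact pow_le_pow_left₀ (abs_nonneg _) (h j) 2

lemma exists_forall_abs_inv_sub_le {lam : ℕ → ℝ} (hlim : Tendsto lam atTop atTop) (l : ℝ) :
    ∃ B : ℝ, ∀ j, |(lam j - l)⁻¹| ≤ B := by
  have h0 : Tendsto (fun j => |(lam j - l)⁻¹|) atTop (nhds |0|) :=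
    (tendsto_inv_atTop_zero.comp (tendsto_atTop_add_const_right _ (-l) hlim)).abs
  obtain ⟨B, hB⟩ := h0.bddAbove_range
  exact ⟨B, fun j => hB (mem_range_self j)⟩

lemma memℓp_inner_hilbertBasis_div_sub (φ : HilbertBasis ℕ ℝ E) {lam : ℕ → ℝ}
    (hlim : Tendsto lam atTop atTop) (l : ℝ) (g : E) :
    Memℓp (fun j => inner ℝ (φ j) g / (lam j - l)) 2 := by
  obtain ⟨B, hB⟩ := exists_forall_abs_inv_sub_le hlim l
  refine memℓp_gen (Summable.of_nonneg_of_le (fun j => by positivity) (fun j => ?_)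
    ((hasSum_sq_inner_hilbertBasis φ g).summable.mul_left (B ^ 2)))
  simp only [ENNReal.toReal_ofNat, Real.rpow_ofNat, Real.norm_eq_abs, sq_abs]
  rw [div_eq_mul_inv, mul_pow, mul_comm, ← sq_abs (lam j - l)⁻¹]
  gcongr
  exact hB j

lemma inner_tsum_inner_div_sub_smul (φ : HilbertBasis ℕ ℝ E) {lam : ℕ → ℝ}
    (hlim : Tendsto lam atTop atTop) (l : ℝ) (g : E) (i : ℕ) :
    inner ℝ (φ i) (∑' j, (inner ℝ (φ j) g / (lam j - l)) • φ j)
      = inner ℝ (φ i) g / (lam i - l) := by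
  have h : ∑' j, (inner ℝ (φ j) g / (lam j - l)) • φ j = _ :=
    (φ.hasSum_repr_symm ⟨_, memℓp_inner_hilbertBasis_div_sub φ hlim l g⟩).tsum_eq
  rw [h, ← φ.repr_apply_apply, LinearIsometryEquiv.apply_symm_apply]

lemma inner_sub_sum_inner_smul (φ : HilbertBasis ℕ ℝ E) (N : ℕ) (g : E) (i : ℕ) :
    inner ℝ (φ i) (g - ∑ j ∈ Finset.range N, inner ℝ (φ j) g • φ j)
      = if i < N then 0 else inner ℝ (φ i) g := by
  rw [inner_sub_right, inner_sum]
  simp only [inner_smul_right, orthonormal_iff_ite.1 φ.orthonormal i, mul_ite, mul_one, mul_zero,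
    Finset.sum_ite_eq, Finset.mem_range]
  split_ifs <;> simp

end EigenbasisResolvent

namespace GreenKernelBounds

section

variable {X : Type*} [MetricSpace X] [MeasurableSpace X] [OpensMeasurableSpace X]
  {d β γ : ℝ} {μ : Measure X} [IsFiniteMeasure μ] {δ : X → ℝ≥0} {κ : X → X → ℝ≥0∞}
  (hκ : GreenKernelBounds d β γ μ δ κ)

include hκ

lemma exists_lintegral_rpow_le {q : ℝ} (hq : 0 ≤ q) (hqβ : β * q < d) :
    ∃ A : ℝ≥0, ∀ᵐ x ∂μ, ∫⁻ y, κ x y ^ q ∂μ ≤ A := by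
  obtain ⟨c, hc⟩ := hκ.gain
  obtain ⟨C, hC⟩ := hκ.upperRegular.exists_lintegral_rieszKernel_le
    (mul_nonneg hκ.β_nonneg hq) hqβ
  refine ⟨c ^ q * C, ?_⟩
  filter_upwards [hc 0 0 le_rfl le_rfl (by simpa using hκ.γ_nonneg)] with x hx
  calc ∫⁻ y, κ x y ^ q ∂μ ≤ ∫⁻ y, (c ^ q : ℝ≥0) * rieszKernel (β * q) x y ∂μ := by
        refine lintegral_mono_ae ?_
        filter_upwards [hx] with y hxy
        simp only [add_zero, ENNReal.rpow_zero, mul_one] at hxy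
        rw [← rieszKernel_rpow β hq, ENNReal.coe_rpow_of_nonneg _ hq,
          ← ENNReal.mul_rpow_of_nonneg _ _ hq]
        gcongr
    _ ≤ (c ^ q * C : ℝ≥0) := by
        rw [lintegral_const_mul' _ _ ENNReal.coe_ne_top, ENNReal.coe_mul]
        gcongr
        exact hC x

lemma exists_lintegral_le : ∃ A : ℝ≥0, ∀ᵐ x ∂μ, ∫⁻ y, κ x y ∂μ ≤ A := by
  simpa using hκ.exists_lintegral_rpow_le zero_le_one (by simpa using hκ.β_lt)

lemma exists_one_lt_lintegral_rpow_le :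
    ∃ q : ℝ, 1 < q ∧ ∃ A : ℝ≥0, ∀ᵐ x ∂μ, ∫⁻ y, κ x y ^ q ∂μ ≤ A := by
  have hlt : ∀ᶠ q in nhdsWithin 1 (Ioi 1), β * q < d :=
    ((continuous_const_mul β).tendsto' 1 β (mul_one β)).eventually_lt_const hκ.β_lt
      |>.filter_mono nhdsWithin_le_nhds
  obtain ⟨q, hqd, hq⟩ := (hlt.and self_mem_nhdsWithin).exists
  exact ⟨q, hq, hκ.exists_lintegral_rpow_le (zero_le_one.trans (le_of_lt hq)) hqd⟩

end

end GreenKernelBounds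

section GreenOperator

variable {α : Type*} [MeasurableSpace α] {μ : Measure α} {G : α → α → ℝ}

lemma inner_eq_integral_mul (u v : Lp ℝ 2 μ) : inner ℝ u v = ∫ x, u x * v x ∂μ := by
  simp [L2.inner_def, mul_comm]

lemma inner_eq_of_ae_eq_integralOp [SFinite μ] (hG : Measurable (Function.uncurry G))
    (hsymm : ∀ᵐ x ∂μ, ∀ᵐ y ∂μ, G x y = G y x) {A : ℝ≥0}
    (hA : ∀ᵐ x ∂μ, ∫⁻ y, ‖G x y‖ₑ ∂μ ≤ A) {T : Lp ℝ 2 μ →L[ℝ] Lp ℝ 2 μ}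
    (hT : ∀ f, T f =ᵐ[μ] integralOp μ G f) (f g : Lp ℝ 2 μ) :
    inner ℝ (T f) g = inner ℝ f (T g) := by
  have hfm := Lp.aestronglyMeasurable f
  have hgm := Lp.aestronglyMeasurable g
  have hfin : ∫⁻ x, potential μ (fun x y => ‖G x y‖ₑ) (fun y => ‖f y‖ₑ) x * ‖g x‖ₑ ∂μ ≠ ⊤ := by
    have hle := eLpNorm_potential_enorm_le hG hsymm hA one_le_two ENNReal.ofNat_ne_top hfm
    have hmul := ENNReal.lintegral_mul_le_Lp_mul_Lq μ Real.HolderConjugate.two_two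
      (measurable_potential (κ := fun x y => ‖G x y‖ₑ) hG.enorm hfm.enorm).aemeasurable hgm.enorm
    simp only [one_div, ← eLpNorm_ofReal_eq_lintegral_rpow _ two_pos, ENNReal.ofReal_ofNat,
      Pi.mul_apply, eLpNorm_enorm] at hmul
    exact (hmul.trans_lt (ENNReal.mul_lt_top (hle.trans_lt (ENNReal.mul_lt_top
      ENNReal.coe_lt_top (Lp.eLpNorm_lt_top f))) (Lp.eLpNorm_lt_top g))).ne
  calc inner ℝ (T f) g = ∫ x, integralOp μ G f x * g x ∂μ := by
        rw [inner_eq_integral_mul]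
        exact integral_congr_ae ((hT f).mono fun x hx => by simp only [hx])
    _ = ∫ x, f x * integralOp μ G g x ∂μ := integral_integralOp_mul hG hsymm hfm hgm hfin
    _ = inner ℝ f (T g) := by
        rw [inner_eq_integral_mul]
        exact integral_congr_ae ((hT g).mono fun x hx => by simp only [hx])

end GreenOperator

section WeightedSpaces

variable {n : ℕ} {γ : ℝ} {Ω : Set (Pt n)} {f g : Pt n → ℝ}

lemma memL1w_add (hf : MemL1w γ Ω f) (hg : MemL1w γ Ω g) : MemL1w γ Ω (fun x => f x + g x) := by
  simp_rw [MemL1w, add_mul]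
  exact Integrable.add hf hg

lemma memL1w_sub (hf : MemL1w γ Ω f) (hg : MemL1w γ Ω g) : MemL1w γ Ω (fun x => f x - g x) := by
  simp_rw [MemL1w, sub_mul]
  exact Integrable.sub hf hg

lemma memL1w_const_mul (hf : MemL1w γ Ω f) (c : ℝ) : MemL1w γ Ω (fun x => c * f x) := by
  simp_rw [MemL1w, mul_assoc]
  exact Integrable.const_mul hf c

lemma memL1w_finsetSum {ι : Type*} (s : Finset ι) {f : ι → Pt n → ℝ}
    (hf : ∀ i ∈ s, MemL1w γ Ω (f i)) : MemL1w γ Ω (fun x => ∑ i ∈ s, f i x) := by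
  simp_rw [MemL1w, Finset.sum_mul]
  exact integrable_finsetSum _ hf

lemma eLpNorm_one_mul_bdist_rpow (hγ : 0 ≤ γ) (f : Pt n → ℝ) :
    eLpNorm (fun x => f x * bdist Ω x ^ γ) 1 (mu Ω)
      = ∫⁻ x in Ω, ‖f x‖ₑ * (bdistNN Ω x : ℝ≥0∞) ^ γ := by
  simp_rw [eLpNorm_one_eq_lintegral_enorm, enorm_mul_bdist_rpow hγ]

lemma memWLinf_iff (hγ : 0 ≤ γ) {ψ : L2 Ω} :
    MemWLinf γ ψ ↔ ∃ M : ℝ≥0, ∀ᵐ x ∂(mu Ω), ‖ψ x‖ₑ ≤ M * (bdistNN Ω x : ℝ≥0∞) ^ γ := by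
  have hw (x : Pt n) : 0 ≤ bdist Ω x ^ γ := Real.rpow_nonneg (bdist_nonneg Ω x) γ
  simp_rw [Real.enorm_eq_ofReal_abs, ← ofReal_bdist_rpow hγ]
  constructor
  · rintro ⟨M, hM⟩
    refine ⟨M.toNNReal, hM.mono fun x hx => ?_⟩
    change _ ≤ ENNReal.ofReal M * _
    rw [← ENNReal.ofReal_mul' (hw x)]
    exact ENNReal.ofReal_le_ofReal hx
  · rintro ⟨M, hM⟩
    refine ⟨M, hM.mono fun x hx => ?_⟩
    rw [← ENNReal.ofReal_coe_nnreal, ← ENNReal.ofReal_mul' (hw x)] at hx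
    exact (ENNReal.ofReal_le_ofReal_iff (mul_nonneg M.coe_nonneg (hw x))).1 hx

lemma memWLinf_of_enorm_le (hγ : 0 ≤ γ) {ψ : L2 Ω}
    (hψ : ∀ᵐ x ∂(mu Ω), ‖ψ x‖ₑ ≤ (bdistNN Ω x : ℝ≥0∞) ^ γ) : MemWLinf γ ψ :=
  (memWLinf_iff hγ).2 ⟨1, by simpa using hψ⟩

lemma lintegral_mul_le_of_enorm_le (F : Pt n → ℝ≥0∞) {M : ℝ≥0}
    (hM : ∀ᵐ x ∂(mu Ω), ‖g x‖ₑ ≤ M * (bdistNN Ω x : ℝ≥0∞) ^ γ) :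
    ∫⁻ x in Ω, F x * ‖g x‖ₑ ≤ M * ∫⁻ x in Ω, F x * (bdistNN Ω x : ℝ≥0∞) ^ γ := by
  rw [← lintegral_const_mul' _ _ ENNReal.coe_ne_top]
  refine lintegral_mono_ae (hM.mono fun x hx => ?_)
  rw [mul_left_comm]
  gcongr

/-- A bounded open set of positive dimension and an exponent for which the weight `δ^γ` is
bounded, which is what the duality between `L¹(Ω; δ^γ)` and `δ^γ L^∞(Ω)` needs. -/
structure IsWeightedDomain (γ : ℝ) (Ω : Set (Pt n)) : Prop where
  one_le : 1 ≤ n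
  isOpen : IsOpen Ω
  isBounded : Bornology.IsBounded Ω
  γ_nonneg : 0 ≤ γ

namespace IsWeightedDomain

variable (hΩ : IsWeightedDomain γ Ω)

include hΩ

lemma isFiniteMeasure : IsFiniteMeasure (mu Ω) := ⟨by simpa using hΩ.isBounded.measure_lt_top⟩

lemma ae_bdist_rpow_pos : ∀ᵐ x ∂(mu Ω), 0 < bdist Ω x ^ γ := by
  filter_upwards [ae_restrict_mem hΩ.isOpen.measurableSet] with x hx
  exact Real.rpow_pos_of_pos (bdist_pos hΩ.one_le hΩ.isOpen hΩ.isBounded hx) γ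

lemma exists_weight_le : ∃ D : ℝ≥0, ∀ᵐ x ∂(mu Ω), (bdistNN Ω x : ℝ≥0∞) ^ γ ≤ D := by
  refine ⟨(Metric.diam (closure Ω) ^ γ).toNNReal, ?_⟩
  filter_upwards [ae_restrict_mem hΩ.isOpen.measurableSet] with x hx
  rw [← ofReal_bdist_rpow hΩ.γ_nonneg]
  exact ENNReal.ofReal_le_ofReal (Real.rpow_le_rpow (bdist_nonneg Ω x)
    (bdist_le_diam hΩ.one_le hΩ.isBounded hx) hΩ.γ_nonneg)

lemma memL1w_iff : MemL1w γ Ω f ↔ AEStronglyMeasurable f (mu Ω) ∧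
    ∫⁻ x in Ω, ‖f x‖ₑ * (bdistNN Ω x : ℝ≥0∞) ^ γ ≠ ⊤ := by
  have hw : Measurable fun x => bdist Ω x ^ γ := (measurable_bdist Ω).pow_const γ
  have hfin : HasFiniteIntegral (fun x => f x * bdist Ω x ^ γ) (mu Ω) ↔
      ∫⁻ x in Ω, ‖f x‖ₑ * (bdistNN Ω x : ℝ≥0∞) ^ γ ≠ ⊤ := by
    simp_rw [HasFiniteIntegral, enorm_mul_bdist_rpow hΩ.γ_nonneg, lt_top_iff_ne_top]
  refine ⟨fun h => ⟨?_, hfin.1 h.2⟩, fun h => ⟨h.1.mul hw.aestronglyMeasurable, hfin.2 h.2⟩⟩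
  refine (h.1.mul hw.inv.aestronglyMeasurable).congr ?_
  filter_upwards [hΩ.ae_bdist_rpow_pos] with x hx
  exact mul_inv_cancel_right₀ hx.ne' (f x)

lemma integrable_mul (hf : MemL1w γ Ω f) {ψ : L2 Ω} (hψ : MemWLinf γ ψ) :
    Integrable (fun x => f x * ψ x) (mu Ω) := by
  obtain ⟨M, hM⟩ := (memWLinf_iff hΩ.γ_nonneg).1 hψ
  obtain ⟨hfm, hfin⟩ := hΩ.memL1w_iff.1 hf
  refine ⟨hfm.mul (Lp.aestronglyMeasurable ψ), ?_⟩
  simp_rw [HasFiniteIntegral, enorm_mul]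
  exact (lintegral_mul_le_of_enorm_le (fun x => ‖f x‖ₑ) hM).trans_lt
    (ENNReal.mul_lt_top ENNReal.coe_lt_top hfin.lt_top)

lemma integral_mul_add_smul (hf : MemL1w γ Ω f) {a b : L2 Ω} (ha : MemWLinf γ a)
    (hb : MemWLinf γ b) (c : ℝ) :
    ∫ x in Ω, f x * (a + c • b : L2 Ω) x = (∫ x in Ω, f x * a x) + c * ∫ x in Ω, f x * b x := by
  rw [← integral_const_mul, ← integral_add (hΩ.integrable_mul hf ha)
    ((hΩ.integrable_mul hf hb).const_mul c)]
  refine integral_congr_ae ?_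
  filter_upwards [Lp.coeFn_add a (c • b), Lp.coeFn_smul c b] with x hadd hsmul
  rw [hadd, Pi.add_apply, hsmul, Pi.smul_apply, smul_eq_mul]
  ring

lemma integral_add_const_mul_mul (hf : MemL1w γ Ω f) (hg : MemL1w γ Ω g) {ψ : L2 Ω}
    (hψ : MemWLinf γ ψ) (c : ℝ) :
    ∫ x in Ω, (f x + c * g x) * ψ x = (∫ x in Ω, f x * ψ x) + c * ∫ x in Ω, g x * ψ x := by
  rw [← integral_const_mul, ← integral_add (hΩ.integrable_mul hf hψ)
    ((hΩ.integrable_mul hg hψ).const_mul c)]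
  simp only [add_mul, mul_assoc]

lemma exists_lintegral_mul_weight_le {p : ℝ≥0∞} (hp : 1 ≤ p) :
    ∃ C : ℝ≥0, ∀ f : Pt n → ℝ, AEStronglyMeasurable f (mu Ω) →
      ∫⁻ x in Ω, ‖f x‖ₑ * (bdistNN Ω x : ℝ≥0∞) ^ γ ≤ C * eLpNorm f p (mu Ω) := by
  have := hΩ.isFiniteMeasure
  obtain ⟨D, hD⟩ := hΩ.exists_weight_le
  obtain ⟨C, hC⟩ := exists_lintegral_mul_le_eLpNorm hD hp
  exact ⟨C, fun f hf => (hC _ hf.enorm).trans_eq (by rw [eLpNorm_enorm])⟩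

lemma memL1w_of_memLp {p : ℝ≥0∞} (hp : 1 ≤ p) (hf : MemLp f p (mu Ω)) : MemL1w γ Ω f := by
  obtain ⟨C, hC⟩ := hΩ.exists_lintegral_mul_weight_le hp
  exact hΩ.memL1w_iff.2 ⟨hf.1, ((hC f hf.1).trans_lt
    (ENNReal.mul_lt_top ENNReal.coe_lt_top hf.2)).ne⟩

lemma memL1w_coeFn (g : L2 Ω) : MemL1w γ Ω g := hΩ.memL1w_of_memLp one_le_two (Lp.memLp g)

lemma exists_enorm_le :
    ∃ C : ℝ≥0, ∀ (g : L2 Ω) (M : ℝ≥0),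
      (∀ᵐ x ∂(mu Ω), ‖g x‖ₑ ≤ M * (bdistNN Ω x : ℝ≥0∞) ^ γ) → ‖g‖ₑ ≤ C * M := by
  have := hΩ.isFiniteMeasure
  obtain ⟨D, hD⟩ := hΩ.exists_weight_le
  have hm : (mu Ω) univ ^ (2 : ℝ≥0∞).toReal⁻¹ ≠ ⊤ :=
    ENNReal.rpow_ne_top_of_nonneg (by positivity) (measure_ne_top _ _)
  refine ⟨D * ((mu Ω) univ ^ (2 : ℝ≥0∞).toReal⁻¹).toNNReal, fun g M hM => ?_⟩
  rw [Lp.enorm_def, ENNReal.coe_mul, ENNReal.coe_toNNReal hm]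
  refine (eLpNorm_le_of_ae_enorm_bound (C := M * D) ?_).trans_eq (by ring)
  filter_upwards [hM, hD] with x hMx hDx
  exact hMx.trans (by gcongr)

lemma memLp_of_enorm_le (hf : AEStronglyMeasurable f (mu Ω)) {M : ℝ≥0}
    (hM : ∀ᵐ x ∂(mu Ω), ‖f x‖ₑ ≤ M * (bdistNN Ω x : ℝ≥0∞) ^ γ) (p : ℝ≥0∞) :
    MemLp f p (mu Ω) := by
  have := hΩ.isFiniteMeasure
  obtain ⟨D, hD⟩ := hΩ.exists_weight_le
  refine MemLp.of_bound hf (M * D : ℝ≥0) ?_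
  filter_upwards [hM, hD] with x hMx hDx
  rw [← coe_nnnorm, NNReal.coe_le_coe, ← ENNReal.coe_le_coe, ENNReal.coe_mul]
  exact hMx.trans (by gcongr)

/-- The sign of `d` times `δ^γ` turns pairings into norms of `L¹(Ω; δ^γ)`. -/
lemma exists_mul_eq_norm_mul {d : Pt n → ℝ} (hd : AEStronglyMeasurable d (mu Ω)) :
    ∃ ψ : L2 Ω, (∀ᵐ x ∂(mu Ω), ‖ψ x‖ₑ ≤ (bdistNN Ω x : ℝ≥0∞) ^ γ) ∧
      ∀ᵐ x ∂(mu Ω), d x * ψ x = ‖d x * bdist Ω x ^ γ‖ := by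
  have hw (x : Pt n) : 0 ≤ bdist Ω x ^ γ := Real.rpow_nonneg (bdist_nonneg Ω x) γ
  set q : Pt n → ℝ := fun x => if hd.mk d x < 0 then -(bdist Ω x ^ γ) else bdist Ω x ^ γ with hq
  have hwm : Measurable fun x => bdist Ω x ^ γ := (measurable_bdist Ω).pow_const γ
  have hqm : Measurable q :=
    Measurable.ite (measurableSet_lt hd.stronglyMeasurable_mk.measurable measurable_const)
      hwm.neg hwm
  have hqe (x : Pt n) : ‖q x‖ₑ = (bdistNN Ω x : ℝ≥0∞) ^ γ := by
    rw [← ofReal_bdist_rpow hΩ.γ_nonneg, ← Real.enorm_of_nonneg (hw x), hq]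
    dsimp only
    split_ifs <;> simp only [enorm_neg]
  have hq2 : MemLp q 2 (mu Ω) := hΩ.memLp_of_enorm_le (M := 1) hqm.aestronglyMeasurable
    (Eventually.of_forall fun x => by simp [hqe]) 2
  refine ⟨hq2.toLp, hq2.coeFn_toLp.mono fun x hx => by rw [hx, hqe], ?_⟩
  filter_upwards [hq2.coeFn_toLp, hd.ae_eq_mk] with x hx hdx
  rw [hx, norm_mul, Real.norm_of_nonneg (hw x), Real.norm_eq_abs, hq]
  dsimp only
  rw [← hdx]
  split_ifs with h
  · rw [abs_of_neg h, neg_mul_comm]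
  · rw [abs_of_nonneg (not_lt.1 h)]

lemma ae_eq_of_forall_integral_eq {u v : Pt n → ℝ} (hu : MemL1w γ Ω u) (hv : MemL1w γ Ω v)
    (h : ∀ ψ : L2 Ω, MemWLinf γ ψ → ∫ x in Ω, u x * ψ x = ∫ x in Ω, v x * ψ x) :
    u =ᵐ[mu Ω] v := by
  have hd := memL1w_sub hu hv
  obtain ⟨ψ, hψle, hψd⟩ := hΩ.exists_mul_eq_norm_mul (hΩ.memL1w_iff.1 hd).1
  have hψ := memWLinf_of_enorm_le hΩ.γ_nonneg hψle
  have hnorm : ∫ x in Ω, ‖(u x - v x) * bdist Ω x ^ γ‖ = 0 := by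
    rw [← integral_congr_ae hψd]
    simp_rw [sub_mul]
    rw [integral_sub (hΩ.integrable_mul hu hψ) (hΩ.integrable_mul hv hψ), h ψ hψ, sub_self]
  rw [integral_eq_zero_iff_of_nonneg (fun x => norm_nonneg _) (Integrable.norm hd)] at hnorm
  filter_upwards [hnorm, hΩ.ae_bdist_rpow_pos] with x hx hpos
  simpa [hpos.ne', sub_eq_zero] using hx

end IsWeightedDomain

end WeightedSpaces

section AdmissibleKernel

variable {n : ℕ} {β γ : ℝ} {Ω : Set (Pt n)} {G : Pt n → Pt n → ℝ}

/-- A signed kernel on a bounded open set whose absolute value is a Green kernel for the weight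
`δ^γ`; only the values off the diagonal matter. -/
structure AdmissibleKernel (β γ : ℝ) (Ω : Set (Pt n)) (G : Pt n → Pt n → ℝ) : Prop
    extends IsWeightedDomain γ Ω where
  measurable : Measurable (Function.uncurry G)
  symm : ∀ᵐ x ∂(mu Ω), ∀ᵐ y ∂(mu Ω), G x y = G y x
  bounds : GreenKernelBounds n β γ (mu Ω) (bdistNN Ω) (fun x y => ‖G x y‖ₑ)

lemma GreenBounds.admissibleKernel {s : ℝ} (hn : 1 ≤ n) (hs : 0 < s) (hγ : 0 ≤ γ) (hΩo : IsOpen Ω)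
    (hΩb : Bornology.IsBounded Ω) (hG : GreenBounds s γ Ω G) :
    AdmissibleKernel (max ((n : ℝ) - 2 * s) 0) γ Ω G :=
  ⟨⟨hn, hΩo, hΩb, hγ⟩, hG.measurable, hG.ae_symm hn hΩo.measurableSet,
    hG.greenKernelBounds hn hs hγ hΩo.measurableSet hΩb⟩

lemma enorm_le_potential_of_ae_eq_integralOp {T : L2 Ω →L[ℝ] L2 Ω}
    (hT : ∀ f : L2 Ω, T f =ᵐ[mu Ω] integralOp (mu Ω) G f) (g : L2 Ω) :
    ∀ᵐ x ∂(mu Ω), ‖T g x‖ₑ ≤ potential (mu Ω) (fun x y => ‖G x y‖ₑ) (fun y => ‖g y‖ₑ) x := by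
  filter_upwards [hT g] with x hx
  rw [hx]
  exact enorm_integralOp_le (mu Ω) G g x

lemma IsEigenSystem.eigenvalue_ne_zero_and_apply {L : L2 Ω →ₗ.[ℝ] L2 Ω}
    (hLG : IsGreenFunction L G) {T : L2 Ω →L[ℝ] L2 Ω}
    (hT : ∀ f : L2 Ω, T f =ᵐ[mu Ω] integralOp (mu Ω) G f)
    {lam : ℕ → ℝ} {φ : HilbertBasis ℕ ℝ (L2 Ω)} (hφ : IsEigenSystem L lam φ) (j : ℕ) :
    lam j ≠ 0 ∧ T (φ j) = (lam j)⁻¹ • φ j := by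
  have hfix : φ j = lam j • T (φ j) := by
    rw [← map_smul]
    exact Lp.ext (((hLG (φ j) (lam j • φ j)).1 (hφ.eigen j)).trans (hT _).symm)
  have h0 : lam j ≠ 0 := fun h0 => φ.orthonormal.ne_zero j (by rw [hfix, h0, zero_smul])
  exact ⟨h0, (inv_smul_eq_iff₀ h0).2 hfix |>.symm⟩

namespace AdmissibleKernel

variable (hG : AdmissibleKernel β γ Ω G)

include hG

lemma exists_greenOp :
    ∃ T : L2 Ω →L[ℝ] L2 Ω, (∀ f : L2 Ω, T f =ᵐ[mu Ω] integralOp (mu Ω) G f) ∧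
      IsCompactOperator T := by
  have := hG.isFiniteMeasure
  obtain ⟨A, hA⟩ := hG.bounds.exists_lintegral_le
  obtain ⟨q, hq, B, hB⟩ := hG.bounds.exists_one_lt_lintegral_rpow_le
  obtain ⟨T, hT, -⟩ := exists_continuousLinearMap_integralOp hG.measurable hG.symm hA
    (p := 2) ENNReal.ofNat_ne_top
  exact ⟨T, hT, isCompactOperator_of_lintegral_kernel_rpow_le hG.measurable hG.symm hq hB hT⟩

lemma inner_greenOp {T : L2 Ω →L[ℝ] L2 Ω} (hT : ∀ f : L2 Ω, T f =ᵐ[mu Ω] integralOp (mu Ω) G f)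
    (f g : L2 Ω) : inner ℝ (T f) g = inner ℝ f (T g) := by
  have := hG.isFiniteMeasure
  obtain ⟨A, hA⟩ := hG.bounds.exists_lintegral_le
  exact inner_eq_of_ae_eq_integralOp hG.measurable hG.symm hA hT f g

theorem exists_isEigenSystem (hΩne : Ω.Nonempty) {L : L2 Ω →ₗ.[ℝ] L2 Ω} (hL : IsNonneg L)
    (hLG : IsGreenFunction L G) :
    ∃ (lam : ℕ → ℝ) (φ : HilbertBasis ℕ ℝ (L2 Ω)), IsEigenSystem L lam φ := by
  have := hG.isFiniteMeasure
  have : Nonempty (Fin n) := ⟨⟨0, hG.one_le⟩⟩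
  obtain ⟨T, hT, hTc⟩ := hG.exists_greenOp
  have hLT (f : L2 Ω) : ∃ h : T f ∈ L.domain, L ⟨T f, h⟩ = f := (hLG (T f) f).2 (hT f)
  have hpos : (T : L2 Ω →ₗ[ℝ] L2 Ω).IsPositive := by
    refine ⟨hG.inner_greenOp hT, fun f => ?_⟩
    obtain ⟨h, hf⟩ := hLT f
    have hLf := hL ⟨T f, h⟩
    rw [hf] at hLf
    simpa [real_inner_comm] using hLf
  have hinj : Function.Injective T := (injective_iff_map_eq_zero T).2 fun f hf => by
    obtain ⟨h, hLf⟩ := hLT f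
    rw [show (⟨T f, h⟩ : L.domain) = 0 from Subtype.ext hf, L.map_zero] at hLf
    exact hLf.symm
  have hinf := not_finiteDimensional_Lp_two_restrict (μ := volume) hG.isOpen
    (infinite_of_mem_nhds _ (hG.isOpen.mem_nhds hΩne.some_mem))
  obtain ⟨lam, φ, hmono, hlim, heig⟩ := exists_hilbertBasis_nat_eigenvectors hinf hTc hpos hinj
  refine ⟨lam, φ, hmono, hlim, fun j => ?_⟩
  obtain ⟨h0, hTφ⟩ := heig j
  have hfix : T (lam j • φ j) = φ j := by rw [map_smul, hTφ, smul_inv_smul₀ h0]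
  have hint := hT (lam j • φ j)
  rw [hfix] at hint
  exact (hLG (φ j) (lam j • φ j)).2 hint

lemma exists_enorm_le_of_eq_greenOp_add {T : L2 Ω →L[ℝ] L2 Ω}
    (hT : ∀ f : L2 Ω, T f =ᵐ[mu Ω] integralOp (mu Ω) G f) (A : ℝ≥0) :
    ∃ C : ℝ≥0, ∀ l : ℝ, ‖l‖ₑ ≤ A → ∀ z g : L2 Ω, z = T g + l • T z →
      ∀ M : ℝ≥0, (∀ᵐ x ∂(mu Ω), ‖g x‖ₑ ≤ M * (bdistNN Ω x : ℝ≥0∞) ^ γ) →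
      ∀ᵐ x ∂(mu Ω), ‖z x‖ₑ ≤ (C * (M + ‖z‖₊) : ℝ≥0) * (bdistNN Ω x : ℝ≥0∞) ^ γ := by
  have := hG.isFiniteMeasure
  obtain ⟨C, hC⟩ := hG.bounds.exists_le_mul_weight A
  obtain ⟨D, hD⟩ := hG.exists_lintegral_mul_weight_le one_le_two
  refine ⟨C * (1 + D), fun l hl z g hz M hM => ?_⟩
  have hle : ∀ᵐ x ∂(mu Ω), ‖z x‖ₑ
      ≤ potential (mu Ω) (fun x y => ‖G x y‖ₑ) (fun y => ‖g y‖ₑ) x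
        + A * potential (mu Ω) (fun x y => ‖G x y‖ₑ) (fun y => ‖z y‖ₑ) x := by
    filter_upwards [Lp.coeFn_add (T g) (l • T z), Lp.coeFn_smul l (T z),
      enorm_le_potential_of_ae_eq_integralOp hT g,
      enorm_le_potential_of_ae_eq_integralOp hT z] with x hadd hsmul hg hz'
    rw [hz, hadd, Pi.add_apply, hsmul, Pi.smul_apply, smul_eq_mul, ← hz]
    refine (enorm_add_le _ _).trans ?_
    rw [enorm_mul]
    gcongr
  have hint : ∫⁻ y in Ω, ‖z y‖ₑ * (bdistNN Ω y : ℝ≥0∞) ^ γ ≤ D * ‖z‖ₑ :=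
    (hD z (Lp.aestronglyMeasurable z)).trans_eq (by rw [Lp.enorm_def])
  filter_upwards [hC _ _ (Lp.aestronglyMeasurable g).enorm (Lp.aestronglyMeasurable z).enorm hle
    M hM] with x hx
  refine hx.trans ?_
  gcongr ?_ * _
  calc (C : ℝ≥0∞) * (M + ∫⁻ y in Ω, ‖z y‖ₑ * (bdistNN Ω y : ℝ≥0∞) ^ γ)
      ≤ C * ((1 + D) * M + (1 + D) * ‖z‖ₑ) := by
        gcongr
        · exact le_mul_of_one_le_left' le_self_add
        · exact hint.trans (by gcongr; exact le_add_self)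
    _ = _ := by
        rw [enorm_eq_nnnorm]
        push_cast
        ring

end AdmissibleKernel

end AdmissibleKernel

section GreenSpectrum

variable {n : ℕ} {β γ : ℝ} {Ω : Set (Pt n)} {G : Pt n → Pt n → ℝ} {T : L2 Ω →L[ℝ] L2 Ω}
  {lam : ℕ → ℝ} {φ : HilbertBasis ℕ ℝ (L2 Ω)} {l : ℝ} {ψ : L2 Ω}

/-- The component of `g` orthogonal to the first `I` elements of the basis `φ`. -/
noncomputable def highPart (φ : HilbertBasis ℕ ℝ (L2 Ω)) (I : ℕ) (g : L2 Ω) : L2 Ω :=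
  g - ∑ j ∈ Finset.range I, inner ℝ (φ j) g • φ j

lemma coeFn_highPart (φ : HilbertBasis ℕ ℝ (L2 Ω)) (I : ℕ) (g : L2 Ω) :
    highPart φ I g =ᵐ[mu Ω] fun x => g x - ∑ j ∈ Finset.range I, inner ℝ (φ j) g * φ j x := by
  have hsmul (j : ℕ) : ((inner ℝ (φ j) g • φ j : L2 Ω) : Pt n → ℝ) =ᵐ[mu Ω]
      fun x => inner ℝ (φ j) g * φ j x := Lp.coeFn_smul _ _
  filter_upwards [Lp.coeFn_sub g (∑ j ∈ Finset.range I, inner ℝ (φ j) g • φ j),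
    Lp.coeFn_fun_finsetSum (Finset.range I) (fun j => inner ℝ (φ j) g • φ j),
    ae_all_iff.2 hsmul] with x hsub hsum hx
  rw [highPart, hsub, Pi.sub_apply, hsum]
  simp_rw [hx]

lemma inner_basis_highPart (φ : HilbertBasis ℕ ℝ (L2 Ω)) (I : ℕ) (g : L2 Ω) (j : ℕ) :
    inner ℝ (φ j) (highPart φ I g) = if j < I then 0 else inner ℝ (φ j) g :=
  inner_sub_sum_inner_smul φ I g j

/-- An admissible kernel, its integral operator `T` on `L²(Ω)`, and a basis of eigenfunctions of
`T`, indexed by the inverses of the eigenvalues. -/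
structure GreenSpectrum (β γ : ℝ) (Ω : Set (Pt n)) (G : Pt n → Pt n → ℝ) (T : L2 Ω →L[ℝ] L2 Ω)
    (lam : ℕ → ℝ) (φ : HilbertBasis ℕ ℝ (L2 Ω)) : Prop extends AdmissibleKernel β γ Ω G where
  greenOp : ∀ f : L2 Ω, T f =ᵐ[mu Ω] integralOp (mu Ω) G f
  tendsto : Tendsto lam atTop atTop
  ne_zero : ∀ j, lam j ≠ 0
  apply_eigen : ∀ j, T (φ j) = (lam j)⁻¹ • φ j

lemma AdmissibleKernel.exists_greenSpectrum (hG : AdmissibleKernel β γ Ω G)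
    {L : L2 Ω →ₗ.[ℝ] L2 Ω} (hLG : IsGreenFunction L G) (hφ : IsEigenSystem L lam φ) :
    ∃ T, GreenSpectrum β γ Ω G T lam φ := by
  obtain ⟨T, hT, -⟩ := hG.exists_greenOp
  exact ⟨T, hG, hT, hφ.tendsto, fun j => (hφ.eigenvalue_ne_zero_and_apply hLG hT j).1,
    fun j => (hφ.eigenvalue_ne_zero_and_apply hLG hT j).2⟩

namespace GreenSpectrum

variable (S : GreenSpectrum β γ Ω G T lam φ)

include S

lemma inner_basis_greenOp (j : ℕ) (g : L2 Ω) :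
    inner ℝ (φ j) (T g) = (lam j)⁻¹ * inner ℝ (φ j) g := by
  rw [← S.inner_greenOp S.greenOp, S.apply_eigen, real_inner_smul_left]

lemma inner_basis_solOp (l : ℝ) (j : ℕ) (g : L2 Ω) :
    inner ℝ (φ j) (solOp lam φ l g) = inner ℝ (φ j) g / (lam j - l) :=
  inner_tsum_inner_div_sub_smul φ S.tendsto l g j

lemma solOp_eq_greenOp_add (hl : ∀ j, l ≠ lam j) (g : L2 Ω) :
    solOp lam φ l g = T g + l • T (solOp lam φ l g) := by
  refine eq_of_forall_inner_hilbertBasis_eq φ fun j => ?_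
  rw [inner_add_right, inner_smul_right, S.inner_basis_greenOp, S.inner_basis_greenOp,
    S.inner_basis_solOp]
  have h0 := S.ne_zero j
  have hsub : lam j - l ≠ 0 := sub_ne_zero.2 (hl j).symm
  field_simp
  ring

lemma solOp_greenOp (l : ℝ) (g : L2 Ω) : solOp lam φ l (T g) = T (solOp lam φ l g) := by
  refine eq_of_forall_inner_hilbertBasis_eq φ fun j => ?_
  rw [S.inner_basis_greenOp, S.inner_basis_solOp, S.inner_basis_solOp, S.inner_basis_greenOp,
    mul_div_assoc]

lemma highPart_solOp (l : ℝ) (I : ℕ) (g : L2 Ω) :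
    highPart φ I (solOp lam φ l g) = solOp lam φ l (highPart φ I g) := by
  refine eq_of_forall_inner_hilbertBasis_eq φ fun j => ?_
  rw [inner_basis_highPart, S.inner_basis_solOp, S.inner_basis_solOp, inner_basis_highPart]
  split_ifs <;> simp

lemma inner_solOp (l : ℝ) (f g : L2 Ω) :
    inner ℝ (solOp lam φ l f) g = inner ℝ f (solOp lam φ l g) := by
  rw [← φ.tsum_inner_mul_inner, ← φ.tsum_inner_mul_inner]
  refine tsum_congr fun j => ?_
  rw [real_inner_comm, S.inner_basis_solOp, S.inner_basis_solOp, real_inner_comm]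
  ring

lemma norm_highPart_solOp_le {I : ℕ} {d : ℝ} (hd : 0 < d) (h : ∀ j, I ≤ j → d ≤ lam j - l)
    (g : L2 Ω) : ‖highPart φ I (solOp lam φ l g)‖ ≤ d⁻¹ * ‖g‖ := by
  refine norm_le_of_forall_abs_inner_hilbertBasis_le φ (inv_nonneg.2 hd.le) fun j => ?_
  rw [inner_basis_highPart, S.inner_basis_solOp]
  split_ifs with hj
  · rw [abs_zero]
    positivity
  · have hgap := h j (not_lt.1 hj)
    rw [abs_div, div_eq_inv_mul, abs_of_pos (hd.trans_le hgap)]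
    exact mul_le_mul_of_nonneg_right (inv_anti₀ hd hgap) (abs_nonneg _)

lemma memWLinf_greenOp (hψ : MemWLinf γ ψ) : MemWLinf γ (T ψ) := by
  have := S.isFiniteMeasure
  obtain ⟨M, hM⟩ := (memWLinf_iff S.γ_nonneg).1 hψ
  obtain ⟨C, hC⟩ := S.bounds.exists_potential_iterate_weight_le 1
  refine (memWLinf_iff S.γ_nonneg).2 ⟨M * C, ?_⟩
  filter_upwards [enorm_le_potential_of_ae_eq_integralOp S.greenOp ψ, hC] with x hx hCx
  calc ‖T ψ x‖ₑ
      ≤ potential (mu Ω) (fun x y => ‖G x y‖ₑ) (fun y => M * (bdistNN Ω y : ℝ≥0∞) ^ γ) x :=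
        hx.trans (potential_mono_ae hM x)
    _ = M * potential (mu Ω) (fun x y => ‖G x y‖ₑ) (fun y => (bdistNN Ω y : ℝ≥0∞) ^ γ) x :=
        potential_const_mul S.bounds.measurable
          (S.bounds.measurable_rpow_weight γ).aemeasurable M x
    _ ≤ M * (C * (bdistNN Ω x : ℝ≥0∞) ^ γ) := by
        gcongr
        exact hCx
    _ = _ := by
        push_cast
        ring

lemma memWLinf_basis (j : ℕ) : MemWLinf γ (φ j) := by
  obtain ⟨C, hC⟩ := S.exists_enorm_le_of_eq_greenOp_add S.greenOp ‖lam j‖₊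
  have hzero : ∀ᵐ x ∂(mu Ω), ‖(0 : L2 Ω) x‖ₑ ≤ (0 : ℝ≥0) * (bdistNN Ω x : ℝ≥0∞) ^ γ := by
    filter_upwards [Lp.coeFn_zero ℝ 2 (mu Ω)] with x hx
    rw [hx]
    simp
  refine (memWLinf_iff S.γ_nonneg).2 ⟨_, hC (lam j) le_rfl (φ j) 0 ?_ 0 hzero⟩
  rw [map_zero, zero_add, S.apply_eigen, smul_inv_smul₀ (S.ne_zero j)]

lemma memWLinf_solOp (hl : ∀ j, l ≠ lam j) (hψ : MemWLinf γ ψ) :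
    MemWLinf γ (solOp lam φ l ψ) := by
  obtain ⟨C, hC⟩ := S.exists_enorm_le_of_eq_greenOp_add S.greenOp ‖l‖₊
  obtain ⟨M, hM⟩ := (memWLinf_iff S.γ_nonneg).1 hψ
  exact (memWLinf_iff S.γ_nonneg).2
    ⟨_, hC l le_rfl _ ψ (S.solOp_eq_greenOp_add hl ψ) M hM⟩

lemma exists_enorm_highPart_le (I : ℕ) :
    ∃ C : ℝ≥0, ∀ (ψ : L2 Ω) (M : ℝ≥0),
      (∀ᵐ x ∂(mu Ω), ‖ψ x‖ₑ ≤ M * (bdistNN Ω x : ℝ≥0∞) ^ γ) →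
      ∀ᵐ x ∂(mu Ω), ‖highPart φ I ψ x‖ₑ ≤ (C * M : ℝ≥0) * (bdistNN Ω x : ℝ≥0∞) ^ γ := by
  obtain ⟨D, hD⟩ := S.exists_enorm_le
  choose B hB using fun j => (memWLinf_iff S.γ_nonneg).1 (S.memWLinf_basis j)
  refine ⟨1 + ∑ j ∈ Finset.range I, D * B j, fun ψ M hM => ?_⟩
  have hcoeff (j : ℕ) : ‖(inner ℝ (φ j) ψ : ℝ)‖ₑ ≤ D * M := by
    refine le_trans ?_ (hD ψ M hM)
    have hle := norm_inner_le_norm (𝕜 := ℝ) (φ j) ψ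
    rw [φ.orthonormal.1 j, one_mul] at hle
    exact enorm_le_iff_norm_le.2 hle
  filter_upwards [coeFn_highPart φ I ψ, hM, ae_all_iff.2 hB] with x hx hMx hBx
  rw [hx]
  refine enorm_sub_le.trans ?_
  push_cast
  rw [add_mul, one_mul, add_mul, Finset.sum_mul, Finset.sum_mul]
  refine add_le_add hMx ((enorm_sum_le _ _).trans (Finset.sum_le_sum fun j _ => ?_))
  rw [enorm_mul]
  calc ‖(inner ℝ (φ j) ψ : ℝ)‖ₑ * ‖φ j x‖ₑ
      ≤ (D * M : ℝ≥0∞) * (B j * (bdistNN Ω x : ℝ≥0∞) ^ γ) := mul_le_mul' (hcoeff j) (hBx j)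
    _ = _ := by ring

/-- The high part `z` of `𝔾_l ψ` solves `z = T g + l T z` with `g` the high part of `ψ`, and its
norm in `L²` is controlled by the gap, whence a bound in `δ^γ L^∞` without any loss at the low
eigenvalues. -/
lemma exists_enorm_highPart_solOp_le (I : ℕ) {d : ℝ} (hd : 0 < d) (A : ℝ≥0) :
    ∃ C : ℝ≥0, ∀ l : ℝ, ‖l‖ₑ ≤ A → (∀ j, l ≠ lam j) → (∀ j, I ≤ j → d ≤ lam j - l) →
      ∀ ψ : L2 Ω, (∀ᵐ x ∂(mu Ω), ‖ψ x‖ₑ ≤ (bdistNN Ω x : ℝ≥0∞) ^ γ) →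
      ∀ᵐ x ∂(mu Ω),
        ‖highPart φ I (solOp lam φ l ψ) x‖ₑ ≤ C * (bdistNN Ω x : ℝ≥0∞) ^ γ := by
  obtain ⟨C, hC⟩ := S.exists_enorm_le_of_eq_greenOp_add S.greenOp A
  obtain ⟨B, hB⟩ := S.exists_enorm_highPart_le I
  obtain ⟨D, hD⟩ := S.exists_enorm_le
  refine ⟨C * (B + ‖d⁻¹‖₊ * D), fun l hlA hl hgap ψ hψ => ?_⟩
  have hψ1 : ∀ᵐ x ∂(mu Ω), ‖ψ x‖ₑ ≤ (1 : ℝ≥0) * (bdistNN Ω x : ℝ≥0∞) ^ γ := by simpa using hψ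
  have hz : highPart φ I (solOp lam φ l ψ)
      = T (highPart φ I ψ) + l • T (highPart φ I (solOp lam φ l ψ)) := by
    rw [S.highPart_solOp]
    exact S.solOp_eq_greenOp_add hl _
  have hnorm : ‖highPart φ I (solOp lam φ l ψ)‖₊ ≤ ‖d⁻¹‖₊ * D := by
    have hψD : ‖ψ‖₊ ≤ D := by
      have := hD ψ 1 hψ1
      rwa [ENNReal.coe_one, mul_one, enorm_eq_nnnorm, ENNReal.coe_le_coe] at this
    refine le_trans ?_ (mul_le_mul_right hψD ‖d⁻¹‖₊)
    rw [← NNReal.coe_le_coe, NNReal.coe_mul, coe_nnnorm, coe_nnnorm, coe_nnnorm,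
      Real.norm_of_nonneg (inv_nonneg.2 hd.le)]
    exact S.norm_highPart_solOp_le hd hgap ψ
  filter_upwards [hC l hlA _ _ hz (B * 1) (hB ψ 1 hψ1)] with x hx
  refine hx.trans ?_
  rw [mul_one]
  gcongr

end GreenSpectrum

end GreenSpectrum

section WeakSolutions

variable {n : ℕ} {β γ : ℝ} {Ω : Set (Pt n)} {G : Pt n → Pt n → ℝ} {T : L2 Ω →L[ℝ] L2 Ω}
  {lam : ℕ → ℝ} {φ : HilbertBasis ℕ ℝ (L2 Ω)} {l : ℝ} {f u v : Pt n → ℝ} {ψ : L2 Ω}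

lemma IsWeightedDomain.integral_sub_sum_mul (hΩ : IsWeightedDomain γ Ω) {ι : Type*}
    (s : Finset ι) (c : ι → ℝ) (e : ι → L2 Ω) (hf : MemL1w γ Ω f) (hψ : MemWLinf γ ψ) :
    ∫ x in Ω, (f x - ∑ j ∈ s, c j * e j x) * ψ x
      = (∫ x in Ω, f x * ψ x) - ∑ j ∈ s, c j * inner ℝ (e j) ψ := by
  have hint (j : ι) : Integrable (fun x => c j * (e j x * ψ x)) (mu Ω) :=
    (hΩ.integrable_mul (hΩ.memL1w_coeFn (e j)) hψ).const_mul _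
  simp_rw [inner_eq_integral_mul, ← integral_const_mul]
  rw [← integral_finsetSum _ fun j _ => hint j,
    ← integral_sub (hΩ.integrable_mul hf hψ) (integrable_finsetSum _ fun j _ => hint j)]
  simp_rw [sub_mul, Finset.sum_mul, mul_assoc]

namespace AdmissibleKernel

variable (hG : AdmissibleKernel β γ Ω G)

include hG

lemma lintegral_potential_mul_weight_ne_top (hf : MemL1w γ Ω f) :
    ∫⁻ x in Ω, potential (mu Ω) (fun x y => ‖G x y‖ₑ) (fun y => ‖f y‖ₑ) x
      * (bdistNN Ω x : ℝ≥0∞) ^ γ ≠ ⊤ := by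
  have := hG.isFiniteMeasure
  obtain ⟨hfm, hfin⟩ := hG.memL1w_iff.1 hf
  obtain ⟨C, hC⟩ := hG.bounds.exists_lintegral_potential_iterate_mul_weight_le 1
  exact ((hC _ hfm.enorm).trans_lt (ENNReal.mul_lt_top ENNReal.coe_lt_top hfin.lt_top)).ne

lemma memL1w_integralOp (hf : MemL1w γ Ω f) : MemL1w γ Ω (integralOp (mu Ω) G f) := by
  have := hG.isFiniteMeasure
  refine hG.memL1w_iff.2 ⟨aestronglyMeasurable_integralOp hG.measurable (hG.memL1w_iff.1 hf).1,
    ne_top_of_le_ne_top (hG.lintegral_potential_mul_weight_ne_top hf) (lintegral_mono fun x => ?_)⟩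
  gcongr
  exact enorm_integralOp_le (mu Ω) G f x

lemma integral_integralOp_mul_eq_integral_mul_greenOp
    (hT : ∀ g : L2 Ω, T g =ᵐ[mu Ω] integralOp (mu Ω) G g) (hf : MemL1w γ Ω f)
    (hψ : MemWLinf γ ψ) :
    ∫ x in Ω, integralOp (mu Ω) G f x * ψ x = ∫ x in Ω, f x * T ψ x := by
  have := hG.isFiniteMeasure
  obtain ⟨M, hM⟩ := (memWLinf_iff hG.γ_nonneg).1 hψ
  have hfin := ((lintegral_mul_le_of_enorm_le
    (potential (mu Ω) (fun x y => ‖G x y‖ₑ) (fun y => ‖f y‖ₑ)) hM).trans_lt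
    (ENNReal.mul_lt_top ENNReal.coe_lt_top
      (hG.lintegral_potential_mul_weight_ne_top hf).lt_top)).ne
  rw [integral_integralOp_mul hG.measurable hG.symm (hG.memL1w_iff.1 hf).1
    (Lp.aestronglyMeasurable ψ) hfin]
  exact integral_congr_ae ((hT ψ).mono fun x hx => by simp only [hx])

end AdmissibleKernel

namespace GreenSpectrum

variable (S : GreenSpectrum β γ Ω G T lam φ)

include S

lemma isWeakSol_of_forall_integral_eq (hl : ∀ j, l ≠ lam j) (hf : MemL1w γ Ω f)
    (hu : MemL1w γ Ω u) (h : ∀ ψ : L2 Ω, MemWLinf γ ψ →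
      ∫ x in Ω, u x * ψ x = ∫ x in Ω, f x * solOp lam φ l ψ x) :
    IsWeakSol γ lam φ l f u :=
  ⟨hf, hu, fun _ hψ => S.integrable_mul hf (S.memWLinf_solOp hl hψ), h⟩

lemma isWeakSol_unique (hu : IsWeakSol γ lam φ l f u) (hv : IsWeakSol γ lam φ l f v) :
    u =ᵐ[mu Ω] v :=
  S.ae_eq_of_forall_integral_eq hu.sol_mem hv.sol_mem fun ψ hψ =>
    (hu.weak ψ hψ).trans (hv.weak ψ hψ).symm

lemma isWeakSol_of_integralOp (hl : ∀ j, l ≠ lam j) (hf : MemL1w γ Ω f)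
    (hu : IsWeakSol γ lam φ l (integralOp (mu Ω) G f) u) :
    IsWeakSol γ lam φ l f (fun x => integralOp (mu Ω) G f x + l * u x) := by
  refine S.isWeakSol_of_forall_integral_eq hl hf
    (memL1w_add hu.data_mem (memL1w_const_mul hu.sol_mem l)) fun ψ hψ => ?_
  have hz := S.memWLinf_solOp hl hψ
  rw [S.integral_add_const_mul_mul hu.data_mem hu.sol_mem hψ, hu.weak ψ hψ,
    S.integral_integralOp_mul_eq_integral_mul_greenOp S.greenOp hf hψ,
    S.integral_integralOp_mul_eq_integral_mul_greenOp S.greenOp hf hz,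
    ← S.integral_mul_add_smul hf (S.memWLinf_greenOp hψ) (S.memWLinf_greenOp hz),
    ← S.solOp_eq_greenOp_add hl]

lemma exists_isWeakSol_of_enorm_le (hl : ∀ j, l ≠ lam j) (hf : MemL1w γ Ω f) {M : ℝ≥0}
    (hM : ∀ᵐ x ∂(mu Ω), ‖f x‖ₑ ≤ M * (bdistNN Ω x : ℝ≥0∞) ^ γ) :
    ∃ u, IsWeakSol γ lam φ l f u := by
  have hf2 : MemLp f 2 (mu Ω) := S.memLp_of_enorm_le (S.memL1w_iff.1 hf).1 hM 2
  refine ⟨solOp lam φ l hf2.toLp,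
    S.isWeakSol_of_forall_integral_eq hl hf (S.memL1w_coeFn _) fun ψ _ => ?_⟩
  rw [← inner_eq_integral_mul, S.inner_solOp, inner_eq_integral_mul]
  exact integral_congr_ae (hf2.coeFn_toLp.mono fun x hx => by simp only [hx])

lemma exists_isWeakSol_of_iterate_enorm_le (hl : ∀ j, l ≠ lam j) (N : ℕ) (hf : MemL1w γ Ω f)
    {M : ℝ≥0} (hM : ∀ᵐ x ∂(mu Ω),
      ‖(integralOp (mu Ω) G)^[N] f x‖ₑ ≤ M * (bdistNN Ω x : ℝ≥0∞) ^ γ) :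
    ∃ u, IsWeakSol γ lam φ l f u := by
  induction N generalizing f with
  | zero => exact S.exists_isWeakSol_of_enorm_le hl hf hM
  | succ N ih =>
    obtain ⟨u, hu⟩ := ih (S.memL1w_integralOp hf) hM
    exact ⟨_, S.isWeakSol_of_integralOp hl hf hu⟩

theorem exists_isWeakSol (hl : ∀ j, l ≠ lam j) (hf : MemL1w γ Ω f) :
    ∃ u, IsWeakSol γ lam φ l f u := by
  have := S.isFiniteMeasure
  obtain ⟨N, C, hC⟩ := S.bounds.exists_potential_iterate_le
  obtain ⟨hfm, hfin⟩ := S.memL1w_iff.1 hf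
  refine S.exists_isWeakSol_of_iterate_enorm_le hl N hf
    (M := C * (∫⁻ x in Ω, ‖f x‖ₑ * (bdistNN Ω x : ℝ≥0∞) ^ γ).toNNReal) ?_
  filter_upwards [hC _ hfm.enorm] with x hx
  refine (enorm_integralOp_iterate_le (mu Ω) G f N x).trans (hx.trans_eq ?_)
  rw [ENNReal.coe_mul, ENNReal.coe_toNNReal hfin, mul_right_comm]

lemma ae_eq_integralOp_add (hl : ∀ j, l ≠ lam j) (hu : IsWeakSol γ lam φ l f u) :
    u =ᵐ[mu Ω] fun x => integralOp (mu Ω) G f x + l * integralOp (mu Ω) G u x := by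
  have hf := hu.data_mem
  have hGf := S.memL1w_integralOp hf
  have hGu := S.memL1w_integralOp hu.sol_mem
  refine S.ae_eq_of_forall_integral_eq hu.sol_mem
    (memL1w_add hGf (memL1w_const_mul hGu l)) fun ψ hψ => ?_
  have hT := S.memWLinf_greenOp hψ
  rw [S.integral_add_const_mul_mul hGf hGu hψ,
    S.integral_integralOp_mul_eq_integral_mul_greenOp S.greenOp hf hψ,
    S.integral_integralOp_mul_eq_integral_mul_greenOp S.greenOp hu.sol_mem hψ, hu.weak _ hT,
    S.solOp_greenOp,
    ← S.integral_mul_add_smul hf hT (S.memWLinf_greenOp (S.memWLinf_solOp hl hψ)),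
    ← S.solOp_eq_greenOp_add hl, hu.weak ψ hψ]

lemma ae_enorm_le_potential_add (hl : ∀ j, l ≠ lam j) {A : ℝ≥0} (hlA : ‖l‖ₑ ≤ A)
    (hu : IsWeakSol γ lam φ l f u) :
    ∀ᵐ x ∂(mu Ω), ‖u x‖ₑ ≤ potential (mu Ω) (fun x y => ‖G x y‖ₑ) (fun y => ‖f y‖ₑ) x
      + A * potential (mu Ω) (fun x y => ‖G x y‖ₑ) (fun y => ‖u y‖ₑ) x := by
  filter_upwards [S.ae_eq_integralOp_add hl hu] with x hx
  rw [hx]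
  refine (enorm_add_le _ _).trans ?_
  rw [enorm_mul]
  gcongr
  · exact enorm_integralOp_le (mu Ω) G f x
  · exact enorm_integralOp_le (mu Ω) G u x

lemma memL1w_perp (l : ℝ) (hf : MemL1w γ Ω f) : MemL1w γ Ω (perp lam φ l f) :=
  memL1w_sub hf (memL1w_finsetSum _ fun j _ =>
    memL1w_const_mul (S.memL1w_coeFn (φ j)) (pairing f (φ j)))

lemma integral_mul_highPart (I : ℕ) (hf : MemL1w γ Ω f) (hψ : MemWLinf γ ψ) :
    ∫ x in Ω, f x * highPart φ I ψ x
      = (∫ x in Ω, f x * ψ x) - ∑ j ∈ Finset.range I, pairing f (φ j) * inner ℝ (φ j) ψ := by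
  have hint (j : ℕ) : Integrable (fun x => f x * φ j x * inner ℝ (φ j) ψ) (mu Ω) :=
    (S.integrable_mul hf (S.memWLinf_basis j)).mul_const _
  simp_rw [pairing, ← integral_mul_const]
  rw [← integral_finsetSum _ fun j _ => hint j,
    ← integral_sub (S.integrable_mul hf hψ) (integrable_finsetSum _ fun j _ => hint j)]
  refine integral_congr_ae ?_
  filter_upwards [coeFn_highPart φ I ψ] with x hx
  rw [hx, mul_sub, Finset.mul_sum]
  simp_rw [mul_left_comm (f x), mul_comm (inner ℝ _ ψ)]

lemma integral_perp_mul (l : ℝ) (hf : MemL1w γ Ω f) (hψ : MemWLinf γ ψ) :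
    ∫ x in Ω, perp lam φ l f x * ψ x = ∫ x in Ω, f x * highPart φ (lowCount lam l) ψ x := by
  rw [S.integral_mul_highPart _ hf hψ, ← S.integral_sub_sum_mul _ _ _ hf hψ]
  rfl

theorem ae_eq_sum_add (hl : ∀ j, l ≠ lam j) (hu : IsWeakSol γ lam φ l f u)
    (hv : IsWeakSol γ lam φ l (perp lam φ l f) v) :
    u =ᵐ[mu Ω] fun x => (∑ j ∈ Finset.range (lowCount lam l),
      pairing f (φ j) / (lam j - l) * φ j x) + v x := by
  have hf := hu.data_mem
  have hsub : (fun x => u x - ∑ j ∈ Finset.range (lowCount lam l),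
      pairing f (φ j) / (lam j - l) * φ j x) =ᵐ[mu Ω] v := by
    refine S.ae_eq_of_forall_integral_eq (memL1w_sub hu.sol_mem (memL1w_finsetSum _ fun j _ =>
      memL1w_const_mul (S.memL1w_coeFn (φ j)) _)) hv.sol_mem fun ψ hψ => ?_
    have hz := S.memWLinf_solOp hl hψ
    rw [S.integral_sub_sum_mul _ _ _ hu.sol_mem hψ, hv.weak ψ hψ, S.integral_perp_mul l hf hz,
      S.integral_mul_highPart _ hf hz, hu.weak ψ hψ]
    simp_rw [S.inner_basis_solOp, mul_div_assoc', div_mul_eq_mul_div]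
  filter_upwards [hsub] with x hx
  rw [← hx, add_sub_cancel]

end GreenSpectrum

end WeakSolutions

section SpectralGap

variable {lam : ℕ → ℝ}

/-- `l` is not an eigenvalue, is bounded by `A`, has `I` low eigenfunctions, and lies at distance at
least `d` below the remaining eigenvalues: all that uniform estimates need to know about `l`. -/
structure HasGap (lam : ℕ → ℝ) (I : ℕ) (d : ℝ) (A : ℝ≥0) (l : ℝ) : Prop where
  ne : ∀ j, l ≠ lam j
  lowCount_eq : lowCount lam l = I
  enorm_le : ‖l‖ₑ ≤ A
  le_sub : ∀ j, I ≤ j → d ≤ lam j - l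

lemma exists_le_and_lt_succ_of_tendsto (hlim : Tendsto lam atTop atTop) (l : ℝ) :
    ∃ j, l ≤ lam j ∧ lam j < lam (j + 1) := by
  by_contra! h
  obtain ⟨N, hN⟩ := tendsto_atTop_atTop.1 hlim l
  have hle (k : ℕ) : lam (N + k) ≤ lam N := by
    induction k with
    | zero => exact le_rfl
    | succ k ih => exact (h (N + k) (hN _ (Nat.le_add_right _ _))).trans ih
  obtain ⟨M, hM⟩ := tendsto_atTop_atTop.1 hlim (lam N + 1)
  linarith [hM (N + M) (Nat.le_add_left _ _), hle M]

lemma le_and_lt_lamBar (hlim : Tendsto lam atTop atTop) (l : ℝ) :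
    l ≤ lam (lowCount lam l - 1) ∧ lam (lowCount lam l - 1) < lamBar lam l :=
  Nat.sInf_mem (s := {j | l ≤ lam j ∧ lam j < lam (j + 1)})
    (exists_le_and_lt_succ_of_tendsto hlim l)

lemma lowCount_eq_sInf (hmono : Monotone lam) (hlim : Tendsto lam atTop atTop) (l : ℝ) :
    lowCount lam l = sInf {j | lamBar lam l ≤ lam j} := by
  have hmem : lowCount lam l ∈ {j | lamBar lam l ≤ lam j} := le_refl (lamBar lam l)
  refine le_antisymm (le_csInf ⟨_, hmem⟩ fun j hj => ?_) (Nat.sInf_le hmem)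
  by_contra! hlt
  exact (hj.trans (hmono (Nat.le_sub_one_of_lt hlt))).not_gt (le_and_lt_lamBar hlim l).2

lemma exists_hasGap (hmono : Monotone lam) (hlim : Tendsto lam atTop atTop) (lb Λ : ℝ) :
    ∃ (I : ℕ) (d : ℝ) (A : ℝ≥0), 0 < d ∧
      ∀ l, -Λ ≤ l → (∀ j, l ≠ lam j) → lamBar lam l = lb → HasGap lam I d A l := by
  by_cases hlb : ∃ l₀, lamBar lam l₀ = lb
  · obtain ⟨l₀, rfl⟩ := hlb
    obtain ⟨-, hlt⟩ := le_and_lt_lamBar hlim l₀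
    refine ⟨lowCount lam l₀, lamBar lam l₀ - lam (lowCount lam l₀ - 1),
      ‖Λ‖₊ + ‖lamBar lam l₀‖₊, sub_pos.2 hlt, fun l hΛ hl hbar => ?_⟩
    have hcount : lowCount lam l = lowCount lam l₀ := by
      rw [lowCount_eq_sInf hmono hlim, lowCount_eq_sInf hmono hlim, hbar]
    have hle : l ≤ lam (lowCount lam l₀ - 1) := hcount ▸ (le_and_lt_lamBar hlim l).1
    refine ⟨hl, hcount, ?_, fun j hj => sub_le_sub (hmono hj) hle⟩
    rw [enorm_eq_nnnorm, ENNReal.coe_le_coe, ← NNReal.coe_le_coe, NNReal.coe_add, coe_nnnorm,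
      coe_nnnorm, coe_nnnorm, Real.norm_eq_abs, Real.norm_eq_abs, Real.norm_eq_abs]
    exact abs_le.2 ⟨by linarith [le_abs_self Λ, abs_nonneg (lamBar lam l₀)],
      by linarith [le_abs_self (lamBar lam l₀), abs_nonneg Λ]⟩
  · exact ⟨0, 1, 0, one_pos, fun l _ _ hbar => (hlb ⟨l, hbar⟩).elim⟩

end SpectralGap

section Estimates

variable {n : ℕ} {β γ : ℝ} {Ω : Set (Pt n)} {G : Pt n → Pt n → ℝ} {T : L2 Ω →L[ℝ] L2 Ω}
  {lam : ℕ → ℝ} {φ : HilbertBasis ℕ ℝ (L2 Ω)}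

lemma ae_enorm_le_eLpNorm_top_of_mem {μ : Measure (Pt n)} {f : Pt n → ℝ} {U K : Set (Pt n)}
    (hU : IsOpen U) (hUK : U ⊆ K) :
    ∀ᵐ y ∂μ, y ∈ U → ‖f y‖ₑ ≤ eLpNorm f ∞ (μ.restrict K) := by
  rw [← ae_restrict_iff' hU.measurableSet, eLpNorm_exponent_top]
  exact ae_mono (Measure.restrict_mono_set μ hUK) (enorm_ae_le_eLpNormEssSup f _)

namespace GreenSpectrum

variable (S : GreenSpectrum β γ Ω G T lam φ)

include S

lemma exists_isWeakSol_forall_ae_eq {l : ℝ} (hl : ∀ j, l ≠ lam j) {f : Pt n → ℝ}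
    (hf : MemL1w γ Ω f) :
    ∃ u, IsWeakSol γ lam φ l f u ∧ ∀ v, IsWeakSol γ lam φ l f v → v =ᵐ[mu Ω] u := by
  obtain ⟨u, hu⟩ := S.exists_isWeakSol hl hf
  exact ⟨u, hu, fun v hv => S.isWeakSol_unique hv hu⟩

variable (I : ℕ) {d : ℝ}

lemma exists_enorm_perp_le :
    ∃ C : ℝ≥0, ∀ l, lowCount lam l = I → ∀ f : Pt n → ℝ, ∀ᵐ x ∂(mu Ω), ‖perp lam φ l f x‖ₑ
      ≤ ‖f x‖ₑ + C * (∫⁻ y in Ω, ‖f y‖ₑ * (bdistNN Ω y : ℝ≥0∞) ^ γ)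
        * (bdistNN Ω x : ℝ≥0∞) ^ γ := by
  choose B hB using fun j => (memWLinf_iff S.γ_nonneg).1 (S.memWLinf_basis j)
  refine ⟨∑ j ∈ Finset.range I, B j * B j, fun l hl f => ?_⟩
  have hpairing (j : ℕ) : ‖pairing f (φ j)‖ₑ
      ≤ B j * ∫⁻ y in Ω, ‖f y‖ₑ * (bdistNN Ω y : ℝ≥0∞) ^ γ := by
    refine (enorm_integral_le_lintegral_enorm _).trans ?_
    simp_rw [enorm_mul]
    exact lintegral_mul_le_of_enorm_le (fun y => ‖f y‖ₑ) (hB j)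
  filter_upwards [ae_all_iff.2 hB] with x hx
  rw [perp, hl]
  refine enorm_sub_le.trans (add_le_add le_rfl ((enorm_sum_le _ _).trans ?_))
  push_cast
  rw [Finset.sum_mul, Finset.sum_mul]
  refine Finset.sum_le_sum fun j _ => ?_
  rw [enorm_mul]
  refine (mul_le_mul' (hpairing j) (hx j)).trans_eq ?_
  ring

variable (hd : 0 < d) (A : ℝ≥0)

include hd

lemma exists_lintegral_sol_perp_mul_weight_le :
    ∃ C : ℝ≥0, ∀ l, HasGap lam I d A l → ∀ f w : Pt n → ℝ, MemL1w γ Ω f →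
      IsWeakSol γ lam φ l (perp lam φ l f) w →
      ∫⁻ x in Ω, ‖w x‖ₑ * (bdistNN Ω x : ℝ≥0∞) ^ γ
        ≤ C * ∫⁻ x in Ω, ‖f x‖ₑ * (bdistNN Ω x : ℝ≥0∞) ^ γ := by
  obtain ⟨C, hC⟩ := S.exists_enorm_highPart_solOp_le I hd A
  refine ⟨C, fun l hl f w hf hw => ?_⟩
  obtain ⟨ψ, hψ, hwψ⟩ := S.exists_mul_eq_norm_mul (S.memL1w_iff.1 hw.sol_mem).1
  have hψmem : MemWLinf γ ψ := memWLinf_of_enorm_le S.γ_nonneg hψ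
  calc ∫⁻ x in Ω, ‖w x‖ₑ * (bdistNN Ω x : ℝ≥0∞) ^ γ
      = ∫⁻ x in Ω, ‖w x * bdist Ω x ^ γ‖ₑ := by simp_rw [enorm_mul_bdist_rpow S.γ_nonneg]
    _ = ENNReal.ofReal (∫ x in Ω, w x * ψ x) := by
        rw [integral_congr_ae hwψ, ofReal_integral_norm_eq_lintegral_enorm hw.sol_mem]
    _ = ENNReal.ofReal (∫ x in Ω, f x * highPart φ I (solOp lam φ l ψ) x) := by
        rw [hw.weak ψ hψmem, S.integral_perp_mul l hf (S.memWLinf_solOp hl.ne hψmem),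
          hl.lowCount_eq]
    _ ≤ ∫⁻ x in Ω, ‖f x‖ₑ * ‖highPart φ I (solOp lam φ l ψ) x‖ₑ := by
        simp_rw [← enorm_mul]
        exact (Real.ofReal_le_enorm _).trans (enorm_integral_le_lintegral_enorm _)
    _ ≤ _ := lintegral_mul_le_of_enorm_le _ (hC l hl.enorm_le hl.ne hl.le_sub ψ hψ)

theorem exists_eLpNorm_sol_perp_mul_bdist_rpow_le :
    ∃ C : ℝ≥0, ∀ l, HasGap lam I d A l → ∀ f w : Pt n → ℝ, MemL1w γ Ω f →
      IsWeakSol γ lam φ l (perp lam φ l f) w →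
      eLpNorm (fun x => w x * bdist Ω x ^ γ) 1 (mu Ω)
        ≤ C * eLpNorm (fun x => f x * bdist Ω x ^ γ) 1 (mu Ω) := by
  simp_rw [eLpNorm_one_mul_bdist_rpow S.γ_nonneg]
  exact S.exists_lintegral_sol_perp_mul_weight_le I hd A

lemma exists_enorm_sol_perp_le_potentialSum :
    ∃ (N : ℕ) (C : ℝ≥0), ∀ l, HasGap lam I d A l → ∀ f w : Pt n → ℝ, MemL1w γ Ω f →
      IsWeakSol γ lam φ l (perp lam φ l f) w →
      ∀ᵐ x ∂(mu Ω), ‖w x‖ₑ ≤ C * potentialSum (mu Ω) (fun x y => ‖G x y‖ₑ)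
        (fun y => (bdistNN Ω y : ℝ≥0∞) ^ γ) N (fun y => ‖f y‖ₑ) x := by
  have := S.isFiniteMeasure
  obtain ⟨B, hB⟩ := S.exists_enorm_perp_le I
  obtain ⟨D, hD⟩ := S.exists_lintegral_sol_perp_mul_weight_le I hd A
  obtain ⟨N, C, hC⟩ := S.bounds.exists_le_potentialSum A B D
  exact ⟨N, C, fun l hl f w hf hw => hC _ _ _ (S.memL1w_iff.1 hf).1.enorm
    (S.memL1w_iff.1 hw.data_mem).1.enorm (S.memL1w_iff.1 hw.sol_mem).1.enorm
    (S.ae_enorm_le_potential_add hl.ne hl.enorm_le hw) (hB l hl.lowCount_eq f)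
    (hD l hl f w hf hw)⟩

lemma exists_eLpNorm_sol_perp_le {p q : ℝ≥0∞} (hp : 1 ≤ p) (hq : 1 ≤ q)
    (hpot : ∀ i, ∃ C : ℝ≥0, ∀ F : Pt n → ℝ≥0∞, AEMeasurable F (mu Ω) →
      eLpNorm ((potential (mu Ω) (fun x y => ‖G x y‖ₑ))^[i + 1] F) q (mu Ω)
        ≤ C * eLpNorm F p (mu Ω)) :
    ∃ C : ℝ≥0, ∀ l, HasGap lam I d A l → ∀ f w : Pt n → ℝ, MemLp f p (mu Ω) →
      IsWeakSol γ lam φ l (perp lam φ l f) w →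
      eLpNorm w q (mu Ω) ≤ C * eLpNorm f p (mu Ω) := by
  have := S.isFiniteMeasure
  obtain ⟨N, C, hC⟩ := S.exists_enorm_sol_perp_le_potentialSum I hd A
  obtain ⟨D, hD⟩ := S.exists_weight_le
  obtain ⟨B, hB⟩ := exists_eLpNorm_potentialSum_le S.bounds.measurable
    (S.bounds.measurable_rpow_weight γ) hD hp hq hpot N
  refine ⟨C * B, fun l hl f w hf hw => ?_⟩
  have hle : eLpNorm w q (mu Ω) ≤ C * eLpNorm (potentialSum (mu Ω) (fun x y => ‖G x y‖ₑ)
      (fun y => (bdistNN Ω y : ℝ≥0∞) ^ γ) N (fun y => ‖f y‖ₑ)) q (mu Ω) :=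
    eLpNorm_le_nnreal_smul_eLpNorm_of_ae_le_mul' (hC l hl f w (S.memL1w_of_memLp hp hf) hw) q
  refine hle.trans ?_
  rw [ENNReal.coe_mul, mul_assoc, ← eLpNorm_enorm f]
  gcongr
  exact hB _ hf.1.enorm

theorem exists_eLpNorm_sol_perp_le_eLpNorm_one {p : ℝ} (hp : 1 ≤ p) (hpβ : p * β < n) :
    ∃ C : ℝ≥0, ∀ l, HasGap lam I d A l → ∀ f w : Pt n → ℝ, MemLp f 1 (mu Ω) →
      IsWeakSol γ lam φ l (perp lam φ l f) w →
      eLpNorm w (ENNReal.ofReal p) (mu Ω) ≤ C * eLpNorm f 1 (mu Ω) := by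
  have := S.isFiniteMeasure
  exact S.exists_eLpNorm_sol_perp_le I hd A le_rfl (ENNReal.one_le_ofReal.2 hp)
    (S.bounds.exists_eLpNorm_potential_iterate_le_eLpNorm_one hp hpβ)

theorem exists_eLpNorm_sol_perp_le_of_one_div_eq {p₀ p₁ : ℝ} (hp₀ : 1 < p₀)
    (hp₀β : p₀ * (1 - β / n) < 1) (hp₁ : 1 / p₁ = 1 / p₀ - (1 - β / n)) :
    ∃ C : ℝ≥0, ∀ l, HasGap lam I d A l → ∀ f w : Pt n → ℝ,
      MemLp f (ENNReal.ofReal p₀) (mu Ω) → IsWeakSol γ lam φ l (perp lam φ l f) w →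
      eLpNorm w (ENNReal.ofReal p₁) (mu Ω) ≤ C * eLpNorm f (ENNReal.ofReal p₀) (mu Ω) := by
  have := S.isFiniteMeasure
  have hp₀0 : 0 < p₀ := by linarith
  have hpos : 0 < 1 / p₁ := by
    rw [hp₁, sub_pos, lt_div_iff₀' hp₀0]
    exact hp₀β
  have hle : 1 / p₁ ≤ 1 := by
    have hinv : 1 / p₀ ≤ 1 := (div_le_one hp₀0).2 hp₀.le
    have hβ : β / n ≤ 1 := (div_le_one S.bounds.dim_pos).2 S.bounds.β_lt.le
    linarith
  have hp₁1 : 1 ≤ p₁ := (div_le_one (one_div_pos.1 hpos)).1 hle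
  exact S.exists_eLpNorm_sol_perp_le I hd A (ENNReal.one_le_ofReal.2 hp₀.le)
    (ENNReal.one_le_ofReal.2 hp₁1)
    (S.bounds.exists_eLpNorm_potential_iterate_le_of_one_div_eq hp₀ hp₀β hp₁)

theorem exists_eLpNorm_top_sol_perp_le {K K₀ : Set (Pt n)} (hK : closure K ⊆ interior K₀)
    (hK₀ : closure K₀ ⊆ Ω) :
    ∃ C : ℝ≥0, ∀ l, HasGap lam I d A l → ∀ f w : Pt n → ℝ, MemL1w γ Ω f →
      IsWeakSol γ lam φ l (perp lam φ l f) w →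
      eLpNorm w ∞ (volume.restrict K) ≤ C * (eLpNorm f ∞ (volume.restrict K₀)
        + eLpNorm (fun x => f x * bdist Ω x ^ γ) 1 (mu Ω)) := by
  have := S.isFiniteMeasure
  have hKΩ : K ⊆ Ω := (subset_closure.trans hK).trans
    (interior_subset.trans (subset_closure.trans hK₀))
  obtain ⟨ρ, hρ, hρK⟩ := ((S.isBounded.subset hKΩ).isCompact_closure).exists_thickening_subset_open
    isOpen_interior hK
  have hthick : Metric.thickening (ρ / 2 + ρ / 2) K ⊆ K₀ := by
    rw [add_halves]
    exact (Metric.thickening_subset_of_subset ρ subset_closure).trans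
      (hρK.trans interior_subset)
  obtain ⟨N, C, hC⟩ := S.exists_enorm_sol_perp_le_potentialSum I hd A
  obtain ⟨D, hD⟩ := S.exists_weight_le
  obtain ⟨B, hB⟩ := S.bounds.exists_potentialSum_le_on_thickening hD K (ρ / 2) (half_pos hρ) N
  refine ⟨C * B, fun l hl f w hf hw => ?_⟩
  rw [eLpNorm_one_mul_bdist_rpow S.γ_nonneg]
  have hsum := hB (fun y => ‖f y‖ₑ) (S.memL1w_iff.1 hf).1.enorm (eLpNorm f ∞ (volume.restrict K₀))
    (ae_restrict_of_ae (ae_enorm_le_eLpNorm_top_of_mem Metric.isOpen_thickening hthick))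
  have hbound : ∀ᵐ x ∂(mu Ω), x ∈ Metric.thickening (ρ / 2) K → ‖w x‖ₑ
      ≤ (C * B : ℝ≥0) * (eLpNorm f ∞ (volume.restrict K₀)
        + ∫⁻ y in Ω, ‖f y‖ₑ * (bdistNN Ω y : ℝ≥0∞) ^ γ) := by
    filter_upwards [hC l hl f w hf hw, hsum] with x hwx hx hxK
    rw [ENNReal.coe_mul, mul_assoc]
    exact hwx.trans (mul_le_mul' le_rfl (hx hxK))
  have hopen : MeasurableSet (Metric.thickening (ρ / 2) K) := Metric.isOpen_thickening.measurableSet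
  rw [← ae_restrict_iff' hopen, Measure.restrict_restrict hopen] at hbound
  exact eLpNormEssSup_le_of_ae_enorm_bound (ae_mono (Measure.restrict_mono_set volume
    (subset_inter (Metric.self_subset_thickening (half_pos hρ) K) hKΩ)) hbound)

end GreenSpectrum

end Estimates

lemma mul_max_sub_zero_lt {a b p : ℝ} (ha : 0 < a) (h : p * (a - b) < a) :
    p * max (a - b) 0 < a := by
  rcases max_choice (a - b) 0 with hmax | hmax <;> rw [hmax]
  exacts [h, by rwa [mul_zero]]

lemma one_sub_max_sub_zero_div {a b : ℝ} (ha : a ≠ 0) (hba : b ≤ a) :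
    1 - max (a - b) 0 / a = b / a := by
  rw [max_eq_left (sub_nonneg.2 hba), sub_div, div_self ha, sub_sub_cancel]

lemma mul_lt_of_one_le_of_lt_div {a b p : ℝ} (ha : 0 ≤ a) (hp : 1 ≤ p) (h : p < a / b) :
    p * b < a := by
  have hb : 0 < b := by
    by_contra! hb
    linarith [div_nonpos_of_nonneg_of_nonpos ha hb]
  exact (lt_div_iff₀ hb).1 h

end GreenEig

open GreenEig in
theorem mainTheorem2_general (n : ℕ) (hn : 1 ≤ n) (s γ : ℝ) (hs : 0 < s) (hγ : 0 ≤ γ)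
    (Ω : Set (Pt n)) (hΩo : IsOpen Ω) (hΩb : Bornology.IsBounded Ω)
    (L : L2 Ω →ₗ.[ℝ] L2 Ω) (G : Pt n → Pt n → ℝ) (hG : GreenBounds s γ Ω G)
    (hLG : IsGreenFunction L G) :
    (Ω.Nonempty → IsNonneg L →
      ∃ (lam : ℕ → ℝ) (φ : HilbertBasis ℕ ℝ (L2 Ω)), IsEigenSystem L lam φ) ∧
    ∀ (lam : ℕ → ℝ) (φ : HilbertBasis ℕ ℝ (L2 Ω)), IsEigenSystem L lam φ →
    (∀ l : ℝ, (∀ j, l ≠ lam j) → ∀ f : Pt n → ℝ, MemL1w γ Ω f →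
      (∃ u, IsWeakSol γ lam φ l f u ∧ ∀ v, IsWeakSol γ lam φ l f v → v =ᵐ[mu Ω] u) ∧
      (∀ j, Integrable (fun x => f x * φ j x) (mu Ω)) ∧
      (∃ w, IsWeakSol γ lam φ l (perp lam φ l f) w ∧
        ∀ v, IsWeakSol γ lam φ l (perp lam φ l f) v → v =ᵐ[mu Ω] w) ∧
      ∀ u w, IsWeakSol γ lam φ l f u → IsWeakSol γ lam φ l (perp lam φ l f) w →
        u =ᵐ[mu Ω] fun x => (∑ j ∈ Finset.range (lowCount lam l),
          pairing f (φ j) / (lam j - l) * φ j x) + w x) ∧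
    ∀ lb Λ : ℝ,
      (∃ C : ℝ≥0, ∀ l : ℝ, -Λ ≤ l → (∀ j, l ≠ lam j) → lamBar lam l = lb →
        ∀ f w : Pt n → ℝ, MemL1w γ Ω f → IsWeakSol γ lam φ l (perp lam φ l f) w →
          eLpNorm (fun x => w x * bdist Ω x ^ γ) 1 (mu Ω)
            ≤ C * eLpNorm (fun x => f x * bdist Ω x ^ γ) 1 (mu Ω)) ∧
      (∀ p : ℝ, 1 ≤ p → p * (n - 2 * s) < n →
        ∃ C : ℝ≥0, ∀ l : ℝ, -Λ ≤ l → (∀ j, l ≠ lam j) → lamBar lam l = lb →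
          ∀ f w : Pt n → ℝ, MemLp f 1 (mu Ω) → IsWeakSol γ lam φ l (perp lam φ l f) w →
            eLpNorm w (ENNReal.ofReal p) (mu Ω) ≤ C * eLpNorm f 1 (mu Ω)) ∧
      (∀ p₀ p₁ : ℝ, 1 < p₀ → p₀ < n / (2 * s) → 1 / p₁ = 1 / p₀ - 2 * s / n →
        ∃ C : ℝ≥0, ∀ l : ℝ, -Λ ≤ l → (∀ j, l ≠ lam j) → lamBar lam l = lb →
          ∀ f w : Pt n → ℝ, MemLp f (ENNReal.ofReal p₀) (mu Ω) →
            IsWeakSol γ lam φ l (perp lam φ l f) w →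
            eLpNorm w (ENNReal.ofReal p₁) (mu Ω)
              ≤ C * eLpNorm f (ENNReal.ofReal p₀) (mu Ω)) ∧
      (∀ K K₀ : Set (Pt n), closure K ⊆ interior K₀ → closure K₀ ⊆ Ω →
        ∃ C : ℝ≥0, ∀ l : ℝ, -Λ ≤ l → (∀ j, l ≠ lam j) → lamBar lam l = lb →
          ∀ f w : Pt n → ℝ, MemL1w γ Ω f → IsWeakSol γ lam φ l (perp lam φ l f) w →
            eLpNorm w ∞ (volume.restrict K)
              ≤ C * (eLpNorm f ∞ (volume.restrict K₀)
                + eLpNorm (fun x => f x * bdist Ω x ^ γ) 1 (mu Ω))) := by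
  have hn0 : (0 : ℝ) < n := Nat.cast_pos.2 hn
  have hK := hG.admissibleKernel hn hs hγ hΩo hΩb
  refine ⟨fun hΩne hL => hK.exists_isEigenSystem hΩne hL hLG, fun lam φ hφ => ?_⟩
  obtain ⟨T, S⟩ := hK.exists_greenSpectrum hLG hφ
  refine ⟨fun l hl f hf => ⟨S.exists_isWeakSol_forall_ae_eq hl hf,
    fun j => S.integrable_mul hf (S.memWLinf_basis j),
    S.exists_isWeakSol_forall_ae_eq hl (S.memL1w_perp l hf),
    fun u w hu hw => S.ae_eq_sum_add hl hu hw⟩, fun lb Λ => ?_⟩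
  obtain ⟨I, d, A, hd, hgap⟩ := exists_hasGap hφ.mono hφ.tendsto lb Λ
  refine ⟨?weighted, fun p hp hpn => ?fromLOne, fun p₀ p₁ hp₀ hp₀n hp₁ => ?sobolev,
    fun K K₀ hKK₀ hK₀ => ?interior⟩
  case weighted =>
    exact (S.exists_eLpNorm_sol_perp_mul_bdist_rpow_le I hd A).imp
      fun C hC l hΛ hl hlb => hC l (hgap l hΛ hl hlb)
  case fromLOne =>
    exact (S.exists_eLpNorm_sol_perp_le_eLpNorm_one I hd A hp (mul_max_sub_zero_lt hn0 hpn)).imp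
      fun C hC l hΛ hl hlb => hC l (hgap l hΛ hl hlb)
  case sobolev =>
    rw [lt_div_iff₀ (by positivity)] at hp₀n
    have hβ := one_sub_max_sub_zero_div hn0.ne' (b := 2 * s) (by nlinarith)
    have hp₀β : p₀ * (2 * s / n) < 1 := by rwa [mul_div_assoc', div_lt_one hn0]
    rw [← hβ] at hp₀β hp₁
    exact (S.exists_eLpNorm_sol_perp_le_of_one_div_eq I hd A hp₀ hp₀β hp₁).imp
      fun C hC l hΛ hl hlb => hC l (hgap l hΛ hl hlb)
  case interior =>
    exact (S.exists_eLpNorm_top_sol_perp_le I hd A hKK₀ hK₀).imp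
      fun C hC l hΛ hl hlb => hC l (hgap l hΛ hl hlb)

open GreenEig in
theorem mainTheorem2 (n : ℕ) (hn : 1 ≤ n) (s γ : ℝ) (hs0 : 0 < s) (hs1 : s < 1)
    (hγ0 : 0 < γ) (hγ1 : γ ≤ 1) (hns : (n : ℝ) ≠ 2 * s)
    (Ω : Set (Pt n)) (hΩo : IsOpen Ω) (hΩb : Bornology.IsBounded Ω) (hΩne : Ω.Nonempty)
    (L : L2 Ω →ₗ.[ℝ] L2 Ω) (hL : IsNonneg L)
    (G : Pt n → Pt n → ℝ) (hG : GreenBounds s γ Ω G) (hLG : IsGreenFunction L G) :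
    -- `L` has a discrete spectrum and an orthonormal basis of eigenfunctions
    (∃ (lam : ℕ → ℝ) (φ : HilbertBasis ℕ ℝ (L2 Ω)), IsEigenSystem L lam φ) ∧
    ∀ (lam : ℕ → ℝ) (φ : HilbertBasis ℕ ℝ (L2 Ω)), IsEigenSystem L lam φ →
    -- existence, uniqueness and representation
    (∀ l : ℝ, (∀ j, l ≠ lam j) → ∀ f : Pt n → ℝ, MemL1w γ Ω f →
      (∃ u, IsWeakSol γ lam φ l f u ∧ ∀ v, IsWeakSol γ lam φ l f v → v =ᵐ[mu Ω] u) ∧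
      (∀ j, Integrable (fun x => f x * φ j x) (mu Ω)) ∧
      (∃ w, IsWeakSol γ lam φ l (perp lam φ l f) w ∧
        ∀ v, IsWeakSol γ lam φ l (perp lam φ l f) v → v =ᵐ[mu Ω] w) ∧
      ∀ u w, IsWeakSol γ lam φ l f u → IsWeakSol γ lam φ l (perp lam φ l f) w →
        u =ᵐ[mu Ω] fun x => (∑ j ∈ Finset.range (lowCount lam l),
          pairing f (φ j) / (lam j - l) * φ j x) + w x) ∧
    -- estimates of `w = u^⊥`, uniform in `l ≥ -Λ` outside the spectrum with a given `lamBar`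
    ∀ lb Λ : ℝ,
      (∃ C : ℝ≥0, ∀ l : ℝ, -Λ ≤ l → (∀ j, l ≠ lam j) → lamBar lam l = lb →
        ∀ f w : Pt n → ℝ, MemL1w γ Ω f → IsWeakSol γ lam φ l (perp lam φ l f) w →
          eLpNorm (fun x => w x * bdist Ω x ^ γ) 1 (mu Ω)
            ≤ C * eLpNorm (fun x => f x * bdist Ω x ^ γ) 1 (mu Ω)) ∧
      (∀ p : ℝ, 1 ≤ p → p < n / (n - 2 * s) →
        ∃ C : ℝ≥0, ∀ l : ℝ, -Λ ≤ l → (∀ j, l ≠ lam j) → lamBar lam l = lb →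
          ∀ f w : Pt n → ℝ, MemLp f 1 (mu Ω) → IsWeakSol γ lam φ l (perp lam φ l f) w →
            eLpNorm w (ENNReal.ofReal p) (mu Ω) ≤ C * eLpNorm f 1 (mu Ω)) ∧
      (∀ p₀ p₁ : ℝ, 1 < p₀ → p₀ < n / (2 * s) → 1 / p₁ = 1 / p₀ - 2 * s / n →
        ∃ C : ℝ≥0, ∀ l : ℝ, -Λ ≤ l → (∀ j, l ≠ lam j) → lamBar lam l = lb →
          ∀ f w : Pt n → ℝ, MemLp f (ENNReal.ofReal p₀) (mu Ω) →
            IsWeakSol γ lam φ l (perp lam φ l f) w →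
            eLpNorm w (ENNReal.ofReal p₁) (mu Ω)
              ≤ C * eLpNorm f (ENNReal.ofReal p₀) (mu Ω)) ∧
      (∀ K K₀ : Set (Pt n), closure K ⊆ interior K₀ → closure K₀ ⊆ Ω →
        ∃ C : ℝ≥0, ∀ l : ℝ, -Λ ≤ l → (∀ j, l ≠ lam j) → lamBar lam l = lb →
          ∀ f w : Pt n → ℝ, MemL1w γ Ω f → MemLinfLoc Ω f →
            IsWeakSol γ lam φ l (perp lam φ l f) w →
            eLpNorm w ∞ (volume.restrict K)
              ≤ C * (eLpNorm f ∞ (volume.restrict K₀)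
                + eLpNorm (fun x => f x * bdist Ω x ^ γ) 1 (mu Ω))) := by
  obtain ⟨hexists, hsol⟩ := mainTheorem2_general n hn s γ hs0 hγ0.le Ω hΩo hΩb L G hG hLG
  refine ⟨hexists hΩne hL, fun lam φ hφ => ⟨(hsol lam φ hφ).1, fun lb Λ => ?_⟩⟩
  obtain ⟨hweighted, hfromLOne, hsobolev, hinterior⟩ := (hsol lam φ hφ).2 lb Λ
  exact ⟨hweighted,
    fun p hp hpn => hfromLOne p hp (mul_lt_of_one_le_of_lt_div n.cast_nonneg hp hpn), hsobolev,
    fun K K₀ hK hK₀ => (hinterior K K₀ hK hK₀).imp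
      fun C hC l hΛ hl hlb f w hf _ => hC l hΛ hl hlb f w hf⟩
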